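/- **Setting.** Let $\mathbb T^d=\mathbb R^d/\mathbb Z^d$, $Q_T=\mathbb T^d\times(0,T)$, $T>0$, and consider the mean field games system $$\begin{cases}-u_t+H(x,D_xu)=f(x,m),\quad m_t-\operatorname{div}(mD_pH(x,D_xu))=0 & \text{in }Q_T,\\ m(x,0)=m_0(x),\quad u(x,T)=g(x,m(x,T)) & x\in\mathbb T^d.\end{cases}\tag{MFG}$$ Let $C_0>0$ and $0\le\tau<1$ be constants, and assume the following. * **(M)** $m_0\in C^4(\mathbb T^d)$, $m_0>0$, $\int_{\mathbb T^d}m_0=1$. * **(H)** $H:\mathbb T^d\times\mathbb R^d\to\mathbb R$; $H,D_pH,D^2_{pp}H$ are of class $C^4$ and, for all $(x,p)$: $\frac1{C_0}I\le D^2_{pp}H\le C_0I$; $D_pH\cdot p\ge 2H-C_0$; $|D^3_{ppp}H|\le C_0(1+|p|)^{-1}$; $|D^3_{xxp}H|\le C_0(1+|p|)^{\tau}$; $|D^3_{xpp}H|\le C_0(1+|p|)^{\tau-1}$. * **(F′)** $f:\mathbb T^d\times[0,\infty)\to[-\infty,\infty)$ is continuous, strictly increasing in $m$, finite and $C^4$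 on $\mathbb T^d\times(0,\infty)$ with $f_m>0$ there; $\liminf_{x\in\mathbb T^d,\,m\to\infty}mf_m(x,m)>0$; and for $m>0$, $|m(D_xf)_m|\le C_0|D_xf|$ and $|D_xf|,|D^2_{xx}f|\le C_0(1+|f|^{\tau/2}+|mf_m|^{(1+\tau)/2})$. (The bound $|mf_{mm}|\le C_0f_m$, equivalently a bound on $\chi_w$, is **not** assumed.) * **(G)** $g:\mathbb T^d\times[0,\infty)\to[-\infty,\infty)$ is continuous, strictly increasing in $m$, finite and $C^4$ on $\mathbb T^d\times(0,\infty)$ with $g_m>0$ there; and for each $x$, $\lim_{m\to\infty}g(x,m)=\sup g$ and $g(x,0)=\inf g$, the supremum and infimum being over $\mathbb T^d\times[0,\infty)$. * **(SE)** $f(\cdot,0)\equiv-\infty$. * **(HFX\*)** $D^2_{xp}H\equiv0$, $D^2_{xm}f\equiv0$, and $\limsup_{x\in\mathbb T^d,\,w\to\infty}|h_w(x,w)|<\infty$, where, with $f^{-1}(x,\cdot)$ the inverse of $f(x,\cdot)$, $\chi(x,w)=f^{-1}(x,w)\,f_m(x,f^{-1}(x,w))$ and $h=\sqrt\chi$.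 * **Normalisation of $C_0$.** $C_0$ is taken so large that also, for all $(x,p)$, $\frac1{C_0}|p|^2-C_0\le H\le C_0|p|^2+C_0$, $|D_pH|\le C_0(1+|p|)$, $|D_xH|,|D^2_{xx}H|\le C_0(1+|p|^{1+\tau})$, $|D^2_{xp}H|\le C_0(1+|p|)^\tau$, and $\|\chi(\cdot,0)\|_{C^0}+\|m_0\|_{C^1}+\|f\|_{C^2(\mathbb T^d\times[\min m_0,\max m_0])}\le C_0$. For $m>0$ put $f_0(m)=\min_xf(x,m)$, $f_1(m)=\max_xf(x,m)$, $g_0(m)=\min_xg(x,m)$, $g_1(m)=\max_xg(x,m)$, and write $r^-=\max(-r,0)$. For $K>0$ put $$\beta_K=\|f\|_{C^1(\mathbb T^d\times[\frac1K,K])}+\|D_xg\|_{C^1(\mathbb T^d\times[\frac1K,K])}+\|1/\chi\|_{C^0(\mathbb T^d\times[-K,\infty))}+\|h_w\|_{C^0(\mathbb T^d\times[-K,\infty))}.$$ We write $C=C(a_1,\dots,a_n)$ for a positive constant that, besides the dimension $d$, depends only on the nonnegative quantities $a_1,\dots,a_n$, and is nondecreasing in each of them. **Theorem.** There exist constants $$L_1=L_1(C_0,\tau,T),\qquad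 L=L\Big(L_1,\ |g_1f_0^{-1}(L_1)|,\ |g_0f_1^{-1}(-L_1)|,\ g_0^{-1}g_1f_0^{-1}(L_1),\ \frac1{g_1^{-1}g_0f_1^{-1}(-L_1)}\Big),$$ $$K_1=K_1\big(L,\ f_0(1/L)^-,\ 1/T\big),\qquad K=K(K_1,\beta_{K_1}),$$ such that, under the above assumptions, every solution $(u,m)\in C^3(\overline{Q_T})\times C^2(\overline{Q_T})$ of (MFG), with $m\ge0$, satisfies $m(\cdot,T)>0$, $\beta_{K_1}<\infty$, $$\|u\|_{C^0(\overline{Q_T})}+\|m(\cdot,T)\|_{C^0(\mathbb T^d)}+\Big\|\frac1{m(\cdot,T)}\Big\|_{C^0(\mathbb T^d)}\le L\qquad\text{and}\qquad\|Du\|_{C^0(\overline{Q_T})}\le K,$$ where $Du=(D_xu,u_t)$. -/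

import Mathlib

open Set Filter Topology MeasureTheory
open scoped ENNReal

noncomputable section

namespace MFG

/-- `ℝᵈ` with its Euclidean norm. Functions on the flat torus `𝕋ᵈ = ℝᵈ / ℤᵈ` are represented by
their `ℤᵈ`-periodic lifts to `ℝᵈ`. -/
abbrev E (d : ℕ) : Type := EuclideanSpace ℝ (Fin d)

/-- `ℤᵈ`-periodicity. -/
def IsPeriodic {d : ℕ} {α : Type*} (F : E d → α) : Prop :=
  ∀ (x : E d) (i : Fin d), F (x + EuclideanSpace.single i 1) = F x

/-- The unit cube, a fundamental domain of the torus. -/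
def unitCube (d : ℕ) : Set (E d) := {x | ∀ i, x i ∈ Icc (0 : ℝ) 1}

/-! ### Derivatives and norms -/

section Derivatives

variable {d : ℕ}

/-- The gradient in the first (space) variable, `D_x F (x, a)`. -/
def gradX {α : Type*} (F : E d → α → ℝ) (x : E d) (a : α) : E d := gradient (fun y => F y a) x

/-- The second space derivative, `D²_{xx} F (x, a)`. -/
def hessX {α : Type*} (F : E d → α → ℝ) (x : E d) (a : α) : E d →L[ℝ] E d :=
  fderiv ℝ (fun y => gradX F y a) x

/-- `D_p H (x, p)`. -/
def gradP (H : E d → E d → ℝ) (x p : E d) : E d := gradient (H x) p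

/-- `D²_{pp} H (x, p)`. -/
def hessP (H : E d → E d → ℝ) (x p : E d) : E d →L[ℝ] E d := fderiv ℝ (gradP H x) p

/-- `D²_{xp} H (x, p)`. -/
def derXP (H : E d → E d → ℝ) (x p : E d) : E d →L[ℝ] E d := fderiv ℝ (fun y => gradP H y p) x

/-- `D³_{ppp} H (x, p)`. -/
def derPPP (H : E d → E d → ℝ) (x p : E d) : E d →L[ℝ] E d →L[ℝ] E d :=
  fderiv ℝ (hessP H x) p

/-- `D³_{xxp} H (x, p)`. -/
def derXXP (H : E d → E d → ℝ) (x p : E d) : E d →L[ℝ] E d →L[ℝ] E d :=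
  fderiv ℝ (fun y => derXP H y p) x

/-- `D³_{xpp} H (x, p)`. -/
def derXPP (H : E d → E d → ℝ) (x p : E d) : E d →L[ℝ] E d →L[ℝ] E d :=
  fderiv ℝ (fun y => hessP H y p) x

/-- The divergence of a vector field on `ℝᵈ`. -/
def divergence (F : E d → E d) (x : E d) : ℝ :=
  ∑ i, (fderiv ℝ F x (EuclideanSpace.single i 1)) i

end Derivatives

/-- The `C⁰` norm of `F` on `S`, as an extended nonnegative number. -/
def supNorm {X V : Type*} [NormedAddCommGroup V] (F : X → V) (S : Set X) : ℝ≥0∞ :=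
  ⨆ z ∈ S, ‖F z‖ₑ

/-- The `Cᵏ` norm of `F` on `S`: the sum of the sup norms of the derivatives of order `≤ k`. -/
def ckNorm {X V : Type*} [NormedAddCommGroup X] [NormedSpace ℝ X] [NormedAddCommGroup V]
    [NormedSpace ℝ V] (k : ℕ) (F : X → V) (S : Set X) : ℝ≥0∞ :=
  ∑ j ∈ Finset.range (k + 1), supNorm (iteratedFDeriv ℝ j F) S

/-! ### The functions derived from the data -/

section Derived

variable {d : ℕ}

/-- The real-valued function `(x, m) ↦ f (x, m)` on `𝕋ᵈ × (0, ∞)`, for a coupling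
`f : 𝕋ᵈ × [0, ∞) → [-∞, ∞)` (the latter is finite for `m > 0`). -/
def re (f : E d → ℝ → EReal) (x : E d) (m : ℝ) : ℝ := (f x m).toReal

/-- `f_m (x, m)`. -/
def derM (f : E d → ℝ → EReal) (x : E d) (m : ℝ) : ℝ := deriv (re f x) m

/-- The mixed derivative `(D_x f)_m (x, m)`. -/
def derXM (f : E d → ℝ → EReal) (x : E d) (m : ℝ) : E d := deriv (fun n => gradX (re f) x n) m

/-- The inverse of a function that is injective on `(0, ∞)`. -/
def inv (φ : ℝ → ℝ) (w : ℝ) : ℝ := Function.invFunOn φ (Ioi 0) w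

/-- `χ(x, w) = f⁻¹(x, w) f_m(x, f⁻¹(x, w))`, where `f⁻¹(x, ·)` is the inverse of `f(x, ·)`. -/
def chi (f : E d → ℝ → EReal) (x : E d) (w : ℝ) : ℝ :=
  inv (re f x) w * derM f x (inv (re f x) w)

/-- `h = √χ`. -/
def hfun (f : E d → ℝ → EReal) (x : E d) (w : ℝ) : ℝ := √(chi f x w)

/-- `h_w`. -/
def hfunW (f : E d → ℝ → EReal) (x : E d) (w : ℝ) : ℝ := deriv (hfun f x) w

/-- `f₀(m) = min_x f(x, m)`. -/
def minX (f : E d → ℝ → EReal) (m : ℝ) : ℝ := ⨅ x, re f x m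

/-- `f₁(m) = max_x f(x, m)`. -/
def maxX (f : E d → ℝ → EReal) (m : ℝ) : ℝ := ⨆ x, re f x m

/-- `β_K = ‖f‖_{C¹(𝕋ᵈ×[1/K,K])} + ‖D_x g‖_{C¹(𝕋ᵈ×[1/K,K])} + ‖1/χ‖_{C⁰(𝕋ᵈ×[-K,∞))}
  + ‖h_w‖_{C⁰(𝕋ᵈ×[-K,∞))}`. -/
def beta (f g : E d → ℝ → EReal) (K : ℝ) : ℝ≥0∞ :=
  ckNorm 1 (fun z : E d × ℝ => re f z.1 z.2) (univ ×ˢ Icc (1 / K) K)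
  + ckNorm 1 (fun z : E d × ℝ => gradX (re g) z.1 z.2) (univ ×ˢ Icc (1 / K) K)
  + supNorm (fun z : E d × ℝ => 1 / chi f z.1 z.2) (univ ×ˢ Ici (-K))
  + supNorm (fun z : E d × ℝ => hfunW f z.1 z.2) (univ ×ˢ Ici (-K))

end Derived

/-! ### The assumptions -/

section Assumptions

variable {d : ℕ}

/-- Assumptions (M) on the initial density. -/
structure AssumptionM (m₀ : E d → ℝ) : Prop where
  periodic : IsPeriodic m₀
  smooth : ContDiff ℝ 4 m₀
  pos : ∀ x, 0 < m₀ x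
  mass : ∫ x in unitCube d, m₀ x = 1

/-- Assumptions (H) on the Hamiltonian. -/
structure AssumptionH (C₀ τ : ℝ) (H : E d → E d → ℝ) : Prop where
  periodic : IsPeriodic H
  smooth : ContDiff ℝ 4 (fun z : E d × E d => H z.1 z.2)
  smooth_gradP : ContDiff ℝ 4 (fun z : E d × E d => gradP H z.1 z.2)
  smooth_hessP : ContDiff ℝ 4 (fun z : E d × E d => hessP H z.1 z.2)
  convex : ∀ x p ξ : E d, 1 / C₀ * ‖ξ‖ ^ 2 ≤ inner ℝ (hessP H x p ξ) ξ ∧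
    inner ℝ (hessP H x p ξ) ξ ≤ C₀ * ‖ξ‖ ^ 2
  quadratic : ∀ x p, 2 * H x p - C₀ ≤ inner ℝ (gradP H x p) p
  third : ∀ x p, ‖derPPP H x p‖ ≤ C₀ * (1 + ‖p‖)⁻¹
  oscXXP : ∀ x p, ‖derXXP H x p‖ ≤ C₀ * (1 + ‖p‖) ^ τ
  oscXPP : ∀ x p, ‖derXPP H x p‖ ≤ C₀ * (1 + ‖p‖) ^ (τ - 1)

/-- The part of assumptions (F) and (G) common to `f` and `g`: a continuous function
`𝕋ᵈ × [0, ∞) → [-∞, ∞)`, `C⁴` on `𝕋ᵈ × (0, ∞)`, strictly increasing in `m` with positive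
`m`-derivative. -/
structure IsCoupling (f : E d → ℝ → EReal) : Prop where
  periodic : IsPeriodic f
  ne_top : ∀ x, ∀ m, 0 ≤ m → f x m ≠ ⊤
  continuous : ContinuousOn (fun z : E d × ℝ => f z.1 z.2) (univ ×ˢ Ici 0)
  smooth : ContDiffOn ℝ 4 (fun z : E d × ℝ => re f z.1 z.2) (univ ×ˢ Ioi 0)
  strictMono : ∀ x, StrictMonoOn (f x) (Ici 0)
  derM_pos : ∀ x, ∀ m, 0 < m → 0 < derM f x m

/-- Assumptions (F) on the running cost, except for the upper polynomial growth bound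
`|χ_w| ≤ C₀`. The field `growth` is `liminf_{x, m → ∞} m f_m(x, m) > 0`. -/
structure AssumptionF (C₀ τ : ℝ) (f : E d → ℝ → EReal) : Prop where
  coupling : IsCoupling f
  growth : ∃ c > 0, ∀ᶠ m in atTop, ∀ x, c ≤ m * derM f x m
  oscXM : ∀ x, ∀ m, 0 < m → ‖m • derXM f x m‖ ≤ C₀ * ‖gradX (re f) x m‖
  oscX : ∀ x, ∀ m, 0 < m →
    ‖gradX (re f) x m‖ ≤ C₀ * (1 + |re f x m| ^ (τ / 2) + |m * derM f x m| ^ ((1 + τ) / 2))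
  oscXX : ∀ x, ∀ m, 0 < m →
    ‖hessX (re f) x m‖ ≤ C₀ * (1 + |re f x m| ^ (τ / 2) + |m * derM f x m| ^ ((1 + τ) / 2))

/-- Assumptions (G) on the terminal cost. Suprema and infima are taken in `[-∞, ∞]`. -/
structure AssumptionG (g : E d → ℝ → EReal) : Prop where
  coupling : IsCoupling g
  tendsto_sup : ∀ x, Tendsto (g x) atTop (𝓝 (⨆ y, ⨆ m ∈ Ici (0 : ℝ), g y m))
  zero_eq_inf : ∀ x, g x 0 = ⨅ y, ⨅ m ∈ Ici (0 : ℝ), g y m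

/-- Strict ellipticity: `f(·, 0) ≡ -∞`. -/
def StrictlyElliptic (f : E d → ℝ → EReal) : Prop := ∀ x, f x 0 = ⊥

/-- The separated-potential condition: `D²_{xp} H ≡ 0`, `D²_{xm} f ≡ 0` and
`limsup_{x, w → ∞} |h_w(x, w)| < ∞`. -/
structure SeparatedPotential (H : E d → E d → ℝ) (f : E d → ℝ → EReal) : Prop where
  derXP_eq : ∀ x p, derXP H x p = 0
  derXM_eq : ∀ x, ∀ m, 0 < m → derXM f x m = 0
  limsup_hW : ∃ C : ℝ, ∀ᶠ w in atTop, ∀ x, |hfunW f x w| ≤ C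

/-- The normalisation of the constant `C₀`: it is taken so large that these inequalities, which
hold for some constant under the other assumptions, hold with `C₀` itself. -/
structure Normalised (C₀ τ : ℝ) (H : E d → E d → ℝ) (f : E d → ℝ → EReal) (m₀ : E d → ℝ) :
    Prop where
  lower : ∀ x p, 1 / C₀ * ‖p‖ ^ 2 - C₀ ≤ H x p
  upper : ∀ x p, H x p ≤ C₀ * ‖p‖ ^ 2 + C₀
  boundP : ∀ x p, ‖gradP H x p‖ ≤ C₀ * (1 + ‖p‖)
  boundX : ∀ x p, ‖gradX H x p‖ ≤ C₀ * (1 + ‖p‖ ^ (1 + τ))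
  boundXX : ∀ x p, ‖hessX H x p‖ ≤ C₀ * (1 + ‖p‖ ^ (1 + τ))
  boundXP : ∀ x p, ‖derXP H x p‖ ≤ C₀ * (1 + ‖p‖) ^ τ
  bound_data : supNorm (fun x => chi f x 0) univ + ckNorm 1 m₀ univ
    + ckNorm 2 (fun z : E d × ℝ => re f z.1 z.2) (univ ×ˢ Icc (⨅ x, m₀ x) (⨆ x, m₀ x))
    ≤ ENNReal.ofReal C₀

end Assumptions

/-! ### Classical solutions -/

section Solutions

variable {d : ℕ}

/-- The time derivative on `[0, T]`, one-sided at the end points. -/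
def derT (T : ℝ) (u : E d → ℝ → ℝ) (x : E d) (t : ℝ) : ℝ := derivWithin (u x) (Icc 0 T) t

/-- The Euclidean norm of the space-time gradient `Du = (D_x u, u_t)`. -/
def normDu (T : ℝ) (u : E d → ℝ → ℝ) (x : E d) (t : ℝ) : ℝ :=
  √(‖gradX u x t‖ ^ 2 + derT T u x t ^ 2)

/-- `(u, m) ∈ C³(Q̄_T) × C²(Q̄_T)` is a solution of the mean field games system
`-u_t + H(x, D_x u) = f(x, m)`, `m_t - div(m D_p H(x, D_x u)) = 0` in `Q_T = 𝕋ᵈ × (0, T)`,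
`m(·, 0) = m₀`, `u(·, T) = g(·, m(·, T))`. -/
structure IsSolution (T : ℝ) (H : E d → E d → ℝ) (f g : E d → ℝ → EReal) (m₀ : E d → ℝ)
    (u m : E d → ℝ → ℝ) : Prop where
  periodic_u : ∀ t ∈ Icc 0 T, IsPeriodic (fun x => u x t)
  periodic_m : ∀ t ∈ Icc 0 T, IsPeriodic (fun x => m x t)
  smooth_u : ContDiffOn ℝ 3 (fun z : E d × ℝ => u z.1 z.2) (univ ×ˢ Icc 0 T)
  smooth_m : ContDiffOn ℝ 2 (fun z : E d × ℝ => m z.1 z.2) (univ ×ˢ Icc 0 T)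
  nonneg : ∀ x, ∀ t ∈ Icc 0 T, 0 ≤ m x t
  hamiltonJacobi : ∀ x, ∀ t ∈ Ioo 0 T,
    ((-derT T u x t + H x (gradX u x t) : ℝ) : EReal) = f x (m x t)
  transport : ∀ x, ∀ t ∈ Ioo 0 T,
    derT T m x t - divergence (fun y => m y t • gradP H y (gradX u y t)) x = 0
  initial : ∀ x, m x 0 = m₀ x
  terminal : ∀ x, ((u x T : ℝ) : EReal) = g x (m x T)

end Solutions

/-- `C` is a positive constant depending monotonically on `n` quantities, which range over the
set `S`. -/
def IsMonotoneConstant {n : ℕ} (C : (Fin n → ℝ) → ℝ) (S : Set (Fin n → ℝ)) : Prop :=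
  MonotoneOn C S ∧ ∀ v ∈ S, 0 < C v

end MFG

end

noncomputable section

namespace MFG

/-! ### Elementary calculus -/

/-! The two vanishing mixed derivatives separate variables. With `h = H(0,·)`, `F = f(0,·)` and a
potential `P(x)` built from `f(x,n) - f(0,n)` and `H(x,0) - H(0,0)`, the system becomes `-u_t +
h(D_x u) - P = F(m)` with velocity `b = Dh(D_x u)` (`IsSolution.reducedSystem`). The density is
positive up to the boundary because `f(·,0) = -∞`. Differentiating the Hamilton-Jacobi equation
along `ξ = (-b, 1)` and inserting the transport equation gives an elliptic equation for `u` alone,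
`D²u(ξ,ξ) + X div b = DP·b` with `X = mF'(m) > 0` (`ReducedSystem.pde`).

Bounds on `u` and on `m(·,T)`. Adding a convex increasing quadratic in `t` to `±u` forces the
maximum to time `T` (`ReducedSystem.exists_terminal_max`). There `D_x u = 0` and `u_t` is bounded on
one side, so the Hamilton-Jacobi equation bounds `f(x, m(x,T))` at that one point. Comparing through
`u(·,T) = g(·, m(·,T))`, monotonicity of `g` spreads this to the whole torus
(`Setting.upper_bounds`, `Setting.lower_bounds`).

Gradient bound. Since `P` does not depend on time, `u_t` solves a linear equation without zeroth
order term, hence is extremal at the end times (`ReducedSystem.time_deriv_le`). The space gradient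
is handled by Bernstein's method for `S = h(D_x u) - P + k(u + ct - c₀)²`. Writing `h(D_x u) - P =
u_t + F(m)`, the bound on `u_t` from the end times by `max S` shows that `F(m)` is bounded below at
the maximum of `S`. This puts the maximum in the range `w ≥ -K₁` where `h_w` is controlled, so that
`|(nF'(n))'| ≤ N F'(n) √(nF'(n))` holds there; no bound on `χ_w` is needed.

At an interior maximum the first order condition makes `D²u b` of linear growth in `D_x u` and gives
`F'(m) D_x m·b = ζ s`, where `ζ = 2k(u + ct - c₀)` and `s` is the derivative of `u + ct` along `ξ`.
The second order tests combined with the differentiated equation leave the good terms `2k s²`, of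
order `k|D_x u|⁴`, and `X` times squares of second derivatives (`ReducedSystem.bernstein_ineq`). The
drift and the third derivatives of `h` are absorbed by Young's inequality for small `k`
(`ReducedSystem.interior_arith`). At times `0` and `T` the sign of `u + ct - c₀` and the boundary
data exclude large gradients (`ReducedSystem.mom_le_of_max`). The maximum of `S` then controls the
energy everywhere, and the end times control `u_t` (`ReducedSystem.gradient_bound`). -/

/-- First and second order necessary conditions at a local maximum on the line. -/
lemma second_deriv_nonpos_of_isLocalMax {σ σ₁ : ℝ → ℝ} {σ₂ : ℝ} (hmax : IsLocalMax σ 0)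
    (h1 : ∀ᶠ s in 𝓝 (0 : ℝ), HasDerivAt σ (σ₁ s) s) (h2 : HasDerivAt σ₁ σ₂ 0) :
    σ₁ 0 = 0 ∧ σ₂ ≤ 0 := by
  have h0 : σ₁ 0 = 0 := hmax.hasDerivAt_eq_zero h1.self_of_nhds
  refine ⟨h0, ?_⟩
  -- If `σ₂` were positive, `0` would be a local minimum as well, so `σ` would be locally constant
  -- and `σ₂` would vanish.
  by_contra! hpos
  have hd : deriv σ =ᶠ[𝓝 0] σ₁ := h1.mono fun s hs => hs.deriv
  have hdd : deriv (deriv σ) 0 = σ₂ := by rw [hd.deriv_eq, h2.deriv]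
  have hmin : IsLocalMin σ 0 :=
    isLocalMin_of_deriv_deriv_pos (hdd ▸ hpos) (h1.self_of_nhds.deriv.trans h0)
      h1.self_of_nhds.continuousAt
  have hc : σ =ᶠ[𝓝 0] fun _ => σ 0 := by
    filter_upwards [hmax, hmin] with s h1 h2 using le_antisymm h1 h2
  have hc1 : deriv σ =ᶠ[𝓝 0] fun _ => (0 : ℝ) := by
    filter_upwards [hc.eventuallyEq_nhds] with s hs
    rw [hs.deriv_eq, deriv_const]
  have : deriv (deriv σ) 0 = 0 := by rw [hc1.deriv_eq, deriv_const]
  linarith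

variable {d : ℕ}

/-- The representative in the unit cube of a point of `ℝᵈ` modulo `ℤᵈ`. -/
def toCube (x : E d) : E d := WithLp.toLp 2 fun i => Int.fract (x i)

lemma toCube_mem (x : E d) : toCube x ∈ unitCube d := fun i =>
  ⟨Int.fract_nonneg (x i), (Int.fract_lt_one (x i)).le⟩

lemma IsPeriodic.add_int_smul {α : Type*} {F : E d → α} (hF : IsPeriodic F) (x : E d) (i : Fin d)
    (n : ℤ) : F (x + n • EuclideanSpace.single i (1 : ℝ)) = F x := by
  have : Function.Periodic F (EuclideanSpace.single i (1 : ℝ)) := fun y => hF y i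
  exact this.zsmul n x

lemma IsPeriodic.apply_toCube {α : Type*} {F : E d → α} (hF : IsPeriodic F) (x : E d) :
    F (toCube x) = F x := by
  -- Periodicity is given along basis vectors only, so the integer parts are restored one coordinate
  -- at a time.
  have key : ∀ s : Finset (Fin d), F (toCube x + ∑ i ∈ s, ⌊x i⌋ • EuclideanSpace.single i (1 : ℝ))
      = F (toCube x) := by
    intro s
    induction s using Finset.induction_on with
    | empty => simp
    | insert i s hi ih => rw [Finset.sum_insert hi, add_comm (_ • _), ← add_assoc,
        hF.add_int_smul, ih]
  rw [← key Finset.univ]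
  congr 1
  ext j
  have h1 : ∀ i, ⌊x i⌋ • (Pi.single i (1 : ℝ) : Fin d → ℝ) j = if j = i then (⌊x i⌋ : ℝ) else 0 := by
    intro i
    rw [Pi.single_apply]
    split_ifs <;> simp
  have h2 := Int.fract_add_floor (x j)
  simp only [toCube, PiLp.add_apply, WithLp.ofLp_sum, WithLp.ofLp_smul, Finset.sum_apply,
    Pi.smul_apply, PiLp.ofLp_single, h1, Finset.sum_ite_eq, Finset.mem_univ, if_true]
  exact h2

lemma isCompact_unitCube : IsCompact (unitCube d) := by
  have : unitCube d = (EuclideanSpace.equiv (Fin d) ℝ).symm '' (Set.pi univ fun _ => Icc 0 1) := by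
    ext x
    constructor
    · intro h
      exact ⟨EuclideanSpace.equiv (Fin d) ℝ x, fun i _ => h i, by simp⟩
    · rintro ⟨y, hy, rfl⟩
      exact fun i => hy i (mem_univ i)
  rw [this]
  exact (isCompact_univ_pi fun _ => isCompact_Icc).image (ContinuousLinearEquiv.continuous _)

lemma unitCube_nonempty : (unitCube d).Nonempty := ⟨toCube 0, toCube_mem 0⟩

/-- A continuous periodic function attains its maximum. -/
lemma IsPeriodic.exists_forall_le {F : E d → ℝ} (hF : IsPeriodic F) (hc : Continuous F) :
    ∃ x ∈ unitCube d, ∀ y, F y ≤ F x := by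
  obtain ⟨x, hx, hmax⟩ := isCompact_unitCube.exists_isMaxOn unitCube_nonempty hc.continuousOn
  exact ⟨x, hx, fun y => hF.apply_toCube y ▸ hmax (toCube_mem y)⟩

lemma IsPeriodic.exists_forall_ge {F : E d → ℝ} (hF : IsPeriodic F) (hc : Continuous F) :
    ∃ x ∈ unitCube d, ∀ y, F x ≤ F y := by
  obtain ⟨x, hx, h⟩ := IsPeriodic.exists_forall_le (F := fun y => - F y)
    (fun x i => by simp [hF x i]) hc.neg
  exact ⟨x, hx, fun y => by have := h y; simpa using this⟩

/-- The closed space-time cylinder (over the universal cover of the torus). -/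
def slab (d : ℕ) (T : ℝ) : Set (E d × ℝ) := univ ×ˢ Icc 0 T

lemma mem_slab {T : ℝ} {z : E d × ℝ} : z ∈ slab d T ↔ z.2 ∈ Icc 0 T := by simp [slab]

/-- A continuous periodic function on the closed cylinder attains its maximum. -/
lemma exists_isMaxOn_slab {T : ℝ} (hT : 0 ≤ T) {F : E d → ℝ → ℝ}
    (hF : ∀ t ∈ Icc 0 T, IsPeriodic fun x => F x t)
    (hc : ContinuousOn (fun z : E d × ℝ => F z.1 z.2) (slab d T)) :
    ∃ x ∈ unitCube d, ∃ t ∈ Icc 0 T, ∀ y, ∀ s ∈ Icc 0 T, F y s ≤ F x t := by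
  have hsub : unitCube d ×ˢ Icc 0 T ⊆ slab d T := prod_mono (subset_univ _) le_rfl
  obtain ⟨⟨x, t⟩, ⟨hx, ht⟩, hmax⟩ := (isCompact_unitCube.prod isCompact_Icc).exists_isMaxOn
    (unitCube_nonempty.prod (nonempty_Icc.2 hT)) (hc.mono hsub)
  refine ⟨x, hx, t, ht, fun y s hs => ?_⟩
  have h1 := (hF s hs).apply_toCube y
  have h2 : (toCube y, s) ∈ unitCube d ×ˢ Icc 0 T := ⟨toCube_mem y, hs⟩
  have h3 := hmax h2
  exact h1 ▸ h3

lemma uniqueDiffOn_slab {T : ℝ} (hT : 0 < T) : UniqueDiffOn ℝ (slab d T) :=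
  uniqueDiffOn_univ.prod (uniqueDiffOn_Icc hT)

lemma slab_mem_nhds {T : ℝ} {z : E d × ℝ} (hz : z.2 ∈ Ioo 0 T) : slab d T ∈ 𝓝 z :=
  prod_mem_nhds univ_mem (Icc_mem_nhds hz.1 hz.2)

lemma mem_slab_of_Ioo {T : ℝ} {z : E d × ℝ} (hz : z.2 ∈ Ioo 0 T) : z ∈ slab d T :=
  mem_slab.2 (Ioo_subset_Icc_self hz)

/-- Symmetry of higher derivatives within a set with boundary needs the point to lie in the closure
of the interior. This is what makes the jets symmetric at times `0` and `T` too. -/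
lemma slab_subset_closure_interior {T : ℝ} (hT : 0 < T) :
    slab d T ⊆ closure (interior (slab d T)) := by
  rw [slab, interior_prod_eq, closure_prod_eq, interior_univ, closure_univ, interior_Icc,
    closure_Ioo hT.ne]

/-! ### The spatial part of a covector on space-time -/

/-- The spatial gradient of a covector on space-time. -/
def spaceGrad (d : ℕ) : (E d × ℝ →L[ℝ] ℝ) →L[ℝ] E d :=
  ∑ i, (ContinuousLinearMap.apply ℝ ℝ (EuclideanSpace.single i (1 : ℝ), (0 : ℝ))).smulRight
    (EuclideanSpace.single i (1 : ℝ))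

lemma inner_spaceGrad (φ : E d × ℝ →L[ℝ] ℝ) (e : E d) : inner ℝ (spaceGrad d φ) e = φ (e, 0) := by
  have he : e = ∑ i, e i • EuclideanSpace.single i (1 : ℝ) := by
    ext j
    simp [Finset.sum_apply, Pi.single_apply]
  have h2 : φ (e, 0) = ∑ i, e i * φ (EuclideanSpace.single i (1 : ℝ), 0) := by
    have : (e, (0 : ℝ)) = ContinuousLinearMap.inl ℝ (E d) ℝ e := rfl
    rw [this, ← ContinuousLinearMap.comp_apply]
    conv_lhs => rw [he]
    simp [map_sum]
  rw [h2]
  simp only [spaceGrad, sum_apply, ContinuousLinearMap.smulRight_apply,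
    ContinuousLinearMap.apply_apply, sum_inner, real_inner_smul_left]
  refine Finset.sum_congr rfl fun i _ => ?_
  rw [EuclideanSpace.inner_single_left]
  simp [mul_comm]

/-! ### Jets of a function on the closed cylinder -/

/-- The first derivative on the closed cylinder. -/
def jet (T : ℝ) (u : E d → ℝ → ℝ) (z : E d × ℝ) : E d × ℝ →L[ℝ] ℝ :=
  fderivWithin ℝ (fun z : E d × ℝ => u z.1 z.2) (slab d T) z

/-- The second derivative on the closed cylinder. -/
def jet₂ (T : ℝ) (u : E d → ℝ → ℝ) (z : E d × ℝ) : E d × ℝ →L[ℝ] E d × ℝ →L[ℝ] ℝ :=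
  fderivWithin ℝ (jet T u) (slab d T) z

/-- The third derivative on the closed cylinder. -/
def jet₃ (T : ℝ) (u : E d → ℝ → ℝ) (z : E d × ℝ) :
    E d × ℝ →L[ℝ] E d × ℝ →L[ℝ] E d × ℝ →L[ℝ] ℝ :=
  fderivWithin ℝ (jet₂ T u) (slab d T) z

section Jets

variable {T : ℝ} {u : E d → ℝ → ℝ}

lemma contDiffOn_jet (hT : 0 < T) {n k : WithTop ℕ∞}
    (hu : ContDiffOn ℝ n (fun z : E d × ℝ => u z.1 z.2) (slab d T)) (hk : k + 1 ≤ n) :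
    ContDiffOn ℝ k (jet T u) (slab d T) :=
  hu.fderivWithin (uniqueDiffOn_slab hT) hk

lemma contDiffOn_jet₂ (hT : 0 < T)
    (hu : ContDiffOn ℝ 3 (fun z : E d × ℝ => u z.1 z.2) (slab d T)) :
    ContDiffOn ℝ 1 (jet₂ T u) (slab d T) :=
  (contDiffOn_jet (k := 2) hT hu (by norm_num)).fderivWithin (uniqueDiffOn_slab hT) (by norm_num)

lemma hasFDerivWithinAt_jet {n : WithTop ℕ∞} (hn : n ≠ 0)
    (hu : ContDiffOn ℝ n (fun z : E d × ℝ => u z.1 z.2) (slab d T)) {z : E d × ℝ}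
    (hz : z ∈ slab d T) :
    HasFDerivWithinAt (fun z : E d × ℝ => u z.1 z.2) (jet T u z) (slab d T) z :=
  (hu.differentiableOn hn z hz).hasFDerivWithinAt

lemma hasFDerivWithinAt_jet₂ (hT : 0 < T)
    (hu : ContDiffOn ℝ 3 (fun z : E d × ℝ => u z.1 z.2) (slab d T)) {z : E d × ℝ}
    (hz : z ∈ slab d T) : HasFDerivWithinAt (jet T u) (jet₂ T u z) (slab d T) z :=
  ((contDiffOn_jet (k := 2) hT hu (by norm_num)).differentiableOn (by norm_num) z
    hz).hasFDerivWithinAt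

lemma hasFDerivWithinAt_jet₃ (hT : 0 < T)
    (hu : ContDiffOn ℝ 3 (fun z : E d × ℝ => u z.1 z.2) (slab d T)) {z : E d × ℝ}
    (hz : z ∈ slab d T) : HasFDerivWithinAt (jet₂ T u) (jet₃ T u z) (slab d T) z :=
  ((contDiffOn_jet₂ hT hu).differentiableOn (by norm_num) z hz).hasFDerivWithinAt

lemma jet₂_symm (hT : 0 < T)
    (hu : ContDiffOn ℝ 3 (fun z : E d × ℝ => u z.1 z.2) (slab d T)) {z : E d × ℝ}
    (hz : z ∈ slab d T) (v w : E d × ℝ) : jet₂ T u z v w = jet₂ T u z w v :=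
  ((hu z hz).isSymmSndFDerivWithinAt (n := 3) (by simp; norm_num) (uniqueDiffOn_slab hT)
    (slab_subset_closure_interior hT hz) hz) v w

lemma jet₃_symm_left (hT : 0 < T)
    (hu : ContDiffOn ℝ 3 (fun z : E d × ℝ => u z.1 z.2) (slab d T)) {z : E d × ℝ}
    (hz : z ∈ slab d T) (v w : E d × ℝ) : jet₃ T u z v w = jet₃ T u z w v :=
  ((contDiffOn_jet (k := 2) hT hu (by norm_num) z hz).isSymmSndFDerivWithinAt (n := 2) (by simp)
    (uniqueDiffOn_slab hT) (slab_subset_closure_interior hT hz) hz) v w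

/-- Differentiates the symmetry of `jet₂`; derivatives within the slab are unique. -/
lemma jet₃_symm_right (hT : 0 < T)
    (hu : ContDiffOn ℝ 3 (fun z : E d × ℝ => u z.1 z.2) (slab d T)) {z : E d × ℝ}
    (hz : z ∈ slab d T) (v w y : E d × ℝ) : jet₃ T u z v w y = jet₃ T u z v y w := by
  have h := hasFDerivWithinAt_jet₃ hT hu hz
  have h1 := (h.clm_apply (hasFDerivWithinAt_const w z _)).clm_apply (hasFDerivWithinAt_const y z _)
  have h2 := (h.clm_apply (hasFDerivWithinAt_const y z _)).clm_apply (hasFDerivWithinAt_const w z _)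
  have h3 := h1.congr (f₁ := fun z => jet₂ T u z y w)
    (fun x hx => jet₂_symm hT hu hx y w) (jet₂_symm hT hu hz y w)
  have h4 := (uniqueDiffOn_slab hT z hz).eq h2 h3
  have := congrArg (fun L => L v) h4
  simpa using this.symm

lemma derT_eq_jet {n : WithTop ℕ∞} (hn : n ≠ 0)
    (hu : ContDiffOn ℝ n (fun z : E d × ℝ => u z.1 z.2) (slab d T)) (hT : 0 < T) (x : E d) {t : ℝ}
    (ht : t ∈ Icc 0 T) : derT T u x t = jet T u (x, t) (0, 1) := by
  have h := hasFDerivWithinAt_jet hn hu (mem_slab.2 ht : (x, t) ∈ slab d T)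
  have hg : HasDerivWithinAt (fun s : ℝ => (x, s)) ((0 : E d), (1 : ℝ)) (Icc 0 T) t :=
    (hasDerivWithinAt_const t _ x).prodMk (hasDerivWithinAt_id t _)
  have := h.comp_hasDerivWithinAt t hg (fun s hs => mem_slab.2 hs)
  exact this.derivWithin (uniqueDiffOn_Icc hT t ht)

lemma hasFDerivAt_space {n : WithTop ℕ∞} (hn : n ≠ 0)
    (hu : ContDiffOn ℝ n (fun z : E d × ℝ => u z.1 z.2) (slab d T)) (x : E d) {t : ℝ}
    (ht : t ∈ Icc 0 T) :
    HasFDerivAt (fun y => u y t) ((jet T u (x, t)).comp (ContinuousLinearMap.inl ℝ (E d) ℝ)) x := by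
  have h := hasFDerivWithinAt_jet hn hu (mem_slab.2 ht : (x, t) ∈ slab d T)
  have hg : HasFDerivWithinAt (fun y : E d => (y, t)) (ContinuousLinearMap.inl ℝ (E d) ℝ) univ x :=
    (hasFDerivAt_prodMk_left x t).hasFDerivWithinAt
  have := h.comp x hg fun s _ => mem_slab.2 ht
  exact hasFDerivWithinAt_univ.1 this

lemma gradX_eq_spaceGrad {n : WithTop ℕ∞} (hn : n ≠ 0)
    (hu : ContDiffOn ℝ n (fun z : E d × ℝ => u z.1 z.2) (slab d T)) (x : E d) {t : ℝ}
    (ht : t ∈ Icc 0 T) : gradX u x t = spaceGrad d (jet T u (x, t)) := by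
  refine ext_inner_right ℝ fun e => ?_
  rw [inner_spaceGrad, gradX, gradient, InnerProductSpace.toDual_symm_apply,
    (hasFDerivAt_space hn hu x ht).fderiv]
  simp

end Jets

end MFG

namespace MFG

/-! ### The system with a separated potential -/

section Reduced

variable {d : ℕ}

/-- The mean field games system `-u_t + h(D_x u) - P(x) = F(m)`,
`m_t - div(m Dh(D_x u)) = 0` on the closed cylinder. -/
structure ReducedSystem (T : ℝ) (h P : E d → ℝ) (F : ℝ → ℝ) (u m : E d → ℝ → ℝ) : Prop where
  T_pos : 0 < T
  smooth_h : Differentiable ℝ h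
  smooth_grad : ContDiff ℝ 2 (gradient h)
  hess_symm : ∀ p v w, inner ℝ (fderiv ℝ (gradient h) p v) w = inner ℝ v (fderiv ℝ (gradient h) p w)
  hess_nonneg : ∀ p v, 0 ≤ inner ℝ (fderiv ℝ (gradient h) p v) v
  smooth_P : ContDiff ℝ 2 P
  periodic_P : IsPeriodic P
  smooth_F : ContDiffOn ℝ 2 F (Ioi 0)
  deriv_F_pos : ∀ n, 0 < n → 0 < deriv F n
  smooth_u : ContDiffOn ℝ 3 (fun z : E d × ℝ => u z.1 z.2) (slab d T)
  smooth_m : ContDiffOn ℝ 2 (fun z : E d × ℝ => m z.1 z.2) (slab d T)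
  periodic_u : ∀ t ∈ Icc 0 T, IsPeriodic (fun x => u x t)
  pos : ∀ x, ∀ t ∈ Icc 0 T, 0 < m x t
  hamiltonJacobi : ∀ x, ∀ t ∈ Icc 0 T, -derT T u x t + h (gradX u x t) - P x = F (m x t)
  transport : ∀ x, ∀ t ∈ Ioo 0 T,
    derT T m x t - divergence (fun y => m y t • gradient h (gradX u y t)) x = 0

/-- The momentum `D_x u`. -/
def mom (T : ℝ) (u : E d → ℝ → ℝ) (z : E d × ℝ) : E d := spaceGrad d (jet T u z)

/-- The velocity `Dh(D_x u)`. -/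
def vel (T : ℝ) (h : E d → ℝ) (u : E d → ℝ → ℝ) (z : E d × ℝ) : E d := gradient h (mom T u z)

/-- The direction `(-Dh(D_x u), 1)` of the characteristics. -/
def chr (T : ℝ) (h : E d → ℝ) (u : E d → ℝ → ℝ) (z : E d × ℝ) : E d × ℝ := (-vel T h u z, 1)

/-- The divergence of the velocity, computed in a given basis. -/
def divVel {ι : Type*} [Fintype ι] (T : ℝ) (h : E d → ℝ) (u : E d → ℝ → ℝ)
    (e : OrthonormalBasis ι ℝ (E d)) (z : E d × ℝ) : ℝ :=
  ∑ i, inner ℝ (fderiv ℝ (gradient h) (mom T u z) (spaceGrad d (jet₂ T u z (e i, 0)))) (e i)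

/-- The energy `h(D_x u) - P(x)`. -/
def energy (T : ℝ) (h P : E d → ℝ) (u : E d → ℝ → ℝ) (z : E d × ℝ) : ℝ :=
  h (mom T u z) - P z.1

lemma inner_gradient {h : E d → ℝ} {p : E d} (v : E d) : inner ℝ (gradient h p) v = fderiv ℝ h p v := by
  rw [gradient, InnerProductSpace.toDual_symm_apply]

lemma hasDerivAt_line {V : Type*} [NormedAddCommGroup V] [NormedSpace ℝ V] {T : ℝ}
    {f : E d × ℝ → V} {f' : E d × ℝ →L[ℝ] V} {z v : E d × ℝ} {s : ℝ}
    (h : HasFDerivWithinAt f f' (slab d T) (z + s • v)) (hz : (z + s • v).2 ∈ Ioo 0 T) :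
    HasDerivAt (fun r : ℝ => f (z + r • v)) (f' v) s := by
  have h1 : HasFDerivAt f f' (z + s • v) := h.hasFDerivAt (slab_mem_nhds hz)
  have h2 : HasDerivAt (fun r : ℝ => z + r • v) v s := by
    simpa using ((hasDerivAt_id s).smul_const v).const_add z
  exact h1.comp_hasDerivAt s h2

lemma eventually_line_mem {T : ℝ} {z : E d × ℝ} (hz : z.2 ∈ Ioo 0 T) (v : E d × ℝ) :
    ∀ᶠ s in 𝓝 (0 : ℝ), (z + s • v).2 ∈ Ioo 0 T := by
  have : Continuous fun s : ℝ => (z + s • v).2 := by fun_prop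
  refine this.continuousAt.eventually (isOpen_Ioo.mem_nhds ?_)
  simpa using hz

lemma chr_apply {T : ℝ} {h : E d → ℝ} {u : E d → ℝ → ℝ} {z : E d × ℝ} (φ : E d × ℝ →L[ℝ] ℝ) :
    φ (chr T h u z) = φ (0, 1) - φ (vel T h u z, 0) := by
  have : chr T h u z = (0, 1) - (vel T h u z, 0) := by simp [chr]
  rw [this, map_sub]

namespace ReducedSystem

variable {T : ℝ} {h P : E d → ℝ} {F : ℝ → ℝ} {u m : E d → ℝ → ℝ}

lemma hasFDerivWithinAt_mom (hS : ReducedSystem T h P F u m) {z : E d × ℝ} (hz : z ∈ slab d T) :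
    HasFDerivWithinAt (mom T u) ((spaceGrad d).comp (jet₂ T u z)) (slab d T) z :=
  (spaceGrad d).hasFDerivAt.comp_hasFDerivWithinAt z
    (hasFDerivWithinAt_jet₂ hS.T_pos hS.smooth_u hz)

lemma hasFDerivWithinAt_vel (hS : ReducedSystem T h P F u m) {z : E d × ℝ} (hz : z ∈ slab d T) :
    HasFDerivWithinAt (vel T h u) ((fderiv ℝ (gradient h) (mom T u z)).comp
      ((spaceGrad d).comp (jet₂ T u z))) (slab d T) z :=
  ((hS.smooth_grad.differentiable (by norm_num) (mom T u z)).hasFDerivAt).comp_hasFDerivWithinAt z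
    (hS.hasFDerivWithinAt_mom hz)

lemma inner_vel_mom_deriv (v z w : E d × ℝ) :
    inner ℝ (vel T h u z) (spaceGrad d (jet₂ T u w v)) = jet₂ T u w v (vel T h u z, 0) := by
  rw [real_inner_comm, inner_spaceGrad]

lemma hasFDerivWithinAt_energy (hS : ReducedSystem T h P F u m) {z : E d × ℝ}
    (hz : z ∈ slab d T) : HasFDerivWithinAt (energy T h P u)
      ((fderiv ℝ h (mom T u z)).comp ((spaceGrad d).comp (jet₂ T u z))
        - (fderiv ℝ P z.1).comp (ContinuousLinearMap.fst ℝ (E d) ℝ)) (slab d T) z := by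
  have h1 := (hS.smooth_h (mom T u z)).hasFDerivAt.comp_hasFDerivWithinAt z
    (hS.hasFDerivWithinAt_mom hz)
  have h2 : HasFDerivWithinAt (fun z : E d × ℝ => P z.1) _ (slab d T) z :=
    (hS.smooth_P.differentiable (by norm_num) z.1).hasFDerivAt.comp_hasFDerivWithinAt z
    (hasFDerivAt_fst (p := z)).hasFDerivWithinAt
  exact h1.sub h2

lemma energy_deriv_apply (z v : E d × ℝ) :
    ((fderiv ℝ h (mom T u z)).comp ((spaceGrad d).comp (jet₂ T u z))
        - (fderiv ℝ P z.1).comp (ContinuousLinearMap.fst ℝ (E d) ℝ)) v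
      = jet₂ T u z v (vel T h u z, 0) - fderiv ℝ P z.1 v.1 := by
  simp only [sub_apply, ContinuousLinearMap.comp_apply, ContinuousLinearMap.coe_fst']
  rw [← inner_gradient, ← inner_vel_mom_deriv (T := T) (h := h)]
  rfl

lemma hj_jet (hS : ReducedSystem T h P F u m) {z : E d × ℝ} (hz : z ∈ slab d T) :
    F (m z.1 z.2) = energy T h P u z - jet T u z (0, 1) := by
  have ht := mem_slab.1 hz
  have := hS.hamiltonJacobi z.1 z.2 ht
  rw [gradX_eq_spaceGrad (by norm_num) hS.smooth_u _ ht,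
    derT_eq_jet (by norm_num) hS.smooth_u hS.T_pos _ ht] at this
  rw [← this, energy, mom]
  ring

/-- The derivative of `F(m)`, from the Hamilton-Jacobi equation. -/
lemma deriv_hj (hS : ReducedSystem T h P F u m) {z : E d × ℝ} (hz : z ∈ slab d T) (v : E d × ℝ) :
    deriv F (m z.1 z.2) * jet T m z v = -jet₂ T u z v (chr T h u z) - fderiv ℝ P z.1 v.1 := by
  have hpos := hS.pos z.1 z.2 (mem_slab.1 hz)
  have hF : HasDerivAt F (deriv F (m z.1 z.2)) (m z.1 z.2) :=
    ((hS.smooth_F.differentiableOn (by norm_num)).differentiableAt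
      (Ioi_mem_nhds hpos)).hasDerivAt
  have h1 := hF.comp_hasFDerivWithinAt z (hasFDerivWithinAt_jet (by norm_num) hS.smooth_m hz)
  have h2 := (hS.hasFDerivWithinAt_energy hz).sub
    ((hasFDerivWithinAt_jet₂ hS.T_pos hS.smooth_u hz).clm_apply
      (hasFDerivWithinAt_const ((0 : E d), (1 : ℝ)) z _))
  have h3 := h2.congr (f₁ := F ∘ fun z : E d × ℝ => m z.1 z.2) (fun x hx => hS.hj_jet hx)
    (hS.hj_jet hz)
  have h4 := congrArg (fun L => L v) ((uniqueDiffOn_slab hS.T_pos z hz).eq h1 h3)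
  simp only [sub_apply (f := ContinuousLinearMap.comp _ _ - _), energy_deriv_apply] at h4
  rw [chr_apply]
  simp only [smul_apply, smul_eq_mul] at h4
  rw [h4]
  have h5 := energy_deriv_apply (T := T) (h := h) (P := P) (u := u) z v
  simp only [sub_apply, ContinuousLinearMap.comp_apply, ContinuousLinearMap.coe_fst'] at h5
  simp
  linarith

/-- The transport equation in terms of jets. -/
lemma transport_jet {ι : Type*} [Fintype ι] (hS : ReducedSystem T h P F u m)
    (e : OrthonormalBasis ι ℝ (E d)) {z : E d × ℝ} (hz : z.2 ∈ Ioo 0 T) :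
    jet T m z (chr T h u z) = m z.1 z.2 * divVel T h u e z := by
  have hzs := mem_slab_of_Ioo hz
  have ht := mem_slab.1 hzs
  have h0 := hS.transport z.1 z.2 hz
  rw [derT_eq_jet (by norm_num) hS.smooth_m hS.T_pos _ ht] at h0
  have hm := hasFDerivAt_space (by norm_num) hS.smooth_m z.1 ht
  have hv := hS.hasFDerivWithinAt_vel hzs
  have hg : HasFDerivWithinAt (fun y : E d => (y, z.2)) (ContinuousLinearMap.inl ℝ (E d) ℝ) univ
      z.1 := (hasFDerivAt_prodMk_left z.1 z.2).hasFDerivWithinAt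
  have hv2 := hasFDerivWithinAt_univ.1 (HasFDerivWithinAt.comp z.1 (g := vel T h u) hv hg
    fun s _ => mem_slab.2 ht)
  have hprod := hm.smul hv2
  have heq : (fun y => m y z.2 • gradient h (gradX u y z.2))
      = ((fun y => m y z.2) • (vel T h u ∘ fun y => (y, z.2))) := by
    funext y
    simp only [Pi.smul_apply', Function.comp_apply, vel, mom]
    rw [gradX_eq_spaceGrad (by norm_num) hS.smooth_u _ ht]
  -- The divergence is a trace, so it can be computed in any orthonormal basis; later the basis
  -- diagonalises `D²h`.
  have htr : divergence (fun y => m y z.2 • gradient h (gradX u y z.2)) z.1 =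
      ∑ i, inner ℝ (e i) (fderiv ℝ (fun y => m y z.2 • gradient h (gradX u y z.2)) z.1 (e i)) := by
    rw [divergence]
    have h1 := LinearMap.trace_eq_sum_inner
      (fderiv ℝ (fun y => m y z.2 • gradient h (gradX u y z.2)) z.1 : E d →ₗ[ℝ] E d) e
    have h2 := LinearMap.trace_eq_sum_inner
      (fderiv ℝ (fun y => m y z.2 • gradient h (gradX u y z.2)) z.1 : E d →ₗ[ℝ] E d)
      (EuclideanSpace.basisFun (Fin d) ℝ)
    simp only [ContinuousLinearMap.coe_coe] at h1 h2
    rw [← h1, h2]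
    refine Finset.sum_congr rfl fun i _ => ?_
    rw [EuclideanSpace.basisFun_apply, EuclideanSpace.inner_single_left]
    simp
  rw [htr, heq, hprod.fderiv] at h0
  have hterm : ∀ i, inner ℝ (e i) ((m z.1 z.2 • (fderiv ℝ (gradient h) (mom T u z)).comp
      ((spaceGrad d).comp (jet₂ T u z)) ∘L ContinuousLinearMap.inl ℝ (E d) ℝ +
      (((jet T m (z.1, z.2)).comp (ContinuousLinearMap.inl ℝ (E d) ℝ))).smulRight
        ((vel T h u ∘ fun y => (y, z.2)) z.1)) (e i)) =
      m z.1 z.2 * inner ℝ (fderiv ℝ (gradient h) (mom T u z)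
        (spaceGrad d (jet₂ T u z (e i, 0)))) (e i)
      + inner ℝ (e i) (vel T h u z) * jet T m z (e i, 0) := by
    intro i
    simp [inner_add_right, inner_smul_right, real_inner_comm]
    ring
  have hvel : jet T m z (vel T h u z, 0) =
      ∑ i, inner ℝ (e i) (vel T h u z) * jet T m z (e i, 0) := by
    have : (vel T h u z, (0 : ℝ)) = ContinuousLinearMap.inl ℝ (E d) ℝ (vel T h u z) := rfl
    rw [this, ← ContinuousLinearMap.comp_apply]
    conv_lhs => rw [← e.sum_repr' (vel T h u z)]
    rw [map_sum]
    exact Finset.sum_congr rfl fun i _ => by rw [map_smul]; rfl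
  rw [chr_apply, hvel, divVel, Finset.mul_sum]
  rw [Finset.sum_congr rfl fun i _ => hterm i, Finset.sum_add_distrib] at h0
  change jet T m z (0, 1) - _ = 0 at h0
  linarith

/-- The second order equation satisfied by `u`. -/
lemma pde {ι : Type*} [Fintype ι] (hS : ReducedSystem T h P F u m)
    (e : OrthonormalBasis ι ℝ (E d)) {z : E d × ℝ} (hz : z.2 ∈ Ioo 0 T) :
    jet₂ T u z (chr T h u z) (chr T h u z)
      + m z.1 z.2 * deriv F (m z.1 z.2) * divVel T h u e z = fderiv ℝ P z.1 (vel T h u z) := by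
  -- In the characteristic direction the transport equation eliminates the derivative of `m`, which
  -- leaves an equation for `u` with coefficient `mF'(m)`.
  have h1 := hS.deriv_hj (mem_slab_of_Ioo hz) (chr T h u z)
  rw [hS.transport_jet e hz] at h1
  have h2 : fderiv ℝ P z.1 (chr T h u z).1 = - fderiv ℝ P z.1 (vel T h u z) := by
    simp [chr]
  rw [h2] at h1
  linarith

end ReducedSystem

end Reduced

end MFG

/-! ### The differentiated equation and the maximum principle for `u_t`. -/

namespace MFG

section Reduced

variable {d : ℕ}

lemma hasDerivAt_line_zero {V : Type*} [NormedAddCommGroup V] [NormedSpace ℝ V] {T : ℝ}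
    {f : E d × ℝ → V} {f' : E d × ℝ →L[ℝ] V} {z : E d × ℝ}
    (h : HasFDerivWithinAt f f' (slab d T) z) (hz : z.2 ∈ Ioo 0 T) (v : E d × ℝ) :
    HasDerivAt (fun r : ℝ => f (z + r • v)) (f' v) 0 := by
  refine hasDerivAt_line ?_ (by simpa using hz)
  simpa using h

/-- In an eigenbasis of `D²h` the second order operator becomes a nonnegative combination of pure
second derivatives, so derivative tests along single lines are enough. -/
lemma exists_eigenbasis (A : E d →L[ℝ] E d) (hA : ∀ v w, inner ℝ (A v) w = inner ℝ v (A w)) :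
    ∃ (e : OrthonormalBasis (Fin d) ℝ (E d)) (lam : Fin d → ℝ), ∀ i, A (e i) = lam i • e i := by
  have hs : LinearMap.IsSymmetric (A : E d →ₗ[ℝ] E d) := fun v w => hA v w
  have hn : Module.finrank ℝ (E d) = d := by simp
  exact ⟨hs.eigenvectorBasis hn, hs.eigenvalues hn, fun i => hs.apply_eigenvectorBasis hn i⟩

lemma IsPeriodic.gradX {d : ℕ} {F : E d → ℝ → ℝ} {t : ℝ} (hF : IsPeriodic fun x => F x t) :
    IsPeriodic fun x => MFG.gradX F x t := by
  intro x i
  have : (fun y => F (y + EuclideanSpace.single i 1) t) = fun y => F y t := funext fun y => hF y i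
  simp only [MFG.gradX, gradient]
  conv_rhs => rw [← this]
  rw [fderiv_comp_add_right (f := fun y => F y t)]

namespace ReducedSystem

variable {T : ℝ} {h P : E d → ℝ} {F : ℝ → ℝ} {u m : E d → ℝ → ℝ}

lemma mom_eq (hS : ReducedSystem T h P F u m) {x : E d} {t : ℝ} (ht : t ∈ Icc 0 T) :
    mom T u (x, t) = gradX u x t :=
  (gradX_eq_spaceGrad (by norm_num) hS.smooth_u x ht).symm

lemma periodic_mom (hS : ReducedSystem T h P F u m) {t : ℝ} (ht : t ∈ Icc 0 T) :
    IsPeriodic fun x => mom T u (x, t) := by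
  simp_rw [hS.mom_eq ht]
  exact (hS.periodic_u t ht).gradX

lemma periodic_time (hS : ReducedSystem T h P F u m) {t : ℝ} (ht : t ∈ Icc 0 T) :
    IsPeriodic fun x => jet T u (x, t) (0, 1) := by
  intro x i
  simp only [← derT_eq_jet (by norm_num) hS.smooth_u hS.T_pos _ ht, derT]
  exact derivWithin_congr (fun s hs => hS.periodic_u s hs x i) (hS.periodic_u t ht x i)

lemma continuousOn_jet (hS : ReducedSystem T h P F u m) : ContinuousOn (jet T u) (slab d T) :=
  fun _ hz => (hasFDerivWithinAt_jet₂ hS.T_pos hS.smooth_u hz).continuousWithinAt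

lemma contDiffOn_deriv_F (hS : ReducedSystem T h P F u m) : ContDiffOn ℝ 1 (deriv F) (Ioi 0) :=
  hS.smooth_F.deriv_of_isOpen isOpen_Ioi (by norm_num)

lemma contDiffOn_mul_deriv_F (hS : ReducedSystem T h P F u m) :
    ContDiffOn ℝ 1 (fun n => n * deriv F n) (Ioi 0) :=
  contDiffOn_id.mul hS.contDiffOn_deriv_F

/-- The second order equation for `u`, differentiated in a constant direction. -/
lemma pde_deriv {ι : Type*} [Fintype ι] (hS : ReducedSystem T h P F u m)
    (e : OrthonormalBasis ι ℝ (E d)) {z : E d × ℝ} (hz : z.2 ∈ Ioo 0 T) (v : E d × ℝ) {c : E d}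
    (hc : fderiv ℝ (gradient h) (mom T u z) (spaceGrad d (jet₂ T u z v)) = c) :
    jet₃ T u z v (chr T h u z) (chr T h u z) - 2 * jet₂ T u z (chr T h u z) (c, 0)
      + deriv (fun n => n * deriv F n) (m z.1 z.2) * jet T m z v * divVel T h u e z
      + m z.1 z.2 * deriv F (m z.1 z.2) * ∑ i,
        (inner ℝ (fderiv ℝ (fderiv ℝ (gradient h)) (mom T u z) (spaceGrad d (jet₂ T u z v))
            (spaceGrad d (jet₂ T u z (e i, 0)))) (e i)
          + inner ℝ (fderiv ℝ (gradient h) (mom T u z) (spaceGrad d (jet₃ T u z v (e i, 0)))) (e i))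
      = fderiv ℝ (fderiv ℝ P) z.1 v.1 (vel T h u z) + fderiv ℝ P z.1 c := by
  have hzs := mem_slab_of_Ioo hz
  have hpos := hS.pos z.1 z.2 (mem_slab.1 hzs)
  have hJ2 := hasDerivAt_line_zero (f := jet₂ T u) (hasFDerivWithinAt_jet₃ hS.T_pos hS.smooth_u hzs) hz v
  have hb := hasDerivAt_line_zero (hS.hasFDerivWithinAt_vel hzs) hz v
  have hb' : HasDerivAt (fun r : ℝ => vel T h u (z + r • v)) c 0 :=
    hb.congr_deriv hc
  -- The direction `ξ` varies with the point; its derivative `(-c, 0)` enters twice and produces the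
  -- term `-2 D²u(ξ, (c, 0))`.
  have hchr : HasDerivAt (fun r : ℝ => chr T h u (z + r • v)) (-c, (0 : ℝ)) 0 :=
    hb'.neg.prodMk (hasDerivAt_const _ _)
  have hX : HasDerivAt (fun r : ℝ => m (z + r • v).1 (z + r • v).2 *
      deriv F (m (z + r • v).1 (z + r • v).2))
      (deriv (fun n => n * deriv F n) (m z.1 z.2) * jet T m z v) 0 := by
    have h1 := hasDerivAt_line_zero (hasFDerivWithinAt_jet (by norm_num) hS.smooth_m hzs) hz v
    have h2 : HasDerivAt (fun n => n * deriv F n) (deriv (fun n => n * deriv F n) (m z.1 z.2))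
        (m (z + (0 : ℝ) • v).1 (z + (0 : ℝ) • v).2) := by
      have : z + (0 : ℝ) • v = z := by simp
      rw [this]
      exact ((hS.contDiffOn_mul_deriv_F.differentiableOn (by norm_num)).differentiableAt
        (Ioi_mem_nhds hpos)).hasDerivAt
    exact h2.comp (0 : ℝ) h1
  have hA : HasDerivAt (fun r : ℝ => fderiv ℝ (gradient h) (mom T u (z + r • v)))
      (fderiv ℝ (fderiv ℝ (gradient h)) (mom T u z) (spaceGrad d (jet₂ T u z v))) 0 := by
    have h1 := hasDerivAt_line_zero (hS.hasFDerivWithinAt_mom hzs) hz v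
    have h2 : HasFDerivAt (fderiv ℝ (gradient h)) (fderiv ℝ (fderiv ℝ (gradient h)) (mom T u z))
        (mom T u (z + (0 : ℝ) • v)) := by
      have : z + (0 : ℝ) • v = z := by simp
      rw [this]
      exact ((hS.smooth_grad.fderiv_right (m := 1) (by norm_num)).differentiable (by norm_num)
        _).hasFDerivAt
    exact h2.comp_hasDerivAt (0 : ℝ) h1
  have hP : HasDerivAt (fun r : ℝ => fderiv ℝ P (z + r • v).1) (fderiv ℝ (fderiv ℝ P) z.1 v.1) 0 := by
    have h2 : HasFDerivAt (fderiv ℝ P) (fderiv ℝ (fderiv ℝ P) z.1) z.1 :=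
      ((hS.smooth_P.fderiv_right (m := 1) (by norm_num)).differentiable (by norm_num)
        _).hasFDerivAt
    exact hasDerivAt_line_zero (T := T) (f := fun z : E d × ℝ => fderiv ℝ P z.1)
      (h2.comp_hasFDerivWithinAt z (hasFDerivAt_fst (p := z)).hasFDerivWithinAt) hz v
  have hdiv : HasDerivAt (fun r : ℝ => divVel T h u e (z + r • v)) (∑ i,
        (inner ℝ (fderiv ℝ (fderiv ℝ (gradient h)) (mom T u z) (spaceGrad d (jet₂ T u z v))
            (spaceGrad d (jet₂ T u z (e i, 0)))) (e i)
          + inner ℝ (fderiv ℝ (gradient h) (mom T u z)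
            (spaceGrad d (jet₃ T u z v (e i, 0)))) (e i))) 0 := by
    refine HasDerivAt.fun_sum fun i _ => ?_
    have h1 := hJ2.clm_apply (hasDerivAt_const (0 : ℝ) ((e i, 0) : E d × ℝ))
    have h2 := (spaceGrad d).hasFDerivAt.comp_hasDerivAt (0 : ℝ) h1
    have h3 := (hA.clm_apply h2).inner ℝ (hasDerivAt_const (0 : ℝ) (e i))
    refine h3.congr_deriv ?_
    simp [inner_add_left]
  have hL := ((hJ2.clm_apply hchr).clm_apply hchr).add (hX.mul hdiv)
  have hR := hP.clm_apply hb'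
  have hEq : (fun r : ℝ => fderiv ℝ P (z + r • v).1 (vel T h u (z + r • v))) =ᶠ[𝓝 0] _ :=
    (eventually_line_mem hz v).mono fun r hr => (hS.pde e hr).symm
  have hfin := (hR.congr_of_eventuallyEq hEq.symm).unique hL
  have hneg : ((-c, (0 : ℝ)) : E d × ℝ) = -(c, 0) := by simp
  simp only [zero_smul, add_zero, hneg, map_neg, add_apply, neg_apply] at hfin
  rw [jet₂_symm hS.T_pos hS.smooth_u hzs (c, 0)] at hfin
  linarith

/-- Maximum principle for the time derivative of `u`. -/
lemma time_deriv_le (hS : ReducedSystem T h P F u m) {ς M : ℝ} (hς : ς ≠ 0)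
    (h0 : ∀ x, ς * jet T u (x, 0) (0, 1) ≤ M) (hT : ∀ x, ς * jet T u (x, T) (0, 1) ≤ M)
    {z : E d × ℝ} (hz : z ∈ slab d T) : ς * jet T u z (0, 1) ≤ M := by
  by_contra! hlt
  have hJc : ContinuousOn (fun z => jet T u z (0, 1)) (slab d T) :=
    hS.continuousOn_jet.clm_apply continuousOn_const
  -- a bound for the drift
  obtain ⟨Λ, hΛ⟩ : ∃ Λ : ℝ, ∀ x ∈ unitCube d, ∀ t ∈ Icc 0 T,
      |deriv (fun n => n * deriv F n) (m x t) / (deriv F (m x t) * (m x t * deriv F (m x t))) *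
        (fderiv ℝ P x (vel T h u (x, t))
          - jet₂ T u (x, t) (chr T h u (x, t)) (chr T h u (x, t)))| ≤ Λ := by
    have hmc : ContinuousOn (fun z : E d × ℝ => m z.1 z.2) (slab d T) := hS.smooth_m.continuousOn
    have hmpos : MapsTo (fun z : E d × ℝ => m z.1 z.2) (slab d T) (Ioi 0) :=
      fun z hz => hS.pos z.1 z.2 (mem_slab.1 hz)
    have h1 : ContinuousOn (fun z : E d × ℝ => deriv (fun n => n * deriv F n) (m z.1 z.2))
        (slab d T) := (hS.contDiffOn_mul_deriv_F.continuousOn_deriv_of_isOpen isOpen_Ioi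
          (by norm_num)).comp hmc hmpos
    have h2 : ContinuousOn (fun z : E d × ℝ => deriv F (m z.1 z.2)) (slab d T) :=
      hS.contDiffOn_deriv_F.continuousOn.comp hmc hmpos
    have h3 : ContinuousOn (vel T h u) (slab d T) :=
      fun _ hz => (hS.hasFDerivWithinAt_vel hz).continuousWithinAt
    have h4 : ContinuousOn (chr T h u) (slab d T) := h3.neg.prodMk continuousOn_const
    have h5 : ContinuousOn (fun z : E d × ℝ => fderiv ℝ P z.1) (slab d T) :=
      ((hS.smooth_P.continuous_fderiv (by norm_num)).comp continuous_fst).continuousOn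
    have h6 := (contDiffOn_jet₂ hS.T_pos hS.smooth_u).continuousOn
    have h7 := (h1.div (h2.mul (hmc.mul h2)) fun z hz => by
      have := hS.pos z.1 z.2 (mem_slab.1 hz)
      have := hS.deriv_F_pos _ this
      exact (mul_pos this (mul_pos (by assumption) this)).ne').mul ((h5.clm_apply h3).sub ((h6.clm_apply h4).clm_apply h4))
    have hcpt : IsCompact (unitCube d ×ˢ Icc 0 T) := isCompact_unitCube.prod isCompact_Icc
    obtain ⟨Λ, hΛ⟩ := hcpt.exists_bound_of_continuousOn
      (h7.mono (prod_mono (subset_univ _) le_rfl))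
    exact ⟨Λ, fun x hx t ht => hΛ (x, t) ⟨hx, ht⟩⟩
  -- The perturbation `ε e^{kt}` contributes a second derivative `εk² e^{kt}` along `ξ`, while the
  -- drift contributes at most `|Λ| εk e^{kt}`; hence the need for `k > |Λ|`.
  set k : ℝ := |Λ| + 1 with hk
  have hkpos : 0 < k := by positivity
  obtain ⟨ε, hε, hεM⟩ : ∃ ε > 0, M + ε * Real.exp (k * T) < ς * jet T u z (0, 1) := by
    refine ⟨(ς * jet T u z (0, 1) - M) / 2 / Real.exp (k * T), by
      have := Real.exp_pos (k * T); have := sub_pos.2 hlt; positivity, ?_⟩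
    rw [div_mul_cancel₀ _ (Real.exp_pos _).ne']
    linarith
  obtain ⟨x, hx, t, ht, hmax⟩ := exists_isMaxOn_slab hS.T_pos.le
    (F := fun x t => ς * jet T u (x, t) (0, 1) + ε * Real.exp (k * t))
    (fun t ht x i => by have := hS.periodic_time ht x i; simp only at this ⊢; rw [this])
    ((continuousOn_const.mul hJc).add (by fun_prop))
  have hz1 := hmax z.1 z.2 (mem_slab.1 hz)
  have hexp : ∀ s ≤ T, ε * Real.exp (k * s) ≤ ε * Real.exp (k * T) := fun s hs => by gcongr
  have hzt : ς * jet T u z (0, 1) ≤ ς * jet T u (x, t) (0, 1) + ε * Real.exp (k * t) :=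
    le_trans (by have := Real.exp_pos (k * z.2); nlinarith) hz1
  have htI : t ∈ Ioo 0 T := by
    refine ⟨lt_of_le_of_ne ht.1 ?_, lt_of_le_of_ne ht.2 ?_⟩
    · rintro rfl
      have := h0 x
      have := hexp 0 hS.T_pos.le
      linarith
    · rintro rfl
      have := hT x
      linarith
  clear hz1 hzt hεM hexp hlt hz z
  set z : E d × ℝ := (x, t) with hz
  have hzI : z.2 ∈ Ioo 0 T := htI
  have hzs := mem_slab_of_Ioo hzI
  -- derivative tests
  have hloc : ∀ v : E d × ℝ, ς * jet₂ T u z v (0, 1) + ε * (k * v.2) * Real.exp (k * t) = 0 ∧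
      ς * jet₃ T u z v v (0, 1) + ε * (k * v.2) ^ 2 * Real.exp (k * t) ≤ 0 := by
    intro v
    have hexp : ∀ s : ℝ, HasDerivAt (fun r : ℝ => Real.exp (k * (z + r • v).2))
        ((k * v.2) * Real.exp (k * (z + s • v).2)) s := by
      intro s
      have h1 : HasDerivAt (fun r : ℝ => k * (z + r • v).2) (k * v.2) s := by
        have : HasDerivAt (fun r : ℝ => z.2 + r * v.2) v.2 s := by
          simpa using ((hasDerivAt_id s).mul_const v.2).const_add z.2
        exact this.const_mul k
      simpa [mul_comm] using h1.exp
    have h1 := second_deriv_nonpos_of_isLocalMax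
      (σ := fun r : ℝ => ς * jet T u (z + r • v) (0, 1) + ε * Real.exp (k * (z + r • v).2))
      (σ₁ := fun r : ℝ => ς * jet₂ T u (z + r • v) v (0, 1)
        + ε * ((k * v.2) * Real.exp (k * (z + r • v).2)))
      (σ₂ := ς * jet₃ T u z v v (0, 1) + ε * ((k * v.2) * ((k * v.2) * Real.exp (k * z.2))))
      ?_ ?_ ?_
    · simp only [zero_smul, add_zero] at h1
      change _ = 0 ∧ ς * jet₃ T u z v v (0, 1) + ε * (k * v.2) ^ 2 * Real.exp (k * z.2) ≤ 0
      refine ⟨by linarith [h1.1], le_trans (le_of_eq ?_) h1.2⟩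
      ring
    · filter_upwards [eventually_line_mem hzI v] with r hr
      have := hmax (z + r • v).1 (z + r • v).2 (Ioo_subset_Icc_self hr)
      exact this.trans_eq (by simp [hz])
    · filter_upwards [eventually_line_mem hzI v] with r hr
      have h2 := hasDerivAt_line (hasFDerivWithinAt_jet₂ hS.T_pos hS.smooth_u
        (mem_slab_of_Ioo hr)) hr
      have h3 := (h2.clm_apply (hasDerivAt_const r ((0 : E d), (1 : ℝ)))).const_mul ς
      have h4 := h3.add ((hexp r).const_mul ε)
      exact h4.congr_deriv (by simp)
    · have h2 := hasDerivAt_line_zero (f := jet₂ T u) (hasFDerivWithinAt_jet₃ hS.T_pos hS.smooth_u hzs) hzI v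
      have h3 := ((h2.clm_apply (hasDerivAt_const (0 : ℝ) v)).clm_apply
        (hasDerivAt_const (0 : ℝ) ((0 : E d), (1 : ℝ)))).const_mul ς
      have h4 := h3.add (((hexp 0).const_mul (k * v.2)).const_mul ε)
      exact h4.congr_deriv (by simp)
  obtain ⟨e, lam, hlam⟩ := exists_eigenbasis (fderiv ℝ (gradient h) (mom T u z))
    (hS.hess_symm _)
  have hlam0 : ∀ i, 0 ≤ lam i := by
    intro i
    have := hS.hess_nonneg (mom T u z) (e i)
    rwa [hlam, real_inner_smul_left, real_inner_self_eq_norm_sq, e.norm_eq_one, one_pow,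
      mul_one] at this
  -- The perturbation depends on `t` only, so `D_x u_t = 0` at the maximum. The velocity is then
  -- stationary in time, which removes the terms with `c` and with third derivatives of `h`.
  have hp : spaceGrad d (jet₂ T u z (0, 1)) = 0 := by
    refine ext_inner_right ℝ fun w => ?_
    rw [inner_spaceGrad, jet₂_symm hS.T_pos hS.smooth_u hzs, inner_zero_left]
    have := (hloc (w, 0)).1
    simpa [hς] using this
  have hD := hS.pde_deriv e hzI (0, 1) (c := 0) (by rw [hp, map_zero])
  have hH := hS.deriv_hj hzs (0, 1)
  have hpde := hS.pde e hzI
  have hterm : ∀ i, inner ℝ (fderiv ℝ (gradient h) (mom T u z)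
      (spaceGrad d (jet₃ T u z (0, 1) (e i, 0)))) (e i) = lam i * jet₃ T u z (e i, 0) (e i, 0) (0, 1) := by
    intro i
    rw [hS.hess_symm, hlam, real_inner_smul_right, inner_spaceGrad,
      jet₃_symm_left hS.T_pos hS.smooth_u hzs, jet₃_symm_right hS.T_pos hS.smooth_u hzs]
  simp only [hp, map_zero, zero_apply, inner_zero_left, zero_add, hterm] at hD hH
  have hξ := hloc (chr T h u z)
  have hxi2 : (chr T h u z).2 = 1 := rfl
  rw [hxi2, mul_one] at hξ
  have hsum : ς * ∑ i, lam i * jet₃ T u z (e i, 0) (e i, 0) (0, 1) ≤ 0 := by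
    rw [Finset.mul_sum]
    refine Finset.sum_nonpos fun i _ => ?_
    have := (hloc (e i, 0)).2
    simp only [mul_zero, zero_pow two_ne_zero, zero_mul, add_zero] at this
    nlinarith [hlam0 i]
  rw [jet₃_symm_left hS.T_pos hS.smooth_u hzs, jet₃_symm_right hS.T_pos hS.smooth_u hzs] at hD
  rw [jet₂_symm hS.T_pos hS.smooth_u hzs] at hH
  have hn : 0 < m x t := hS.pos x t ht
  have hF := hS.deriv_F_pos _ hn
  have hb := hΛ x hx t ht
  change |_ / _ * (fderiv ℝ P z.1 (vel T h u z) - jet₂ T u z (chr T h u z) (chr T h u z))| ≤ Λ at hb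
  change _ + m x t * deriv F (m x t) * _ = _ at hpde
  change deriv F (m x t) * _ = _ at hH
  change _ - _ + deriv (fun n => n * deriv F n) (m x t) * _ * _ + m x t * deriv F (m x t) * _ = _ at hD
  have h00 : jet₂ T u z (chr T h u z) (0, 0) = 0 := map_zero _
  rw [h00] at hD
  -- By the second order equation the quantity bounded by `Λ` is exactly this drift coefficient. It
  -- was bounded in a form free of `divVel`, since the eigenbasis is known only after the maximum
  -- point.
  have hb2 : |deriv (fun n => n * deriv F n) (m x t) * divVel T h u e z / deriv F (m x t)| ≤ Λ := by
    refine le_trans (le_of_eq ?_) hb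
    rw [← hpde]
    congr 1
    field_simp
    ring
  have hX : 0 < m x t * deriv F (m x t) := mul_pos hn hF
  generalize deriv (fun n => n * deriv F n) (m x t) = X' at *
  generalize divVel T h u e z = θ at *
  generalize jet T m z (0, 1) = j at *
  generalize deriv F (m x t) = F' at *
  generalize ∑ i, lam i * jet₃ T u z (e i, 0) (e i, 0) (0, 1) = S₃ at *
  generalize jet₃ T u z (chr T h u z) (chr T h u z) (0, 1) = J₃ at *
  generalize jet₂ T u z (chr T h u z) (0, 1) = J₂ at *
  have hE : 0 < ε * k * Real.exp (k * t) := by positivity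
  generalize hEE : ε * k * Real.exp (k * t) = E' at *
  -- The first order test along `ξ` gives `ς u_{tξ} = -E'`, and the differentiated Hamilton-Jacobi
  -- equation turns this into `m_t`.
  have h1 : ς * j = E' / F' := by
    rw [eq_div_iff hF.ne']
    linear_combination ς * hH - hξ.1
  have h2 : ς * J₃ = -(X' * θ / F') * E' - (m x t * F') * (ς * S₃) := by
    linear_combination ς * hD - X' * θ * h1
  have h3 : X' * θ / F' ≤ |Λ| := (le_abs_self _).trans (hb2.trans (le_abs_self _))
  have h4 : ς * J₃ + k * E' ≤ 0 := by
    rw [← hEE]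
    linarith [hξ.2]
  have h5 : (X' * θ / F') * E' ≤ |Λ| * E' := by gcongr
  have h6 : 0 ≤ -((m x t * F') * (ς * S₃)) := by nlinarith
  rw [h2, hk] at h4
  linarith

end ReducedSystem

end Reduced

end MFG

/-! ### Comparison of `±u` with a quadratic function of time. -/

namespace MFG

section Reduced

variable {d : ℕ}

section MaxOnSlab

variable {T : ℝ} {S : E d × ℝ → ℝ} {S' : E d × ℝ →L[ℝ] ℝ} {z : E d × ℝ}

lemma convex_slab : Convex ℝ (slab d T) := convex_univ.prod (convex_Icc 0 T)

/-- The slab is convex, so the segment to `z + v` stays inside and `v` is a tangent direction. -/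
lemma apply_nonpos_of_isMaxOn_slab (hS : HasFDerivWithinAt S S' (slab d T) z)
    (hmax : IsMaxOn S (slab d T) z) (hz : z ∈ slab d T) {v : E d × ℝ} (hv : z + v ∈ slab d T) :
    S' v ≤ 0 :=
  hmax.localize.hasFDerivWithinAt_nonpos hS
    (mem_posTangentConeAt_of_segment_subset (convex_slab.segment_subset hz hv))

lemma apply_space_eq_zero_of_isMaxOn_slab (hS : HasFDerivWithinAt S S' (slab d T) z)
    (hmax : IsMaxOn S (slab d T) z) (hz : z ∈ slab d T) (v : E d) : S' (v, 0) = 0 := by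
  have hz' := mem_slab.1 hz
  refine le_antisymm (apply_nonpos_of_isMaxOn_slab hS hmax hz (mem_slab.2 (by simpa using hz'))) ?_
  have := apply_nonpos_of_isMaxOn_slab hS hmax hz (v := -(v, 0)) (mem_slab.2 (by simpa using hz'))
  rw [map_neg] at this
  linarith

/-- The slab is unbounded in space, so the inward direction may have any space component, in
particular that of a characteristic; scaling by `T` ends at the terminal time. -/
lemma apply_nonpos_of_isMaxOn_slab_initial (hT : 0 < T) (hS : HasFDerivWithinAt S S' (slab d T) z)
    (hmax : IsMaxOn S (slab d T) z) (hz : z.2 = 0) (v : E d) : S' (v, 1) ≤ 0 := by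
  have := apply_nonpos_of_isMaxOn_slab hS hmax (mem_slab.2 (by simp [hz, hT.le]))
    (v := T • (v, 1)) (mem_slab.2 (by simp [hz, hT.le]))
  rw [map_smul, smul_eq_mul] at this
  nlinarith

lemma apply_nonneg_of_isMaxOn_slab_terminal (hT : 0 < T)
    (hS : HasFDerivWithinAt S S' (slab d T) z)
    (hmax : IsMaxOn S (slab d T) z) (hz : z.2 = T) (v : E d) : 0 ≤ S' (v, 1) := by
  have := apply_nonpos_of_isMaxOn_slab hS hmax (mem_slab.2 (by simp [hz, hT.le]))
    (v := (-T) • (v, 1)) (mem_slab.2 (by simp [hz, hT.le]))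
  rw [map_smul, smul_eq_mul] at this
  nlinarith

end MaxOnSlab

namespace ReducedSystem

variable {T : ℝ} {h P : E d → ℝ} {F : ℝ → ℝ} {u m : E d → ℝ → ℝ}

/-- Comparison of `u` with a function of time: up to such a function, `±u` is maximal at the
terminal time. -/
lemma exists_terminal_max (hS : ReducedSystem T h P F u m) {ς D B : ℝ} (hς : ς = 1 ∨ ς = -1)
    (hB0 : 0 ≤ B)
    (hD : ∀ x, |fderiv ℝ P x (gradient h 0)| ≤ D)
    (hB : ∀ x, mom T u (x, 0) = 0 → |jet T u (x, 0) (0, 1)| ≤ B) :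
    ∃ x, mom T u (x, T) = 0 ∧ -((D + 1) * T + B + 1) ≤ ς * jet T u (x, T) (0, 1) ∧
      (∀ y, ς * u y T ≤ ς * u x T) ∧ ∀ y, ∀ s ∈ Icc 0 T,
        ς * u y s ≤ ς * u x T + ((D + 1) * T ^ 2 / 2 + (B + 1) * T) := by
  have hTpos := hS.T_pos
  have hς0 : ς ≠ 0 := by rcases hς with rfl | rfl <;> norm_num
  have hς1 : |ς| = 1 := by rcases hς with rfl | rfl <;> norm_num
  have hD0 : 0 ≤ D := (abs_nonneg _).trans (hD 0)
  -- `φ'' = D + 1` beats the potential term in the interior, and `φ'(0) = B + 1` beats `u_t` at time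
  -- `0`.
  set φ : ℝ → ℝ := fun t => (D + 1) * t ^ 2 / 2 + (B + 1) * t with hφ
  have hφ' : ∀ t, HasDerivAt φ ((D + 1) * t + (B + 1)) t := by
    intro t
    have h1 := ((((hasDerivAt_id t).pow 2).const_mul (D + 1)).div_const 2).add
      ((hasDerivAt_id t).const_mul (B + 1))
    refine h1.congr_deriv ?_
    simp
    ring
  obtain ⟨x, hx, t, ht, hmax⟩ := exists_isMaxOn_slab hTpos.le
    (F := fun x t => ς * u x t + φ t)
    (fun t ht x i => by have := hS.periodic_u t ht x i; simp only at this ⊢; rw [this])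
    ((continuousOn_const.mul hS.smooth_u.continuousOn).add (by fun_prop))
  set z : E d × ℝ := (x, t) with hz
  have hzs : z ∈ slab d T := mem_slab.2 ht
  have hMax : IsMaxOn (fun z : E d × ℝ => ς * u z.1 z.2 + φ z.2) (slab d T) z :=
    fun w hw => hmax w.1 w.2 (mem_slab.1 hw)
  have hder : ∀ w ∈ slab d T, HasFDerivWithinAt (fun z : E d × ℝ => ς * u z.1 z.2 + φ z.2)
      (ς • jet T u w + ((D + 1) * w.2 + (B + 1)) • ContinuousLinearMap.snd ℝ (E d) ℝ)
      (slab d T) w := by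
    intro w hw
    exact ((hasFDerivWithinAt_jet (by norm_num) hS.smooth_u hw).const_mul ς).add
      ((hφ' w.2).comp_hasFDerivWithinAt w hasFDerivWithinAt_snd)
  have hgrad : mom T u z = 0 := by
    refine ext_inner_right ℝ fun e => ?_
    have := apply_space_eq_zero_of_isMaxOn_slab (hder z hzs) hMax hzs e
    rw [mom, inner_spaceGrad, inner_zero_left]
    simpa [hς0] using this
  have htT : t = T := by
    by_contra hne
    have htT : t < T := lt_of_le_of_ne ht.2 hne
    rcases ht.1.eq_or_lt with h0 | h0
    -- A maximum at time `0` would give `ς u_t ≤ -(B + 1)` at a critical point.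
    · have h1 := apply_nonpos_of_isMaxOn_slab_initial hTpos (hder z hzs) hMax h0.symm 0
      have h2 := hB x (by rw [h0]; exact hgrad)
      simp only [add_apply, smul_apply, smul_eq_mul, ContinuousLinearMap.coe_snd', mul_one] at h1
      rw [hz, ← h0] at h1
      have h3 : |ς * jet T u (x, 0) (0, 1)| ≤ B := by rwa [abs_mul, hς1, one_mul]
      simp only [mul_zero, zero_add] at h1
      linarith [(abs_le.1 h3).1]
    -- At an interior maximum the tests give `ς(D²u(ξ,ξ) + X div b) ≤ -(D + 1)`, whereas the
    -- equation makes the left side at least `-D`.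
    · have hzI : z.2 ∈ Ioo 0 T := ⟨h0, htT⟩
      have hloc : ∀ v : E d × ℝ, ς * jet₂ T u z v v + (D + 1) * v.2 ^ 2 ≤ 0 := by
        intro v
        refine (second_deriv_nonpos_of_isLocalMax
          (σ := fun r : ℝ => ς * u (z + r • v).1 (z + r • v).2 + φ (z + r • v).2)
          (σ₁ := fun r : ℝ => ς * jet T u (z + r • v) v + ((D + 1) * (z + r • v).2 + (B + 1)) * v.2)
          (σ₂ := ς * jet₂ T u z v v + (D + 1) * v.2 ^ 2) ?_ ?_ ?_).2
        · filter_upwards [eventually_line_mem hzI v] with r hr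
          exact (hMax (mem_slab_of_Ioo hr)).trans_eq (by simp)
        · filter_upwards [eventually_line_mem hzI v] with r hr
          refine (hasDerivAt_line (hder _ (mem_slab_of_Ioo hr)) hr).congr_deriv ?_
          simp
        · have h2 := hasDerivAt_line_zero (hasFDerivWithinAt_jet₂ hTpos hS.smooth_u hzs) hzI v
          have h3 := (h2.clm_apply (hasDerivAt_const (0 : ℝ) v)).const_mul ς
          have h4 := hasDerivAt_line_zero (T := T) (z := z)
            (hasFDerivWithinAt_snd (𝕜 := ℝ) (E := E d) (F := ℝ)) hzI v
          have h5 := h3.add (((h4.const_mul (D + 1)).add_const (B + 1)).mul_const v.2)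
          refine h5.congr_deriv ?_
          simp
          ring
      obtain ⟨e, lam, hlam⟩ := exists_eigenbasis (fderiv ℝ (gradient h) (mom T u z))
        (hS.hess_symm _)
      have hlam0 : ∀ i, 0 ≤ lam i := by
        intro i
        have := hS.hess_nonneg (mom T u z) (e i)
        rwa [hlam, real_inner_smul_left, real_inner_self_eq_norm_sq, e.norm_eq_one, one_pow,
          mul_one] at this
      have hpde := hS.pde e hzI
      have hdiv : divVel T h u e z = ∑ i, lam i * jet₂ T u z (e i, 0) (e i, 0) := by
        refine Finset.sum_congr rfl fun i _ => ?_
        rw [hS.hess_symm, hlam, real_inner_smul_right, inner_spaceGrad]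
      have hsum : ς * divVel T h u e z ≤ 0 := by
        rw [hdiv, Finset.mul_sum]
        refine Finset.sum_nonpos fun i _ => ?_
        have := hloc (e i, 0)
        simp only [ne_eq, OfNat.ofNat_ne_zero, not_false_eq_true, zero_pow, mul_zero,
          add_zero] at this
        nlinarith [hlam0 i]
      have hvel : vel T h u z = gradient h 0 := by rw [vel, hgrad]
      have hξ := hloc (chr T h u z)
      have h2 : (chr T h u z).2 = 1 := rfl
      rw [h2] at hξ
      have hDx := hD z.1
      rw [← hvel] at hDx
      have h3 : |ς * fderiv ℝ P z.1 (vel T h u z)| ≤ D := by rwa [abs_mul, hς1, one_mul]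
      rw [← hpde] at h3
      have hn := hS.pos z.1 z.2 ht
      have hX := mul_pos hn (hS.deriv_F_pos _ hn)
      have := (abs_le.1 h3).1
      nlinarith
  subst htT
  refine ⟨x, hgrad, ?_, fun y => ?_, fun y s hs => ?_⟩
  · have := apply_nonneg_of_isMaxOn_slab_terminal hTpos (hder z hzs) hMax rfl 0
    simp only [add_apply, smul_apply, smul_eq_mul, ContinuousLinearMap.coe_snd', mul_one] at this
    linarith
  · have h1 := hmax y t ht
    linarith
  · have h1 := hmax y s hs
    have h2 : 0 ≤ φ s := by
      have := hs.1
      positivity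
    have h3 : φ t = (D + 1) * t ^ 2 / 2 + (B + 1) * t := rfl
    linarith

end ReducedSystem

end Reduced

end MFG

/-! ### Derivative tests for the Bernstein function. -/

namespace MFG

section Reduced

variable {d : ℕ}

/-- The Bernstein function `h(D_x u) - P(x) + k (u + c t - c₀)²`. -/
def bernsteinFun (T : ℝ) (h P : E d → ℝ) (u : E d → ℝ → ℝ) (k c c₀ : ℝ) (z : E d × ℝ) : ℝ :=
  energy T h P u z + k * (u z.1 z.2 + (c * z.2 - c₀)) ^ 2

namespace ReducedSystem

variable {T : ℝ} {h P : E d → ℝ} {F : ℝ → ℝ} {u m : E d → ℝ → ℝ} {k c c₀ : ℝ}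

lemma exists_hasFDerivWithinAt_bernsteinFun (hS : ReducedSystem T h P F u m) {z : E d × ℝ}
    (hz : z ∈ slab d T) : ∃ S' : E d × ℝ →L[ℝ] ℝ,
      HasFDerivWithinAt (bernsteinFun T h P u k c c₀) S' (slab d T) z ∧
      ∀ v, S' v = jet₂ T u z v (vel T h u z, 0) - fderiv ℝ P z.1 v.1
        + 2 * k * (u z.1 z.2 + (c * z.2 - c₀)) * (jet T u z v + c * v.2) := by
  have h1 := hasFDerivWithinAt_jet (by norm_num) hS.smooth_u hz
  have h2 : HasFDerivWithinAt (fun z : E d × ℝ => c * z.2 - c₀)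
      (c • ContinuousLinearMap.snd ℝ (E d) ℝ) (slab d T) z :=
    (hasFDerivWithinAt_snd.const_mul c).sub_const c₀
  have h3 := (hS.hasFDerivWithinAt_energy hz).add (((h1.add h2).pow 2).const_mul k)
  refine ⟨_, h3, fun v => ?_⟩
  rw [add_apply, energy_deriv_apply]
  simp
  ring

/-- The second derivative of a convex function of `D_x u` leaves the nonnegative quadratic form of
`D²h` in the second derivatives of `u`: the coercive term of Bernstein's method. -/
lemma hasDerivAt_energy_deriv (hS : ReducedSystem T h P F u m) {z : E d × ℝ}
    (hz : z.2 ∈ Ioo 0 T) (v : E d × ℝ) :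
    HasDerivAt (fun r : ℝ => jet₂ T u (z + r • v) v (vel T h u (z + r • v), 0)
        - fderiv ℝ P (z + r • v).1 v.1)
      (jet₃ T u z v v (vel T h u z, 0) + inner ℝ (spaceGrad d (jet₂ T u z v))
        (fderiv ℝ (gradient h) (mom T u z) (spaceGrad d (jet₂ T u z v)))
        - fderiv ℝ (fderiv ℝ P) z.1 v.1 v.1) 0 := by
  have hzs := mem_slab_of_Ioo hz
  have h1 := hasDerivAt_line_zero (f := jet₂ T u)
    (hasFDerivWithinAt_jet₃ hS.T_pos hS.smooth_u hzs) hz v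
  have h2 := hasDerivAt_line_zero (hS.hasFDerivWithinAt_vel hzs) hz v
  have h3 : HasDerivAt (fun r : ℝ => fderiv ℝ P (z + r • v).1)
      (fderiv ℝ (fderiv ℝ P) z.1 v.1) 0 := by
    have h2 : HasFDerivAt (fderiv ℝ P) (fderiv ℝ (fderiv ℝ P) z.1) z.1 :=
      ((hS.smooth_P.fderiv_right (m := 1) (by norm_num)).differentiable (by norm_num)
        _).hasFDerivAt
    exact hasDerivAt_line_zero (T := T) (f := fun z : E d × ℝ => fderiv ℝ P z.1)
      (h2.comp_hasFDerivWithinAt z (hasFDerivAt_fst (p := z)).hasFDerivWithinAt) hz v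
  have h4 := ((h1.clm_apply (hasDerivAt_const (0 : ℝ) v)).clm_apply
    (h2.prodMk (hasDerivAt_const (0 : ℝ) (0 : ℝ)))).sub
    (h3.clm_apply (hasDerivAt_const (0 : ℝ) v.1))
  refine h4.congr_deriv ?_
  rw [inner_spaceGrad]
  simp

/-- The inequality obtained from the second order equation at an interior maximum of the
Bernstein function. -/
lemma bernstein_ineq (hS : ReducedSystem T h P F u m) {z : E d × ℝ} (hz : z.2 ∈ Ioo 0 T)
    (hmax : IsMaxOn (bernsteinFun T h P u k c c₀) (slab d T) z)
    {e : OrthonormalBasis (Fin d) ℝ (E d)} {lam : Fin d → ℝ}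
    (hlam : ∀ i, fderiv ℝ (gradient h) (mom T u z) (e i) = lam i • e i)
    {ζ s : ℝ} (hζ : ζ = 2 * k * (u z.1 z.2 + (c * z.2 - c₀)))
    (hs : s = jet T u z (chr T h u z) + c) :
    ∃ (y : E d) (a : Fin d → E d) (j : ℝ),
      (∀ v, inner ℝ y v = fderiv ℝ P z.1 v - ζ * inner ℝ (mom T u z) v) ∧
      deriv F (m z.1 z.2) * j = ζ * s ∧
      ζ * inner ℝ (mom T u z) (fderiv ℝ (gradient h) (mom T u z) y)
        + ζ * fderiv ℝ P z.1 (vel T h u z)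
        - deriv (fun n => n * deriv F n) (m z.1 z.2) * j * (∑ i, lam i * inner ℝ (a i) (e i))
        - m z.1 z.2 * deriv F (m z.1 z.2) *
          (∑ i, inner ℝ (fderiv ℝ (fderiv ℝ (gradient h)) (mom T u z) y (a i)) (e i))
        + m z.1 z.2 * deriv F (m z.1 z.2) * (∑ i, lam i *
          (inner ℝ (a i) (fderiv ℝ (gradient h) (mom T u z) (a i))
            - fderiv ℝ (fderiv ℝ P) z.1 (e i) (e i) + 2 * k * inner ℝ (mom T u z) (e i) ^ 2))
        + 2 * k * s ^ 2 ≤ 0 := by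
  have hzs := mem_slab_of_Ioo hz
  have hTpos := hS.T_pos
  have hsymm := fun v w => jet₂_symm hTpos hS.smooth_u hzs v w
  have hn : 0 < m z.1 z.2 := hS.pos z.1 z.2 (mem_slab.1 hzs)
  have hX : 0 < m z.1 z.2 * deriv F (m z.1 z.2) := mul_pos hn (hS.deriv_F_pos _ hn)
  -- first and second derivative tests
  have hloc : ∀ v : E d × ℝ, jet₂ T u z v (vel T h u z, 0) - fderiv ℝ P z.1 v.1
        + ζ * (jet T u z v + c * v.2) = 0 ∧
      jet₃ T u z v v (vel T h u z, 0) + inner ℝ (spaceGrad d (jet₂ T u z v))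
        (fderiv ℝ (gradient h) (mom T u z) (spaceGrad d (jet₂ T u z v)))
        - fderiv ℝ (fderiv ℝ P) z.1 v.1 v.1 + 2 * k * (jet T u z v + c * v.2) ^ 2
        + ζ * jet₂ T u z v v ≤ 0 := by
    intro v
    have h1 := second_deriv_nonpos_of_isLocalMax
      (σ := fun r : ℝ => bernsteinFun T h P u k c c₀ (z + r • v))
      (σ₁ := fun r : ℝ => jet₂ T u (z + r • v) v (vel T h u (z + r • v), 0)
        - fderiv ℝ P (z + r • v).1 v.1
        + 2 * k * (u (z + r • v).1 (z + r • v).2 + (c * (z + r • v).2 - c₀))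
          * (jet T u (z + r • v) v + c * v.2))
      (σ₂ := jet₃ T u z v v (vel T h u z, 0) + inner ℝ (spaceGrad d (jet₂ T u z v))
        (fderiv ℝ (gradient h) (mom T u z) (spaceGrad d (jet₂ T u z v)))
        - fderiv ℝ (fderiv ℝ P) z.1 v.1 v.1 + (2 * k * (jet T u z v + c * v.2) ^ 2
        + ζ * jet₂ T u z v v)) ?_ ?_ ?_
    · simp only [zero_smul, add_zero] at h1
      rw [← hζ] at h1
      exact ⟨h1.1, by linarith [h1.2]⟩
    · filter_upwards [eventually_line_mem hz v] with r hr
      exact (hmax (mem_slab_of_Ioo hr)).trans_eq (by simp)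
    · filter_upwards [eventually_line_mem hz v] with r hr
      obtain ⟨S', hS', hv⟩ := hS.exists_hasFDerivWithinAt_bernsteinFun (k := k) (c := c) (c₀ := c₀)
        (mem_slab_of_Ioo hr)
      exact (hasDerivAt_line hS' hr).congr_deriv (hv v)
    · have h2 := hasDerivAt_line_zero (hasFDerivWithinAt_jet₂ hTpos hS.smooth_u hzs) hz v
      have h3 := (h2.clm_apply (hasDerivAt_const (0 : ℝ) v)).add_const (c * v.2)
      have h4 := hasDerivAt_line_zero (T := T) (z := z)
        (hasFDerivWithinAt_snd (𝕜 := ℝ) (E := E d) (F := ℝ)) hz v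
      have h5 := hasDerivAt_line_zero (hasFDerivWithinAt_jet (by norm_num) hS.smooth_u hzs) hz v
      have h6 := ((h5.add ((h4.const_mul c).sub_const c₀)).const_mul (2 * k)).mul h3
      have h7 := (hS.hasDerivAt_energy_deriv hz v).add h6
      refine h7.congr_deriv ?_
      simp [hζ]
      ring
  set b := vel T h u z with hb
  set p := mom T u z with hp
  set ξ := chr T h u z with hξ
  set A := fderiv ℝ (gradient h) p with hA
  set y := spaceGrad d (jet₂ T u z (b, 0)) with hy
  set r := spaceGrad d (jet₂ T u z ξ) with hr
  set a : Fin d → E d := fun i => spaceGrad d (jet₂ T u z (e i, 0)) with ha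
  have hpe : ∀ v : E d, jet T u z (v, 0) = inner ℝ p v := fun v => (inner_spaceGrad _ _).symm
  have hF1 : ∀ v, inner ℝ y v = fderiv ℝ P z.1 v - ζ * inner ℝ p v := by
    intro v
    have := (hloc (v, 0)).1
    rw [hy, inner_spaceGrad, hsymm]
    simp only [mul_zero, add_zero, hpe] at this
    linarith
  have hξ2 : ξ.2 = 1 := rfl
  have hξ1 : ξ.1 = -b := rfl
  have hF2 := (hloc ξ).1
  have hF3 := (hloc ξ).2
  rw [hξ2, mul_one, ← hs, hξ1, map_neg] at hF2 hF3
  simp only [neg_apply, map_neg, neg_neg] at hF3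
  have hF4 := fun i => (hloc (e i, 0)).2
  -- The equation is differentiated along the velocity frozen at `z`, since the tests contain the
  -- third derivatives `D³u(v, v, b)`. The resulting derivative of the velocity is `A y`.
  have hF5 := hS.pde_deriv e hz (b, 0) (c := A y) rfl
  have hF6 := hS.deriv_hj hzs (b, 0)
  have hF7 := hS.pde e hz
  have hdiv : divVel T h u e z = ∑ i, lam i * inner ℝ (a i) (e i) := by
    refine Finset.sum_congr rfl fun i _ => ?_
    rw [hS.hess_symm, hlam, real_inner_smul_right]
  have haa : ∀ i, jet₂ T u z (e i, 0) (e i, 0) = inner ℝ (a i) (e i) :=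
    fun i => (inner_spaceGrad _ _).symm
  have hterm : ∀ i, inner ℝ (A (spaceGrad d (jet₃ T u z (b, 0) (e i, 0)))) (e i)
      = lam i * jet₃ T u z (e i, 0) (e i, 0) (b, 0) := by
    intro i
    rw [hA, hS.hess_symm, hlam, real_inner_smul_right, inner_spaceGrad,
      jet₃_symm_left hS.T_pos hS.smooth_u hzs, jet₃_symm_right hS.T_pos hS.smooth_u hzs]
  refine ⟨y, a, jet T m z (b, 0), hF1, ?_, ?_⟩
  -- The first order test along `ξ` cancels the second derivative of `u` against the potential and
  -- leaves `ζ s`.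
  · rw [hF6, ← hξ, hsymm]
    linarith
  -- The test along `ξ` gives `⟨r, Ar⟩` and the differentiated equation gives `2⟨r, Ay⟩`; the square
  -- is completed at the cost of `⟨y, Ay⟩`, which the first order condition evaluates.
  have hquad : 0 ≤ inner ℝ (A (r + y)) (r + y) := hS.hess_nonneg _ _
  have hquad2 : inner ℝ (A (r + y)) (r + y) =
      inner ℝ r (A r) + 2 * inner ℝ r (A y) + inner ℝ y (A y) := by
    rw [map_add, inner_add_left, inner_add_right, inner_add_right, hS.hess_symm, hS.hess_symm,
      hS.hess_symm _ y r, hS.hess_symm _ y y, ← hA]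
    have : inner ℝ y (A r) = inner ℝ r (A y) := by rw [← hS.hess_symm, real_inner_comm]
    rw [this]
    ring
  have hrA : jet₂ T u z ξ (A y, 0) = inner ℝ r (A y) := (inner_spaceGrad _ _).symm
  have hyA := hF1 (A y)
  rw [jet₃_symm_left hS.T_pos hS.smooth_u hzs, jet₃_symm_right hS.T_pos hS.smooth_u hzs,
    hdiv] at hF5
  rw [hdiv] at hF7
  simp only [← hp, ← hA, hterm] at hF5
  rw [Finset.sum_add_distrib, hrA] at hF5
  -- Weighting the space tests by `X λ_i ≥ 0` reproduces the third order part of the differentiated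
  -- equation, so all third derivatives of `u` cancel in the final combination.
  have hsum : m z.1 z.2 * deriv F (m z.1 z.2) * ((∑ i, lam i *
          (inner ℝ (a i) (A (a i)) - fderiv ℝ (fderiv ℝ P) z.1 (e i) (e i)
            + 2 * k * inner ℝ p (e i) ^ 2))
        + (∑ i, lam i * jet₃ T u z (e i, 0) (e i, 0) (b, 0))
        + ζ * ∑ i, lam i * inner ℝ (a i) (e i)) ≤ 0 := by
    refine mul_nonpos_of_nonneg_of_nonpos hX.le ?_
    rw [Finset.mul_sum, ← Finset.sum_add_distrib, ← Finset.sum_add_distrib]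
    refine Finset.sum_nonpos fun i _ => ?_
    have h1 := hF4 i
    simp only [mul_zero, add_zero, hpe, haa] at h1
    have hl : 0 ≤ lam i := by
      have := hS.hess_nonneg p (e i)
      rwa [hlam, real_inner_smul_left, real_inner_self_eq_norm_sq, e.norm_eq_one, one_pow,
        mul_one] at this
    have := mul_nonpos_of_nonneg_of_nonpos hl h1
    linarith
  simp only [← hξ, ← hb, ← hy] at hF5 hF7
  change _ + inner ℝ r (A r) - _ + _ + _ ≤ 0 at hF3
  linear_combination hF3 + hsum + hquad + hquad2 - hF5 - ζ * hF7 + hyA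

end ReducedSystem

end Reduced

end MFG

/-! ### Quantitative bounds and the arithmetic of an interior maximum. -/

namespace MFG

section Reduced

variable {d : ℕ}

/-- Quantitative bounds for the data of a reduced system. The constant `ω` bounds `F(m)` from below
at the initial and terminal times. -/
structure ReducedBounds (N ω T : ℝ) (h P : E d → ℝ) (F : ℝ → ℝ) (u m : E d → ℝ → ℝ) : Prop where
  one_le : 1 ≤ N
  omega_le : ω ≤ N
  hess_ge : ∀ p v, 1 / N * ‖v‖ ^ 2 ≤ inner ℝ (fderiv ℝ (gradient h) p v) v
  hess_le : ∀ p v, inner ℝ (fderiv ℝ (gradient h) p v) v ≤ N * ‖v‖ ^ 2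
  quadratic : ∀ p, 2 * h p - N ≤ inner ℝ (gradient h p) p
  lower : ∀ p, 1 / N * ‖p‖ ^ 2 - N ≤ h p
  upper : ∀ p, h p ≤ N * ‖p‖ ^ 2 + N
  grad_le : ∀ p, ‖gradient h p‖ ≤ N * (1 + ‖p‖)
  third : ∀ p, ‖fderiv ℝ (fderiv ℝ (gradient h)) p‖ * (1 + ‖p‖) ≤ N
  P_le : ∀ x, |P x| ≤ N
  dP_le : ∀ x, ‖fderiv ℝ P x‖ ≤ N
  ddP_le : ∀ x v, |fderiv ℝ (fderiv ℝ P) x v v| ≤ N * ‖v‖ ^ 2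
  u_le : ∀ x, ∀ t ∈ Icc 0 T, |u x t| ≤ N
  inv_T : 1 / T ≤ N
  initial_ge : ∀ x, -ω ≤ F (m x 0)
  terminal_ge : ∀ x, -ω ≤ F (m x T)
  initial_le : ∀ x, F (m x 0) ≤ N
  terminal_le : ∀ x, F (m x T) ≤ N
  initial_deriv : ∀ x v, |deriv F (m x 0) * jet T m (x, 0) (v, 0)| ≤ N * ‖v‖
  terminal_deriv : ∀ x, ∃ G : E d, ∃ r > 0, ‖G‖ ≤ N ∧
    ∀ v, inner ℝ (mom T u (x, T)) v = inner ℝ G v + r * jet T m (x, T) (v, 0)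
  drift : ∀ n, 0 < n → -(ω + 1) ≤ F n →
    |deriv (fun n => n * deriv F n) n| ≤ N * deriv F n * √(n * deriv F n)

namespace ReducedSystem

variable {T : ℝ} {h P : E d → ℝ} {F : ℝ → ℝ} {u m : E d → ℝ → ℝ} {N ω : ℝ}

/-- A bound for a symmetric operator with spectrum in `[0, N]`. -/
lemma norm_apply_le_of_eigenbasis {A : E d →L[ℝ] E d} {e : OrthonormalBasis (Fin d) ℝ (E d)}
    {lam : Fin d → ℝ} (hA : ∀ v w, inner ℝ (A v) w = inner ℝ v (A w))
    (hlam : ∀ i, A (e i) = lam i • e i) (h0 : ∀ i, 0 ≤ lam i) (hN : ∀ i, lam i ≤ N) (hN0 : 0 ≤ N)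
    (y : E d) : ‖A y‖ ≤ N * ‖y‖ := by
  have h1 := e.sum_sq_norm_inner_left (A y)
  have h2 := e.sum_sq_norm_inner_left y
  have h3 : ‖A y‖ ^ 2 ≤ (N * ‖y‖) ^ 2 := by
    rw [← h1, mul_pow, ← h2, Finset.mul_sum]
    refine Finset.sum_le_sum fun i _ => ?_
    rw [hA, hlam, real_inner_smul_right, norm_mul, mul_pow, Real.norm_of_nonneg (h0 i)]
    have := pow_le_pow_left₀ (h0 i) (hN i) 2
    gcongr
  exact le_of_sq_le_sq h3 (by positivity)

set_option maxHeartbeats 1000000 in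
/-- The real inequality that excludes large gradients at an interior maximum. -/
lemma interior_arith {N k r X Y A₁ B₁ θ Q D₃ D : ℝ} (hN : 1 ≤ N) (hD : 1 ≤ D)
    (hk : k = 1 / (36 * D * N ^ 8)) (hr : 100 * D * N ^ 11 ≤ r) (hX : 0 ≤ X) {ζ s : ℝ}
    (hζ : |ζ| ≤ 6 * k * N) (hs : s ≤ -(1 / N * r ^ 2) + 9 * N ^ 2)
    (hA₁ : |A₁| ≤ N ^ 2 * (1 + r) ^ 2) (hB₁ : |B₁| ≤ N * √X * (|ζ * s|) * |θ|)
    (hθ : θ ^ 2 ≤ N ^ 2 * (D * Y)) (hD₃ : |D₃| ≤ N ^ 2 * √(D * Y)) (hY : 0 ≤ Y)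
    (hQ : 1 / N ^ 2 * Y - D * N ^ 2 + 2 * k / N * r ^ 2 ≤ Q)
    (hI : ζ * A₁ - B₁ - X * D₃ + X * Q + 2 * k * s ^ 2 ≤ 0) : False := by
  have hN0 : 0 < N := by linarith
  have hk0 : 0 < k := by rw [hk]; positivity
  have hN1 : ∀ n : ℕ, 1 ≤ N ^ n := fun n => one_le_pow₀ hN
  have hkD : k * (36 * D * N ^ 8) = 1 := by rw [hk]; field_simp
  have hr1 : 100 * N ^ 11 ≤ r := le_trans (by nlinarith [hN1 11]) hr
  have hr2 : 1 ≤ r := by linarith [hN1 11]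
  have hr3 : 100 * N ^ 3 ≤ r := le_trans (by
    have := pow_le_pow_right₀ hN (show 3 ≤ 11 by norm_num); linarith) hr1
  -- the transport derivative is very negative
  have hs2 : s ≤ -(1 / (2 * N) * r ^ 2) := by
    have h1 : 9 * N ^ 2 ≤ 1 / (2 * N) * r ^ 2 := by
      have h2 : (100 * N ^ 3) ^ 2 ≤ r ^ 2 := by gcongr
      have h3 : 1 / (2 * N) * (100 * N ^ 3) ^ 2 = 5000 * N ^ 5 := by field_simp; norm_num
      have h4 : 1 / (2 * N) * (100 * N ^ 3) ^ 2 ≤ 1 / (2 * N) * r ^ 2 := by gcongr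
      have := pow_le_pow_right₀ hN (show 2 ≤ 5 by norm_num)
      nlinarith
    have h2 : 1 / N * r ^ 2 = 1 / (2 * N) * r ^ 2 + 1 / (2 * N) * r ^ 2 := by field_simp; norm_num
    linarith
  have hs3 : 1 / (4 * N ^ 2) * r ^ 4 ≤ s ^ 2 := by
    have h1 : 0 ≤ 1 / (2 * N) * r ^ 2 := by positivity
    have h2 : (1 / (2 * N) * r ^ 2) ^ 2 ≤ (-s) ^ 2 := by
      apply pow_le_pow_left₀ h1; linarith
    have h3 : (1 / (2 * N) * r ^ 2) ^ 2 = 1 / (4 * N ^ 2) * r ^ 4 := by field_simp; norm_num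
    nlinarith
  -- the drift term
  have hB2 : |B₁| ≤ X * Y / (4 * N ^ 2) + k * s ^ 2 := by
    set α := √X * |θ| with hα
    have hα2 : α ^ 2 = X * θ ^ 2 := by rw [hα, mul_pow, Real.sq_sqrt hX, sq_abs]
    have h1 : N * √X * |ζ * s| * |θ| = α * (N * |ζ * s|) := by rw [hα]; ring
    have h2 : α * (N * |ζ * s|) ≤ α ^ 2 / (4 * N ^ 4 * D) + (N * |ζ * s|) ^ 2 * (N ^ 4 * D) := by
      have h3 : 0 ≤ (α / (2 * N ^ 2) - (N * |ζ * s|) * (N ^ 2 * D)) ^ 2 / D := by positivity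
      have h4 : (α / (2 * N ^ 2) - (N * |ζ * s|) * (N ^ 2 * D)) ^ 2 / D =
          α ^ 2 / (4 * N ^ 4 * D) + (N * |ζ * s|) ^ 2 * (N ^ 4 * D) - α * (N * |ζ * s|) := by
        field_simp
        ring
      linarith
    have h5 : α ^ 2 / (4 * N ^ 4 * D) ≤ X * Y / (4 * N ^ 2) := by
      rw [hα2]
      have : X * θ ^ 2 ≤ X * (N ^ 2 * (D * Y)) := by gcongr
      calc X * θ ^ 2 / (4 * N ^ 4 * D) ≤ X * (N ^ 2 * (D * Y)) / (4 * N ^ 4 * D) := by gcongr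
        _ = X * Y / (4 * N ^ 2) := by field_simp
    -- This fixes `k`: as `|ζ| ≤ 6kN`, the left side is at most `k s²` times `36kDN⁸`, which equals
    -- one.
    have h6 : (N * |ζ * s|) ^ 2 * (N ^ 4 * D) ≤ k * s ^ 2 := by
      have h7 : ζ ^ 2 ≤ (6 * k * N) ^ 2 := by
        rw [← sq_abs]; gcongr
      have h8 : (N * |ζ * s|) ^ 2 * (N ^ 4 * D) = ζ ^ 2 * (s ^ 2 * N ^ 6 * D) := by
        rw [mul_pow, sq_abs]; ring
      rw [h8]
      calc ζ ^ 2 * (s ^ 2 * N ^ 6 * D) ≤ (6 * k * N) ^ 2 * (s ^ 2 * N ^ 6 * D) := by gcongr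
        _ = k * s ^ 2 * (k * (36 * D * N ^ 8)) := by ring
        _ = k * s ^ 2 := by rw [hkD, mul_one]
    linarith
  -- the third order term
  have hD2 : |D₃| ≤ Y / (4 * N ^ 2) + N ^ 6 * D := by
    set β := √(D * Y) with hβ
    have hβ2 : β ^ 2 = D * Y := Real.sq_sqrt (by positivity)
    have h3 : 0 ≤ (β / (2 * N) - N ^ 3 * D) ^ 2 / D := by positivity
    have h4 : (β / (2 * N) - N ^ 3 * D) ^ 2 / D = β ^ 2 / (4 * N ^ 2 * D) + N ^ 6 * D - N ^ 2 * β := by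
      field_simp
      ring
    have h5 : β ^ 2 / (4 * N ^ 2 * D) = Y / (4 * N ^ 2) := by rw [hβ2]; field_simp
    linarith
  -- The factor `X` is not bounded, so everything it multiplies must be nonnegative together. The
  -- part `2k r²/N` of `Q` pays for the constants, which is why `r` is taken of order `DN¹¹`.
  have hQ2 : 0 ≤ Q - |D₃| - Y / (4 * N ^ 2) := by
    have h1 : 2 * N ^ 6 * D ≤ 2 * k / N * r ^ 2 := by
      have h2 : (100 * D * N ^ 11) ^ 2 ≤ r ^ 2 := by gcongr
      have h3 : 2 * k / N * (100 * D * N ^ 11) ^ 2 ≤ 2 * k / N * r ^ 2 := by gcongr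
      have h4 : 2 * k / N * (100 * D * N ^ 11) ^ 2 =
          (k * (36 * D * N ^ 8)) * (20000 / 36 * D * N ^ 13) := by
        field_simp
        norm_num
      rw [hkD, one_mul] at h4
      have h5 := pow_le_pow_right₀ hN (show 6 ≤ 13 by norm_num)
      have h6 : D * N ^ 6 ≤ D * N ^ 13 := by gcongr
      have h7 : 0 < D * N ^ 6 := by positivity
      nlinarith
    have h2 : D * N ^ 2 ≤ D * N ^ 6 := by
      have := pow_le_pow_right₀ hN (show 2 ≤ 6 by norm_num); gcongr
    have h3 : 1 / N ^ 2 * Y = Y / (4 * N ^ 2) + Y / (4 * N ^ 2) + Y / (2 * N ^ 2) := by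
      ring
    have h4 : 0 ≤ Y / (2 * N ^ 2) := by positivity
    linarith
  have hζA : |ζ * A₁| ≤ 6 * k * N * (N ^ 2 * (1 + r) ^ 2) := by
    rw [abs_mul]; gcongr
  have hXD : X * D₃ ≤ X * |D₃| := by gcongr; exact le_abs_self _
  have hXQ := mul_nonneg hX hQ2
  -- What remains compares `s²`, of order `r⁴`, with a term of order `r²`; `k` cancels.
  have h1 : k * s ^ 2 ≤ 6 * k * N * (N ^ 2 * (1 + r) ^ 2) := by
    have e1 := (abs_le.1 hζA).1
    have e2 := (abs_le.1 hB2).2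
    have e3 : X * (Q - |D₃| - Y / (4 * N ^ 2)) = X * Q - X * |D₃| - X * Y / (4 * N ^ 2) := by ring
    linarith
  have h2 : s ^ 2 ≤ 24 * N ^ 3 * r ^ 2 := by
    have e1 : (1 + r) ^ 2 ≤ (2 * r) ^ 2 := by gcongr; linarith
    have e2 : k * s ^ 2 ≤ k * (6 * N ^ 3 * (2 * r) ^ 2) :=
      h1.trans (by
        have : 6 * k * N * (N ^ 2 * (1 + r) ^ 2) = k * (6 * N ^ 3 * (1 + r) ^ 2) := by ring
        rw [this]; gcongr)
    have := le_of_mul_le_mul_left e2 hk0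
    linarith
  have h3 : r ^ 4 ≤ 96 * N ^ 5 * r ^ 2 := by
    have e1 := hs3.trans h2
    have e2 : 4 * N ^ 2 * (1 / (4 * N ^ 2) * r ^ 4) ≤ 4 * N ^ 2 * (24 * N ^ 3 * r ^ 2) := by gcongr
    have e3 : 4 * N ^ 2 * (1 / (4 * N ^ 2) * r ^ 4) = r ^ 4 := by field_simp
    rw [e3] at e2
    linarith
  have h4 : r ^ 2 ≤ 96 * N ^ 5 := by
    have : r ^ 2 * r ^ 2 ≤ r ^ 2 * (96 * N ^ 5) := by linarith
    exact le_of_mul_le_mul_left this (by positivity)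
  have h5 : (100 * N ^ 3) ^ 2 ≤ r ^ 2 := by gcongr
  have h6 := pow_le_pow_right₀ hN (show 5 ≤ 6 by norm_num)
  have h7 := hN1 6
  linarith

end ReducedSystem

end Reduced

end MFG

/-! ### The gradient bound for the reduced system. -/

namespace MFG

section Reduced

variable {d : ℕ}

namespace ReducedSystem

variable {T : ℝ} {h P : E d → ℝ} {F : ℝ → ℝ} {u m : E d → ℝ → ℝ} {N ω : ℝ}

lemma energy_le (hB : ReducedBounds N ω T h P F u m) (z : E d × ℝ) :
    energy T h P u z ≤ N * ‖mom T u z‖ ^ 2 + 2 * N := by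
  have h1 := hB.upper (mom T u z)
  have h2 := (abs_le.1 (hB.P_le z.1)).1
  rw [energy]
  linarith

lemma le_energy (hB : ReducedBounds N ω T h P F u m) (z : E d × ℝ) :
    1 / N * ‖mom T u z‖ ^ 2 - 2 * N ≤ energy T h P u z := by
  have h1 := hB.lower (mom T u z)
  have h2 := (abs_le.1 (hB.P_le z.1)).2
  rw [energy]
  linarith

lemma jet_space (z : E d × ℝ) (v : E d) : jet T u z (v, 0) = inner ℝ (mom T u z) v :=
  (inner_spaceGrad _ _).symm

/-- Where `F(m)` is bounded below, the derivative of `u + c t` along characteristics is very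
negative for large gradients. -/
lemma jet_chr_le (hS : ReducedSystem T h P F u m) (hB : ReducedBounds N ω T h P F u m)
    {z : E d × ℝ} (hz : z ∈ slab d T) (hF : -(ω + 1) ≤ F (m z.1 z.2)) :
    jet T u z (chr T h u z) + 2 * (N + 1) / T ≤ -(1 / N * ‖mom T u z‖ ^ 2) + 9 * N ^ 2 := by
  have h1 := hS.hj_jet hz
  have h2 := hB.quadratic (mom T u z)
  have h3 := hB.lower (mom T u z)
  have h4 := (abs_le.1 (hB.P_le z.1)).1
  have h5 := hB.omega_le
  have hN := hB.one_le
  have hT : 2 * (N + 1) / T ≤ 2 * (N + 1) * N := by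
    have := hB.inv_T
    rw [div_eq_mul_one_div]
    gcongr
  -- Along `ξ`, `u` has derivative `h - Dh·p - P - F(m)`, and the quadratic condition gives `h -
  -- Dh·p ≤ N - h`.
  rw [chr_apply, jet_space, real_inner_comm]
  rw [energy] at h1
  change 2 * h (mom T u z) - N ≤ inner ℝ (vel T h u z) (mom T u z) at h2
  nlinarith

set_option maxHeartbeats 1000000 in
/-- The gradient bound at an interior maximum of the Bernstein function. -/
lemma mom_le_of_interior_max (hS : ReducedSystem T h P F u m) (hB : ReducedBounds N ω T h P F u m)
    {k : ℝ} (hk : k = 1 / (36 * ((d : ℝ) + 1) * N ^ 8)) {z : E d × ℝ} (hz : z.2 ∈ Ioo 0 T)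
    (hmax : IsMaxOn (bernsteinFun T h P u k (2 * (N + 1) / T) (N + 1)) (slab d T) z)
    (hF : -(ω + 1) ≤ F (m z.1 z.2))
    (hζ : |2 * k * (u z.1 z.2 + (2 * (N + 1) / T * z.2 - (N + 1)))| ≤ 6 * k * N) :
    ‖mom T u z‖ ≤ 100 * ((d : ℝ) + 1) * N ^ 11 := by
  by_contra! hlt
  have hzs := mem_slab_of_Ioo hz
  have hN := hB.one_le
  have hN0 : 0 < N := by linarith
  have hd0 : (0 : ℝ) ≤ d := Nat.cast_nonneg d
  have hn : 0 < m z.1 z.2 := hS.pos z.1 z.2 (mem_slab.1 hzs)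
  have hF' := hS.deriv_F_pos _ hn
  have hX : 0 < m z.1 z.2 * deriv F (m z.1 z.2) := mul_pos hn hF'
  have hk0 : 0 < k := by rw [hk]; positivity
  have hkN : 6 * k * N ≤ 1 := by
    rw [hk]
    have h1 : N ≤ N ^ 8 := le_self_pow₀ hN (by norm_num)
    rw [show 6 * (1 / (36 * ((d : ℝ) + 1) * N ^ 8)) * N = N / (6 * ((d : ℝ) + 1) * N ^ 8) by
      field_simp; norm_num, div_le_one (by positivity)]
    have h2 : 0 ≤ (d : ℝ) * N ^ 8 := by positivity
    nlinarith
  obtain ⟨e, lam, hlam⟩ := exists_eigenbasis (fderiv ℝ (gradient h) (mom T u z)) (hS.hess_symm _)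
  have hlam_eq : ∀ i, inner ℝ (fderiv ℝ (gradient h) (mom T u z) (e i)) (e i) = lam i := by
    intro i
    rw [hlam, real_inner_smul_left, real_inner_self_eq_norm_sq, e.norm_eq_one, one_pow, mul_one]
  have hlam1 : ∀ i, 1 / N ≤ lam i := by
    intro i
    have := hB.hess_ge (mom T u z) (e i)
    rwa [hlam_eq, e.norm_eq_one, one_pow, mul_one] at this
  have hlam2 : ∀ i, lam i ≤ N := by
    intro i
    have := hB.hess_le (mom T u z) (e i)
    rwa [hlam_eq, e.norm_eq_one, one_pow, mul_one] at this
  have hlam0 : ∀ i, 0 ≤ lam i := fun i => le_trans (by positivity) (hlam1 i)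
  set ζ := 2 * k * (u z.1 z.2 + (2 * (N + 1) / T * z.2 - (N + 1))) with hζdef
  set s := jet T u z (chr T h u z) + 2 * (N + 1) / T with hs
  obtain ⟨y, a, j, hy, hj, hI⟩ := hS.bernstein_ineq hz hmax hlam hζdef hs
  have hsle := hS.jet_chr_le hB hzs hF
  rw [← hs] at hsle
  set p := mom T u z with hp
  set A := fderiv ℝ (gradient h) p with hA
  set X := m z.1 z.2 * deriv F (m z.1 z.2) with hXdef
  set Y := ∑ i, ‖a i‖ ^ 2 with hY
  have hY0 : 0 ≤ Y := Finset.sum_nonneg fun i _ => by positivity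
  -- Cauchy-Schwarz with `d + 1` in place of `d`, so that the constant is at least one even for `d =
  -- 0`.
  have hsumsq : (∑ i, ‖a i‖) ^ 2 ≤ ((d : ℝ) + 1) * Y := by
    have := sq_sum_le_card_mul_sum_sq (s := Finset.univ) (f := fun i => ‖a i‖)
    simp only [Finset.card_univ, Fintype.card_fin] at this
    nlinarith
  have hsum0 : 0 ≤ ∑ i, ‖a i‖ := Finset.sum_nonneg fun i _ => norm_nonneg _
  have hdP : ∀ v, |fderiv ℝ P z.1 v| ≤ N * ‖v‖ := fun v =>
    (ContinuousLinearMap.le_of_opNorm_le _ (hB.dP_le z.1) v)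
  -- The linear growth of `y` is matched by the decay `(1 + |p|)⁻¹` of the third derivatives of `h`,
  -- so their product stays bounded.
  have hynorm : ‖y‖ ≤ N * (1 + ‖p‖) := by
    have h1 := hy y
    rw [real_inner_self_eq_norm_sq] at h1
    have h2 := (abs_le.1 (hdP y)).2
    have h3 : |ζ * inner ℝ p y| ≤ 1 * (‖p‖ * ‖y‖) := by
      rw [abs_mul]
      gcongr
      · exact hζ.trans hkN
      · exact abs_real_inner_le_norm p y
    have h4 := (abs_le.1 h3).1
    have h5 : ‖y‖ * ‖y‖ ≤ ‖y‖ * (N * (1 + ‖p‖)) := by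
      have : ‖p‖ * ‖y‖ ≤ N * (‖p‖ * ‖y‖) := le_mul_of_one_le_left (by positivity) hN
      nlinarith
    rcases (norm_nonneg y).eq_or_lt with h6 | h6
    · rw [← h6]; positivity
    · exact le_of_mul_le_mul_left h5 h6
  have hAy : ‖A y‖ ≤ N * ‖y‖ :=
    norm_apply_le_of_eigenbasis (hS.hess_symm _) hlam hlam0 hlam2 hN0.le y
  refine interior_arith (A₁ := inner ℝ p (A y) + fderiv ℝ P z.1 (vel T h u z))
    (B₁ := deriv (fun n => n * deriv F n) (m z.1 z.2) * j * (∑ i, lam i * inner ℝ (a i) (e i)))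
    (θ := ∑ i, lam i * inner ℝ (a i) (e i)) (Y := Y) (D := (d : ℝ) + 1)
    (D₃ := ∑ i, inner ℝ (fderiv ℝ (fderiv ℝ (gradient h)) p y (a i)) (e i))
    (Q := ∑ i, lam i * (inner ℝ (a i) (A (a i)) - fderiv ℝ (fderiv ℝ P) z.1 (e i) (e i)
      + 2 * k * inner ℝ p (e i) ^ 2))
    hN (by linarith) hk hlt.le hX.le hζ hsle ?_ ?_ ?_ ?_ hY0 ?_ ?_
  · have h1 : |inner ℝ p (A y)| ≤ ‖p‖ * (N * (N * (1 + ‖p‖))) :=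
      (abs_real_inner_le_norm _ _).trans (by gcongr; exact hAy.trans (by gcongr))
    have h2 : |fderiv ℝ P z.1 (vel T h u z)| ≤ N * (N * (1 + ‖p‖)) :=
      (hdP _).trans (by gcongr; exact hB.grad_le p)
    refine (abs_add_le _ _).trans ?_
    linarith
  · have h1 := hB.drift _ hn hF
    have h2 : |deriv (fun n => n * deriv F n) (m z.1 z.2) * j|
        ≤ N * √X * |ζ * s| := by
      rw [abs_mul, ← hj, abs_mul, abs_of_pos hF']
      calc _ ≤ N * deriv F (m z.1 z.2) * √X * |j| := by gcongr
        _ = _ := by ring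
    rw [abs_mul]
    gcongr
  · have h1 : |∑ i, lam i * inner ℝ (a i) (e i)| ≤ N * ∑ i, ‖a i‖ := by
      refine (Finset.abs_sum_le_sum_abs _ _).trans ?_
      rw [Finset.mul_sum]
      refine Finset.sum_le_sum fun i _ => ?_
      rw [abs_mul, abs_of_nonneg (hlam0 i)]
      have := abs_real_inner_le_norm (a i) (e i)
      rw [e.norm_eq_one, mul_one] at this
      have := hlam2 i
      gcongr
    rw [← sq_abs]
    calc _ ≤ (N * ∑ i, ‖a i‖) ^ 2 := by gcongr
      _ = N ^ 2 * (∑ i, ‖a i‖) ^ 2 := by ring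
      _ ≤ _ := by gcongr
  · have h0 : ‖fderiv ℝ (fderiv ℝ (gradient h)) p‖ * ‖y‖ ≤ N ^ 2 := by
      have h1 := hB.third p
      calc _ ≤ ‖fderiv ℝ (fderiv ℝ (gradient h)) p‖ * (N * (1 + ‖p‖)) := by gcongr
        _ = N * (‖fderiv ℝ (fderiv ℝ (gradient h)) p‖ * (1 + ‖p‖)) := by ring
        _ ≤ N * N := by gcongr
        _ = _ := by ring
    have h1 : |∑ i, inner ℝ (fderiv ℝ (fderiv ℝ (gradient h)) p y (a i)) (e i)|
        ≤ N ^ 2 * ∑ i, ‖a i‖ := by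
      refine (Finset.abs_sum_le_sum_abs _ _).trans ?_
      rw [Finset.mul_sum]
      refine Finset.sum_le_sum fun i _ => ?_
      have h2 := abs_real_inner_le_norm (fderiv ℝ (fderiv ℝ (gradient h)) p y (a i)) (e i)
      rw [e.norm_eq_one, mul_one] at h2
      refine h2.trans ((ContinuousLinearMap.le_opNorm _ _).trans ?_)
      gcongr
      exact (ContinuousLinearMap.le_opNorm _ _).trans h0
    refine h1.trans ?_
    gcongr
    exact Real.le_sqrt_of_sq_le hsumsq
  · have hpn : ∑ i, inner ℝ p (e i) ^ 2 = ‖p‖ ^ 2 := by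
      rw [← e.sum_sq_norm_inner_left p]
      exact Finset.sum_congr rfl fun i _ => by rw [Real.norm_eq_abs, sq_abs]
    have hterm : ∀ i, 1 / N ^ 2 * ‖a i‖ ^ 2 - N * N + 2 * k / N * inner ℝ p (e i) ^ 2 ≤
        lam i * (inner ℝ (a i) (A (a i)) - fderiv ℝ (fderiv ℝ P) z.1 (e i) (e i)
      + 2 * k * inner ℝ p (e i) ^ 2) := by
      intro i
      have h1 := hB.hess_ge p (a i)
      rw [real_inner_comm, ← hA] at h1
      have h2 := hB.ddP_le z.1 (e i)
      rw [e.norm_eq_one, one_pow, mul_one] at h2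
      have h3 : 1 / N * (1 / N * ‖a i‖ ^ 2) ≤ lam i * inner ℝ (a i) (A (a i)) :=
        mul_le_mul (hlam1 i) h1 (by positivity) (hlam0 i)
      have h4 : lam i * fderiv ℝ (fderiv ℝ P) z.1 (e i) (e i) ≤ N * N := by
        calc _ ≤ lam i * N := by
              have := hlam0 i
              gcongr
              exact (abs_le.1 h2).2
          _ ≤ _ := by gcongr; exact hlam2 i
      have h5 : 1 / N * (2 * k * inner ℝ p (e i) ^ 2) ≤ lam i * (2 * k * inner ℝ p (e i) ^ 2) :=
        mul_le_mul_of_nonneg_right (hlam1 i) (by positivity)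
      have h6 : 1 / N ^ 2 * ‖a i‖ ^ 2 = 1 / N * (1 / N * ‖a i‖ ^ 2) := by ring
      have h7 : 2 * k / N * inner ℝ p (e i) ^ 2 = 1 / N * (2 * k * inner ℝ p (e i) ^ 2) := by ring
      rw [h6, h7]
      linarith
    refine le_trans ?_ (Finset.sum_le_sum fun i _ => hterm i)
    rw [Finset.sum_add_distrib, Finset.sum_sub_distrib,
      ← Finset.mul_sum _ (fun i => ‖a i‖ ^ 2), ← Finset.mul_sum _ (fun i => inner ℝ p (e i) ^ 2), hpn]
    simp only [Finset.sum_const, Finset.card_univ, Fintype.card_fin, nsmul_eq_mul]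
    linarith [sq_nonneg N]
  · linarith

/-- The affine term runs from `-(N+1)` to `N+1`. It makes the shifted function at most `-1` at time
`0` and at least `1` at time `T`, while its size stays of order `N`. -/
lemma abs_shifted_le (hS : ReducedSystem T h P F u m) (hB : ReducedBounds N ω T h P F u m)
    {w : E d × ℝ} (hw : w ∈ slab d T) :
    |u w.1 w.2 + (2 * (N + 1) / T * w.2 - (N + 1))| ≤ 3 * N := by
  have hT := hS.T_pos
  have hN := hB.one_le
  have h1 := abs_le.1 (hB.u_le w.1 w.2 (mem_slab.1 hw))
  have h2 := mem_slab.1 hw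
  have h3 : 0 ≤ 2 * (N + 1) / T * w.2 := by have := h2.1; positivity
  have h4 : 2 * (N + 1) / T * w.2 ≤ 2 * (N + 1) := by
    rw [div_mul_eq_mul_div, div_le_iff₀ hT]
    have := h2.2
    gcongr
  rw [abs_le]
  constructor <;> linarith [h1.1, h1.2]

lemma shifted_sq_le (hS : ReducedSystem T h P F u m) (hB : ReducedBounds N ω T h P F u m)
    {k : ℝ} (hk : k = 1 / (36 * ((d : ℝ) + 1) * N ^ 8)) {w : E d × ℝ} (hw : w ∈ slab d T) :
    k * (u w.1 w.2 + (2 * (N + 1) / T * w.2 - (N + 1))) ^ 2 ≤ 1 := by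
  have hN := hB.one_le
  have hN0 : 0 < N := by linarith
  have hd0 : (0 : ℝ) ≤ d := Nat.cast_nonneg d
  have hk0 : 0 < k := by rw [hk]; positivity
  have hk9 : k * (9 * N ^ 2) ≤ 1 := by
    rw [hk]
    have h1 : N ^ 2 ≤ N ^ 8 := pow_le_pow_right₀ hN (by norm_num)
    rw [show 1 / (36 * ((d : ℝ) + 1) * N ^ 8) * (9 * N ^ 2) = 9 * N ^ 2 / (36 * ((d : ℝ) + 1) * N ^ 8)
      by ring, div_le_one (by positivity)]
    have h2 : 0 ≤ (d : ℝ) * N ^ 8 := by positivity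
    have h3 : 0 ≤ N ^ 8 := by positivity
    linarith
  refine le_trans ?_ hk9
  have := abs_shifted_le hS hB hw
  rw [← sq_abs]
  have h2 : |u w.1 w.2 + (2 * (N + 1) / T * w.2 - (N + 1))| ^ 2 ≤ (3 * N) ^ 2 := by gcongr
  calc _ ≤ k * (3 * N) ^ 2 := by gcongr
    _ = _ := by ring

set_option maxHeartbeats 1000000 in
/-- The gradient bound at a maximum of the Bernstein function. -/
lemma mom_le_of_max (hS : ReducedSystem T h P F u m) (hB : ReducedBounds N ω T h P F u m)
    {k : ℝ} (hk : k = 1 / (36 * ((d : ℝ) + 1) * N ^ 8)) {z : E d × ℝ} (hz : z ∈ slab d T)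
    (hmax : IsMaxOn (bernsteinFun T h P u k (2 * (N + 1) / T) (N + 1)) (slab d T) z) :
    ‖mom T u z‖ ≤ 100 * ((d : ℝ) + 1) * N ^ 11 := by
  have hT := hS.T_pos
  have hN := hB.one_le
  have hN0 : 0 < N := by linarith
  have hd0 : (0 : ℝ) ≤ d := Nat.cast_nonneg d
  have hk0 : 0 < k := by rw [hk]; positivity
  have hζ : |2 * k * (u z.1 z.2 + (2 * (N + 1) / T * z.2 - (N + 1)))| ≤ 6 * k * N := by
    rw [abs_mul, abs_of_pos (by positivity : 0 < 2 * k)]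
    have := abs_shifted_le hS hB hz
    calc _ ≤ 2 * k * (3 * N) := by gcongr
      _ = _ := by ring
  -- lower bound for the density at the maximum
  have hFz : -(ω + 1) ≤ F (m z.1 z.2) := by
    -- The energy equals `u_t + F(m)`, so at the end times `u_t` is at most `max S + ω`. The maximum
    -- principle carries this to `z`, where `F(m)` is the energy minus `u_t`; only `-ω` and the
    -- small term `k(u + ct - c₀)² ≤ 1` survive.
    have hbd : ∀ w ∈ slab d T, -ω ≤ F (m w.1 w.2) →
        1 * jet T u w (0, 1) ≤ bernsteinFun T h P u k (2 * (N + 1) / T) (N + 1) z + ω := by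
      intro w hw hω
      have h1 := hS.hj_jet hw
      have h2 : bernsteinFun _ _ _ _ _ _ _ w ≤ bernsteinFun _ _ _ _ _ _ _ z := hmax hw
      rw [bernsteinFun] at h2
      have h3 : 0 ≤ k * (u w.1 w.2 + (2 * (N + 1) / T * w.2 - (N + 1))) ^ 2 := by positivity
      linarith
    have h0 := hS.time_deriv_le one_ne_zero
      (fun x => hbd (x, 0) (mem_slab.2 ⟨le_rfl, hT.le⟩) (hB.initial_ge x))
      (fun x => hbd (x, T) (mem_slab.2 ⟨hT.le, le_rfl⟩) (hB.terminal_ge x)) hz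
    have h1 := hS.hj_jet hz
    rw [bernsteinFun] at h0
    linarith [shifted_sq_le hS hB hk hz]
  by_contra! hlt
  obtain ⟨S', hS', hv⟩ := hS.exists_hasFDerivWithinAt_bernsteinFun (k := k)
    (c := 2 * (N + 1) / T) (c₀ := N + 1) hz
  have hSξ := hv (chr T h u z)
  have hsle := hS.jet_chr_le hB hz hFz
  have hdw := hS.deriv_hj hz (vel T h u z, 0)
  rw [jet₂_symm hT hS.smooth_u hz] at hdw
  have hξ2 : (chr T h u z).2 = 1 := rfl
  have hξ1 : (chr T h u z).1 = -vel T h u z := rfl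
  rw [hξ2, mul_one, hξ1, map_neg] at hSξ
  set s := jet T u z (chr T h u z) + 2 * (N + 1) / T with hs
  set r := ‖mom T u z‖ with hr
  have hN11 : 1 ≤ N ^ 11 := one_le_pow₀ hN
  have hr0 : 100 * N ^ 11 ≤ r := le_trans (by nlinarith) hlt.le
  have hr3 : 100 * N ^ 3 ≤ r := le_trans (by
    have := pow_le_pow_right₀ hN (show 3 ≤ 11 by norm_num); linarith) hr0
  have hr1 : 1 ≤ r := by linarith
  have hN3 : 1 ≤ N ^ 3 := one_le_pow₀ hN
  have hrN : 100 * N ^ 2 * r ≤ 1 / N * r ^ 2 := by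
    have : 1 / N * r ^ 2 = (1 / N * r) * r := by ring
    rw [this]
    refine mul_le_mul_of_nonneg_right ?_ (by linarith)
    rw [one_div, inv_mul_eq_div, le_div_iff₀ hN0]
    linarith
  have hN2 : 1 ≤ N ^ 2 := one_le_pow₀ hN
  have hs2 : s ≤ -(1 / (2 * N) * r ^ 2) := by
    have h1 : 1 / N * r ^ 2 = 1 / (2 * N) * r ^ 2 + 1 / (2 * N) * r ^ 2 := by
      field_simp; norm_num
    have h2 : 100 * N ^ 2 * 1 ≤ 100 * N ^ 2 * r := by gcongr
    linarith
  have hvel : ‖vel T h u z‖ ≤ N * (1 + r) := hB.grad_le _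
  rcases (mem_slab.1 hz).1.eq_or_lt with h0 | h0
  -- At time `0` the test along `ξ` gives `ζ s ≤ F'(m₀) Dm₀·b`, of linear growth; but `ζ` and `s`
  -- are both negative there and `ζ s` grows quadratically.
  · have h1 := apply_nonpos_of_isMaxOn_slab_initial hT hS' hmax h0.symm (-vel T h u z)
    change S' (chr T h u z) ≤ 0 at h1
    have hdm := (abs_le.1 (hB.initial_deriv z.1 (vel T h u z))).2
    have hzz : z = (z.1, 0) := by rw [h0]
    rw [← hzz] at hdm
    have hm0 : m z.1 z.2 = m z.1 0 := by rw [← h0]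
    rw [hm0] at hdw
    have hu := (abs_le.1 (hB.u_le z.1 z.2 (mem_slab.1 hz))).2
    have hut1 : u z.1 z.2 + (2 * (N + 1) / T * z.2 - (N + 1)) ≤ -1 := by
      have : 2 * (N + 1) / T * z.2 = 0 := by rw [← h0, mul_zero]
      rw [this]; linarith
    have h2 : 2 * k * (1 / (2 * N) * r ^ 2) ≤
        2 * k * (u z.1 z.2 + (2 * (N + 1) / T * z.2 - (N + 1))) * s := by
      rw [mul_assoc (2 * k)]
      have : 0 ≤ 1 / (2 * N) * r ^ 2 := by positivity
      have h3 : 1 / (2 * N) * r ^ 2 ≤ (u z.1 z.2 + (2 * (N + 1) / T * z.2 - (N + 1))) * s := by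
        nlinarith
      exact mul_le_mul_of_nonneg_left h3 (by positivity)
    have h4 : 2 * k * (1 / (2 * N) * r ^ 2) ≤ N * (N * (1 + r)) := by
      have : N * ‖vel T h u z‖ ≤ N * (N * (1 + r)) := by gcongr
      linarith
    have h5 : k * r ^ 2 ≤ 2 * N ^ 3 * r := by
      have h6 : N * (2 * k * (1 / (2 * N) * r ^ 2)) = k * r ^ 2 := by field_simp
      rw [← h6]
      calc _ ≤ N * (N * (N * (1 + r))) := by gcongr
        _ ≤ N * (N * (N * (2 * r))) := by gcongr; linarith
        _ = _ := by ring
    have h6 : k * r ≤ 2 * N ^ 3 := by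
      have : r * (k * r) ≤ r * (2 * N ^ 3) := by linarith
      exact le_of_mul_le_mul_left this (by linarith)
    have h7 : k * (100 * ((d : ℝ) + 1) * N ^ 11) < k * r := by gcongr
    have h8 : k * (100 * ((d : ℝ) + 1) * N ^ 11) = 100 / 36 * N ^ 3 := by
      rw [hk]; field_simp
    rw [h8] at h7
    linarith
  · rcases (mem_slab.1 hz).2.eq_or_lt with h1 | h1
    -- At time `T` one has `ζ > 0 > s`, so the test forces `D_x m·b < 0`. The terminal condition
    -- then bounds `D_x u·b` linearly, against its quadratic growth.
    · have h2 := apply_nonneg_of_isMaxOn_slab_terminal hT hS' hmax h1 (-vel T h u z)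
      change 0 ≤ S' (chr T h u z) at h2
      obtain ⟨G, ρ, hρ, hG, hGv⟩ := hB.terminal_deriv z.1
      have hzz : z = (z.1, T) := by rw [← h1]
      rw [← hzz] at hGv
      have hu := (abs_le.1 (hB.u_le z.1 z.2 (mem_slab.1 hz))).1
      have hut1 : 1 ≤ u z.1 z.2 + (2 * (N + 1) / T * z.2 - (N + 1)) := by
        have : 2 * (N + 1) / T * z.2 = 2 * (N + 1) := by
          rw [h1]; field_simp
        rw [this]; linarith
      have hs0 : s < 0 := by
        have : 0 < 1 / (2 * N) * r ^ 2 := by positivity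
        linarith
      have h3 : 2 * k * (u z.1 z.2 + (2 * (N + 1) / T * z.2 - (N + 1))) * s < 0 :=
        mul_neg_of_pos_of_neg (by positivity) hs0
      have hn : 0 < m z.1 z.2 := hS.pos z.1 z.2 (mem_slab.1 hz)
      have hF' := hS.deriv_F_pos _ hn
      have hj : jet T m z (vel T h u z, 0) < 0 := by
        by_contra! hj
        have := mul_nonneg hF'.le hj
        linarith
      have h4 := hGv (vel T h u z)
      have h5 : inner ℝ G (vel T h u z) ≤ N * (N * (1 + r)) :=
        (real_inner_le_norm _ _).trans (by gcongr)
      have h6 := hB.quadratic (mom T u z)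
      have h7 := hB.lower (mom T u z)
      rw [real_inner_comm] at h6
      change _ ≤ inner ℝ (mom T u z) (vel T h u z) at h6
      have h8 := mul_neg_of_pos_of_neg hρ hj
      have h9 : N ≤ N ^ 2 := le_self_pow₀ hN two_ne_zero
      have h10 : N ^ 2 ≤ N ^ 2 * r := le_mul_of_one_le_right (by positivity) hr1
      linarith
    · exact absurd (hS.mom_le_of_interior_max hB hk ⟨h0, h1⟩ hmax hFz hζ) (not_le.2 hlt)

/-- The global gradient bound. -/
lemma gradient_bound (hS : ReducedSystem T h P F u m) (hB : ReducedBounds N ω T h P F u m)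
    {R : ℝ} (hR : R = 100 * ((d : ℝ) + 1) * N ^ 11) {z : E d × ℝ} (hz : z ∈ slab d T) :
    ‖mom T u z‖ ^ 2 ≤ N * (N * R ^ 2 + 4 * N + 1) ∧
      |jet T u z (0, 1)| ≤ N * R ^ 2 + 3 * N + 1 := by
  have hT := hS.T_pos
  have hN := hB.one_le
  have hN0 : 0 < N := by linarith
  have hd0 : (0 : ℝ) ≤ d := Nat.cast_nonneg d
  set k : ℝ := 1 / (36 * ((d : ℝ) + 1) * N ^ 8) with hk
  have hk0 : 0 < k := by rw [hk]; positivity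
  obtain ⟨x, -, t, ht, hmax⟩ := exists_isMaxOn_slab hT.le
    (F := fun x t => bernsteinFun T h P u k (2 * (N + 1) / T) (N + 1) (x, t))
    (fun t ht x i => by
      have h1 := hS.periodic_mom ht x i
      have h2 := hS.periodic_u t ht x i
      have h3 := hS.periodic_P x i
      simp only [bernsteinFun, energy] at h1 h2 ⊢
      rw [h1, h2, h3])
    (fun w hw => by
      obtain ⟨S', hS', -⟩ := hS.exists_hasFDerivWithinAt_bernsteinFun (k := k)
        (c := 2 * (N + 1) / T) (c₀ := N + 1) hw
      exact hS'.continuousWithinAt)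
  have hMax : IsMaxOn (bernsteinFun T h P u k (2 * (N + 1) / T) (N + 1)) (slab d T) (x, t) :=
    fun w hw => hmax w.1 w.2 (mem_slab.1 hw)
  have hbound := hS.mom_le_of_max hB hk (mem_slab.2 ht) hMax
  have hR0 : 0 ≤ R := by rw [hR]; positivity
  rw [← hR] at hbound
  have hE : ∀ w ∈ slab d T, energy T h P u w ≤ N * R ^ 2 + 2 * N + 1 := by
    intro w hw
    have h1 : bernsteinFun _ _ _ _ _ _ _ w ≤ bernsteinFun _ _ _ _ _ _ _ (x, t) := hMax hw
    have h2 := energy_le hB (u := u) (x, t)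
    have h3 : N * ‖mom T u (x, t)‖ ^ 2 ≤ N * R ^ 2 := by gcongr
    have h4 := shifted_sq_le hS hB hk (mem_slab.2 ht : (x, t) ∈ slab d T)
    have h5 : 0 ≤ k * (u w.1 w.2 + (2 * (N + 1) / T * w.2 - (N + 1))) ^ 2 := by positivity
    rw [bernsteinFun, bernsteinFun] at h1
    linarith
  have hlow := fun w => le_energy hB (T := T) (u := u) w
  constructor
  · have h1 := hlow z
    have h2 := hE z hz
    have h3 : 1 / N * ‖mom T u z‖ ^ 2 ≤ N * R ^ 2 + 4 * N + 1 := by linarith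
    rwa [one_div, inv_mul_eq_div, div_le_iff₀ hN0, mul_comm] at h3
  -- At the end times `u_t`, the difference of the energy and `F(m)`, is bounded on both sides; the
  -- maximum principle is applied to `u_t` and to `-u_t`.
  · have hbd : ∀ w ∈ slab d T, -ω ≤ F (m w.1 w.2) → F (m w.1 w.2) ≤ N →
        1 * jet T u w (0, 1) ≤ N * R ^ 2 + 3 * N + 1 ∧
        -1 * jet T u w (0, 1) ≤ N * R ^ 2 + 3 * N + 1 := by
      intro w hw h1 h2
      have h3 := hS.hj_jet hw
      have h4 := hE w hw
      have h5 := hlow w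
      have h6 : 0 ≤ 1 / N * ‖mom T u w‖ ^ 2 := by positivity
      have h7 : 0 ≤ N * R ^ 2 := by positivity
      have h8 := hB.omega_le
      constructor <;> linarith
    have hb0 := fun x => hbd (x, 0) (mem_slab.2 ⟨le_rfl, hT.le⟩) (hB.initial_ge x) (hB.initial_le x)
    have hbT := fun x => hbd (x, T) (mem_slab.2 ⟨hT.le, le_rfl⟩) (hB.terminal_ge x)
      (hB.terminal_le x)
    have h1 := hS.time_deriv_le one_ne_zero (fun x => (hb0 x).1) (fun x => (hbT x).1) hz
    have h2 := hS.time_deriv_le (neg_ne_zero.2 one_ne_zero) (fun x => (hb0 x).2)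
      (fun x => (hbT x).2) hz
    rw [abs_le]
    constructor <;> linarith

end ReducedSystem

end Reduced

end MFG

namespace MFG

variable {d : ℕ}

/-! ### Couplings -/

lemma inv_eq_of_strictMonoOn {φ : ℝ → ℝ} (hφ : StrictMonoOn φ (Ioi 0)) {n w : ℝ} (hn : 0 < n)
    (hw : φ n = w) : inv φ w = n := by
  have hex : ∃ a ∈ Ioi (0 : ℝ), φ a = w := ⟨n, hn, hw⟩
  exact hφ.injOn (Function.invFunOn_mem hex) hn ((Function.invFunOn_eq hex).trans hw.symm)

namespace IsCoupling

variable {f : E d → ℝ → EReal}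

lemma coe_re (hf : IsCoupling f) {x : E d} {n : ℝ} (hn : 0 < n) : ((re f x n : ℝ) : EReal) = f x n :=
  EReal.coe_toReal (hf.ne_top x n hn.le)
    (ne_of_gt (lt_of_le_of_lt bot_le (hf.strictMono x self_mem_Ici hn.le hn)))

lemma strictMonoOn_re (hf : IsCoupling f) (x : E d) : StrictMonoOn (re f x) (Ioi 0) := by
  intro a ha b hb hab
  have := hf.strictMono x (Ioi_subset_Ici_self ha) (Ioi_subset_Ici_self hb) hab
  rw [← hf.coe_re ha, ← hf.coe_re hb] at this
  exact_mod_cast this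

lemma periodic_re (hf : IsCoupling f) (n : ℝ) : IsPeriodic fun x => re f x n := fun x i => by
  simp only [re, hf.periodic x i]

lemma isOpen_pos : IsOpen ((univ : Set (E d)) ×ˢ Ioi (0 : ℝ)) := isOpen_univ.prod isOpen_Ioi

lemma hasFDerivAt_re (hf : IsCoupling f) {x : E d} {n : ℝ} (hn : 0 < n) :
    HasFDerivAt (fun z : E d × ℝ => re f z.1 z.2)
      (fderiv ℝ (fun z : E d × ℝ => re f z.1 z.2) (x, n)) (x, n) :=
  ((hf.smooth.differentiableOn (by norm_num)).differentiableAt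
    (isOpen_pos.mem_nhds (show (x, n) ∈ univ ×ˢ Ioi 0 from ⟨mem_univ _, hn⟩))).hasFDerivAt

lemma hasFDerivAt_left (hf : IsCoupling f) {x : E d} {n : ℝ} (hn : 0 < n) :
    HasFDerivAt (fun y => re f y n)
      ((fderiv ℝ (fun z : E d × ℝ => re f z.1 z.2) (x, n)).comp
        (ContinuousLinearMap.inl ℝ (E d) ℝ)) x := by
  have := (hf.hasFDerivAt_re (x := x) hn).comp x (hasFDerivAt_prodMk_left (𝕜 := ℝ) x n)
  exact this

lemma hasDerivAt_right (hf : IsCoupling f) {x : E d} {n : ℝ} (hn : 0 < n) :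
    HasDerivAt (re f x) (fderiv ℝ (fun z : E d × ℝ => re f z.1 z.2) (x, n) (0, 1)) n := by
  have := (hf.hasFDerivAt_re (x := x) hn).comp_hasDerivAt n
    ((hasDerivAt_const n x).prodMk (hasDerivAt_id n))
  exact this

lemma derM_eq (hf : IsCoupling f) {x : E d} {n : ℝ} (hn : 0 < n) :
    derM f x n = fderiv ℝ (fun z : E d × ℝ => re f z.1 z.2) (x, n) (0, 1) :=
  (hf.hasDerivAt_right hn).deriv

lemma continuous_left (hf : IsCoupling f) {n : ℝ} (hn : 0 < n) : Continuous fun x => re f x n :=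
  continuous_iff_continuousAt.2 fun _ => (hf.hasFDerivAt_left hn).continuousAt

lemma gradX_eq (hf : IsCoupling f) {x : E d} {n : ℝ} (hn : 0 < n) :
    gradX (re f) x n = spaceGrad d (fderiv ℝ (fun z : E d × ℝ => re f z.1 z.2) (x, n)) := by
  refine ext_inner_right ℝ fun v => ?_
  rw [gradX, inner_gradient, (hf.hasFDerivAt_left hn).fderiv, inner_spaceGrad]
  rfl

lemma contDiffOn_gradX (hf : IsCoupling f) :
    ContDiffOn ℝ 3 (fun z : E d × ℝ => gradX (re f) z.1 z.2) (univ ×ˢ Ioi 0) := by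
  have h1 : ContDiffOn ℝ 3 (fderiv ℝ fun z : E d × ℝ => re f z.1 z.2) (univ ×ˢ Ioi 0) :=
    hf.smooth.fderiv_of_isOpen isOpen_pos (by norm_num)
  exact ((spaceGrad d).contDiff.comp_contDiffOn h1).congr fun z hz => hf.gradX_eq hz.2

lemma periodic_gradX (hf : IsCoupling f) (n : ℝ) : IsPeriodic fun x => gradX (re f) x n :=
  (hf.periodic_re n).gradX

lemma contDiffOn_right (hf : IsCoupling f) (x : E d) : ContDiffOn ℝ 4 (re f x) (Ioi 0) :=
  hf.smooth.comp (contDiff_prodMk_right x).contDiffOn fun _ hn => ⟨mem_univ _, hn⟩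

lemma exists_minX (hf : IsCoupling f) {n : ℝ} (hn : 0 < n) :
    ∃ x, minX f n = re f x n ∧ ∀ y, minX f n ≤ re f y n := by
  obtain ⟨x, -, hx⟩ := (hf.periodic_re n).exists_forall_ge (hf.continuous_left hn)
  have hb : BddBelow (range fun x => re f x n) := ⟨_, by rintro _ ⟨y, rfl⟩; exact hx y⟩
  exact ⟨x, le_antisymm (ciInf_le hb x) (le_ciInf hx), fun y => ciInf_le hb y⟩

lemma exists_maxX (hf : IsCoupling f) {n : ℝ} (hn : 0 < n) :
    ∃ x, maxX f n = re f x n ∧ ∀ y, re f y n ≤ maxX f n := by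
  obtain ⟨x, -, hx⟩ := (hf.periodic_re n).exists_forall_le (hf.continuous_left hn)
  have hb : BddAbove (range fun x => re f x n) := ⟨_, by rintro _ ⟨y, rfl⟩; exact hx y⟩
  exact ⟨x, le_antisymm (ciSup_le hx) (le_ciSup hb x), fun y => le_ciSup hb y⟩

lemma strictMonoOn_minX (hf : IsCoupling f) : StrictMonoOn (minX f) (Ioi 0) := by
  intro a ha b hb hab
  obtain ⟨x, hx, -⟩ := hf.exists_minX hb
  obtain ⟨-, -, h⟩ := hf.exists_minX ha
  rw [hx]
  exact (h x).trans_lt (hf.strictMonoOn_re x ha hb hab)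

lemma strictMonoOn_maxX (hf : IsCoupling f) : StrictMonoOn (maxX f) (Ioi 0) := by
  intro a ha b hb hab
  obtain ⟨x, hx, -⟩ := hf.exists_maxX ha
  obtain ⟨-, -, h⟩ := hf.exists_maxX hb
  rw [hx]
  exact (hf.strictMonoOn_re x ha hb hab).trans_le (h x)

lemma continuousOn_maxX (hf : IsCoupling f) : ContinuousOn (maxX f) (Ioi 0) := by
  have h1 : Continuous (↿fun (n : Ioi (0 : ℝ)) (x : E d) => re f x n) := by
    have := hf.smooth.continuousOn
    rw [continuousOn_iff_continuous_domRestrict] at this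
    have h2 : Continuous fun q : Ioi (0 : ℝ) × E d =>
        (⟨(q.2, q.1.1), ⟨mem_univ _, q.1.2⟩⟩ : ((univ : Set (E d)) ×ˢ Ioi (0 : ℝ) : Set _)) := by
      fun_prop
    exact this.comp h2
  have h2 := isCompact_unitCube.continuous_sSup h1
  rw [continuousOn_iff_continuous_domRestrict]
  refine h2.congr fun n => ?_
  obtain ⟨x, hx, hle⟩ := hf.exists_maxX n.2
  rw [domRestrict_apply]
  refine IsGreatest.csSup_eq ⟨⟨toCube x, toCube_mem x, ?_⟩, ?_⟩
  · rw [hx]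
    exact (hf.periodic_re n).apply_toCube x
  · rintro _ ⟨y, -, rfl⟩
    exact hle y

lemma continuousOn_minX (hf : IsCoupling f) : ContinuousOn (minX f) (Ioi 0) := by
  have h1 : Continuous (↿fun (n : Ioi (0 : ℝ)) (x : E d) => re f x n) := by
    have := hf.smooth.continuousOn
    rw [continuousOn_iff_continuous_domRestrict] at this
    have h2 : Continuous fun q : Ioi (0 : ℝ) × E d =>
        (⟨(q.2, q.1.1), ⟨mem_univ _, q.1.2⟩⟩ : ((univ : Set (E d)) ×ˢ Ioi (0 : ℝ) : Set _)) := by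
      fun_prop
    exact this.comp h2
  have h2 := isCompact_unitCube.continuous_sInf h1
  rw [continuousOn_iff_continuous_domRestrict]
  refine h2.congr fun n => ?_
  obtain ⟨x, hx, hle⟩ := hf.exists_minX n.2
  rw [domRestrict_apply]
  refine IsLeast.csInf_eq ⟨⟨toCube x, toCube_mem x, ?_⟩, ?_⟩
  · rw [hx]
    exact (hf.periodic_re n).apply_toCube x
  · rintro _ ⟨y, -, rfl⟩
    exact hle y

/-- Continuity at `m = 0` in the extended reals, which covers the value `-∞`, yields one positive
density for all nearby points. -/
lemma exists_eventually_lt (hf : IsCoupling f) {x : E d} {K : EReal} (hK : f x 0 < K) :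
    ∃ n > 0, ∀ᶠ y in 𝓝 x, f y n < K := by
  have h1 := (hf.continuous (x, 0) ⟨mem_univ _, self_mem_Ici⟩).eventually (eventually_lt_nhds hK)
  rw [nhdsWithin_prod_eq, nhdsWithin_univ] at h1
  obtain ⟨pa, ha, pb, hb, hab⟩ := eventually_prod_iff.1 h1
  have hb' : ∀ᶠ n in 𝓝[>] (0 : ℝ), pb n := hb.filter_mono (nhdsWithin_mono _ Ioi_subset_Ici_self)
  obtain ⟨n, hn, hn0⟩ := (hb'.and self_mem_nhdsWithin).exists
  exact ⟨n, hn0, ha.mono fun y hy => hab hy hn⟩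

end IsCoupling

/-- A local property that is directed in the parameter holds uniformly on the torus. -/
lemma exists_forall_of_locally {p : E d → ℝ → Prop} (hper : ∀ n, IsPeriodic fun x => p x n)
    (hdir : ∀ n₁ > 0, ∀ n₂ > 0, ∃ n > 0, ∀ y, (p y n₁ ∨ p y n₂) → p y n)
    (hloc : ∀ x, ∃ n > 0, ∀ᶠ y in 𝓝 x, p y n) : ∃ n > 0, ∀ x, p x n := by
  have h := isCompact_unitCube.induction_on (s := unitCube d)
    (p := fun S => ∃ n > 0, ∀ y ∈ S, p y n) ⟨1, one_pos, fun _ h => h.elim⟩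
    (fun S S' hS ⟨n, hn, h⟩ => ⟨n, hn, fun y hy => h y (hS hy)⟩)
    (fun S S' ⟨n₁, hn₁, h₁⟩ ⟨n₂, hn₂, h₂⟩ => by
      obtain ⟨n, hn, h⟩ := hdir n₁ hn₁ n₂ hn₂
      exact ⟨n, hn, fun y hy => h y (hy.imp (h₁ y) (h₂ y))⟩)
    (fun x _ => by
      obtain ⟨n, hn, h⟩ := hloc x
      exact ⟨_, mem_nhdsWithin_of_mem_nhds h, n, hn, fun y hy => hy⟩)
  obtain ⟨n, hn, h⟩ := h
  exact ⟨n, hn, fun x => (hper n).apply_toCube x ▸ h _ (toCube_mem x)⟩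

namespace AssumptionG

variable {g : E d → ℝ → EReal}

/-- Strict monotonicity puts `g₁(a)` strictly below `sup g`, the limit of every `g(x,·)`.
Compactness makes the crossing uniform in `x`, and the intermediate value theorem applies to `g₀`.
-/
lemma exists_minX_eq (hg : AssumptionG g) {a : ℝ} (ha : 0 < a) :
    ∃ n, 0 < n ∧ minX g n = maxX g a := by
  have hc := hg.coupling
  obtain ⟨x₀, hx₀, hle⟩ := hc.exists_maxX ha
  have hsup : ((maxX g a : ℝ) : EReal) < ⨆ y, ⨆ m ∈ Ici (0 : ℝ), g y m := by
    rw [hx₀, hc.coe_re ha]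
    refine lt_of_lt_of_le (hc.strictMono x₀ (b := a + 1) ha.le (by simp; linarith) (by linarith)) ?_
    exact le_iSup_of_le x₀ (le_iSup₂_of_le (a + 1) (by simp; linarith) le_rfl)
  obtain ⟨n, hn, h⟩ := exists_forall_of_locally (p := fun x n => maxX g a < re g x n)
    (fun n x i => by have := hc.periodic_re n x i; simp only at this ⊢; rw [this])
    (fun n₁ h₁ n₂ h₂ => ⟨max n₁ n₂, lt_max_of_lt_left h₁, fun y hy => by
      have hm := (hc.strictMonoOn_re y).monotoneOn
      rcases hy with hy | hy
      · exact hy.trans_le (hm h₁ (lt_max_of_lt_left h₁) (le_max_left _ _))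
      · exact hy.trans_le (hm h₂ (lt_max_of_lt_left h₁) (le_max_right _ _))⟩)
    (fun x => by
      obtain ⟨n, hn, hn0⟩ := (((hg.tendsto_sup x).eventually (eventually_gt_nhds hsup)).and
        (eventually_gt_atTop 0)).exists
      refine ⟨n, hn0, (hc.continuous_left hn0).continuousAt.eventually (eventually_gt_nhds ?_)⟩
      rw [← hc.coe_re hn0] at hn
      exact_mod_cast hn)
  have han : a ≤ n := by
    by_contra! hlt
    have := (hc.strictMonoOn_re x₀ hn ha hlt)
    have := h x₀
    linarith
  obtain ⟨y, hy, hyn⟩ := hc.exists_minX hn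
  obtain ⟨k, hk, hkeq⟩ := intermediate_value_Icc han
    (hc.continuousOn_minX.mono fun k hk => lt_of_lt_of_le ha hk.1)
    (show maxX g a ∈ Icc (minX g a) (minX g n) from
      ⟨by obtain ⟨-, -, h'⟩ := hc.exists_minX ha; rw [hx₀]; exact h' x₀, by rw [hy]; exact (h y).le⟩)
  exact ⟨k, lt_of_lt_of_le ha hk.1, hkeq⟩

/-- The mirror argument: `g(·,0) = inf g` lies strictly below `g₀(b)`, uniformly for small
densities. -/
lemma exists_maxX_eq (hg : AssumptionG g) {b : ℝ} (hb : 0 < b) :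
    ∃ n, 0 < n ∧ maxX g n = minX g b := by
  have hc := hg.coupling
  obtain ⟨x₀, hx₀, hle⟩ := hc.exists_minX hb
  have hinf : ∀ x, g x 0 < ((minX g b : ℝ) : EReal) := by
    intro x
    rw [hx₀, hc.coe_re hb, hg.zero_eq_inf x, ← hg.zero_eq_inf x₀]
    exact hc.strictMono x₀ self_mem_Ici hb.le hb
  obtain ⟨n, hn, h⟩ := exists_forall_of_locally
    (p := fun x n => g x n < ((minX g b : ℝ) : EReal))
    (fun n x i => by simp only [hc.periodic x i])
    (fun n₁ h₁ n₂ h₂ => ⟨min n₁ n₂, lt_min h₁ h₂, fun y hy => by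
      have hm := (hc.strictMono y).monotoneOn
      rcases hy with hy | hy
      · exact (hm (lt_min h₁ h₂).le (le_of_lt h₁) (min_le_left _ _)).trans_lt hy
      · exact (hm (lt_min h₁ h₂).le (le_of_lt h₂) (min_le_right _ _)).trans_lt hy⟩)
    (fun x => hc.exists_eventually_lt (hinf x))
  have h' : ∀ x, re g x n < minX g b := fun x => by
    have := h x
    rw [← hc.coe_re hn] at this
    exact_mod_cast this
  have han : n ≤ b := by
    by_contra! hlt
    have := (hc.strictMonoOn_re x₀ hb hn hlt)
    have := h' x₀
    linarith
  obtain ⟨y, hy, hyn⟩ := hc.exists_maxX hn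
  obtain ⟨k, hk, hkeq⟩ := intermediate_value_Icc han
    (hc.continuousOn_maxX.mono fun k hk => lt_of_lt_of_le hn hk.1)
    (show minX g b ∈ Icc (maxX g n) (maxX g b) from
      ⟨by rw [hy]; exact (h' y).le, by obtain ⟨-, -, h'⟩ := hc.exists_maxX hb; rw [hx₀]; exact h' x₀⟩)
  exact ⟨k, lt_of_lt_of_le hn hk.1, hkeq⟩

end AssumptionG

/-! ### Separation of variables -/

section Separation

variable {C₀ τ : ℝ} {H : E d → E d → ℝ} {f : E d → ℝ → EReal}

/-- `D_x f` does not depend on `m`, so the difference of two slices `f(·,n) - f(·,k)` is constant in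
`x`. -/
lemma re_eq_add (hf : IsCoupling f) (hsep : ∀ x, ∀ n, 0 < n → derXM f x n = 0) (x : E d)
    {n : ℝ} (hn : 0 < n) (k : ℝ) (hk : 0 < k) : re f x n = re f 0 n + (re f x k - re f 0 k) := by
  have hgrad : ∀ y, gradX (re f) y n = gradX (re f) y k := by
    intro y
    have hdiff : DifferentiableOn ℝ (fun n => gradX (re f) y n) (Ioi 0) :=
      (hf.contDiffOn_gradX.comp (contDiff_prodMk_right y).contDiffOn
        (fun _ hn => ⟨mem_univ _, hn⟩)).differentiableOn (by norm_num)
    exact isOpen_Ioi.is_const_of_deriv_eq_zero isPreconnected_Ioi hdiff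
      (fun j hj => hsep y j hj) hn hk
  have hzero : ∀ y, fderiv ℝ (fun y => re f y n - re f y k) y = 0 := by
    intro y
    rw [fderiv_fun_sub (hf.hasFDerivAt_left hn).differentiableAt
      (hf.hasFDerivAt_left hk).differentiableAt, sub_eq_zero]
    ext v
    rw [← inner_gradient, ← inner_gradient]
    exact congrArg (fun q => inner ℝ q v) (hgrad y)
  have := is_const_of_fderiv_eq_zero (𝕜 := ℝ) (f := fun y => re f y n - re f y k) (fun y =>
    ((hf.hasFDerivAt_left hn).sub (hf.hasFDerivAt_left hk)).differentiableAt) hzero x 0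
  linarith

lemma hamiltonian_eq_add (hH : AssumptionH C₀ τ H) (hsep : ∀ x p, derXP H x p = 0) (x p : E d) :
    H x p = H 0 p + (H x 0 - H 0 0) := by
  have hgrad : ∀ p, gradP H x p = gradP H 0 p := by
    intro p
    refine is_const_of_fderiv_eq_zero (𝕜 := ℝ) (f := fun y => gradP H y p) ?_
      (fun y => hsep y p) x 0
    exact (hH.smooth_gradP.comp (contDiff_prodMk_left p)).differentiable (by norm_num)
  have hd : ∀ x, Differentiable ℝ (H x) := fun x =>
    (hH.smooth.comp (contDiff_prodMk_right x)).differentiable (by norm_num)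
  have hzero : ∀ p, fderiv ℝ (fun p => H x p - H 0 p) p = 0 := by
    intro p
    rw [fderiv_fun_sub (hd x p) (hd 0 p), sub_eq_zero]
    ext v
    rw [← inner_gradient, ← inner_gradient]
    exact congrArg (fun q => inner ℝ q v) (hgrad p)
  have := is_const_of_fderiv_eq_zero (𝕜 := ℝ) (f := fun p => H x p - H 0 p)
    ((hd x).sub (hd 0)) hzero p 0
  linarith

/-- The coupling at the origin diverges to `∞`. -/
lemma AssumptionF.exists_lt_re (hf : AssumptionF C₀ τ f) (K : ℝ) : ∃ n, 0 < n ∧ K < re f 0 n := by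
  obtain ⟨c, hc, hev⟩ := hf.growth
  obtain ⟨M, hM⟩ := eventually_atTop.1 hev
  set M' := max M 1 with hM'
  have hM0 : 0 < M' := lt_of_lt_of_le one_pos (le_max_right _ _)
  have hdiff : ∀ n, 0 < n → HasDerivAt (fun n => re f 0 n - c * Real.log n)
      (derM f 0 n - c * n⁻¹) n := by
    intro n hn
    have h1 := hf.coupling.hasDerivAt_right (x := 0) hn
    rw [← hf.coupling.derM_eq hn] at h1
    exact h1.sub ((Real.hasDerivAt_log hn.ne').const_mul c)
  have hmono : MonotoneOn (fun n => re f 0 n - c * Real.log n) (Ici M') := by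
    refine monotoneOn_of_deriv_nonneg (convex_Ici _)
      (fun n hn => (hdiff n (hM0.trans_le hn)).continuousAt.continuousWithinAt)
      (fun n hn => (hdiff n (hM0.trans_le (interior_subset hn))).differentiableAt.differentiableWithinAt)
      fun n hn => ?_
    have hn' : M' ≤ n := interior_subset hn
    have hn0 := hM0.trans_le hn'
    rw [(hdiff n hn0).deriv, sub_nonneg, ← div_eq_mul_inv, div_le_iff₀ hn0, mul_comm]
    exact hM n ((le_max_left _ _).trans hn') 0
  have hlog : Tendsto (fun n => (re f 0 M' - c * Real.log M') + c * Real.log n) atTop atTop :=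
    tendsto_atTop_add_const_left _ _ (Real.tendsto_log_atTop.const_mul_atTop hc)
  obtain ⟨n, hn, hnM⟩ := ((hlog.eventually_gt_atTop K).and (eventually_ge_atTop M')).exists
  have := hmono self_mem_Ici hnM hnM
  simp only at this
  exact ⟨n, hM0.trans_le hnM, by linarith⟩

/-- The coupling at the origin attains every real value. -/
lemma AssumptionF.exists_re_eq (hf : AssumptionF C₀ τ f) (hse : StrictlyElliptic f) (K : ℝ) :
    ∃ n, 0 < n ∧ re f 0 n = K := by
  obtain ⟨b, hb, hbK⟩ := hf.exists_lt_re K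
  obtain ⟨a, ha, haK⟩ := hf.coupling.exists_eventually_lt (x := 0) (K := (K : EReal))
    (by rw [hse]; exact EReal.bot_lt_coe K)
  have haK' := haK.self_of_nhds
  rw [← hf.coupling.coe_re ha] at haK'
  have haK2 : re f 0 a < K := by exact_mod_cast haK'
  have hab : a ≤ b := by
    by_contra! hlt
    have := hf.coupling.strictMonoOn_re 0 hb ha hlt
    linarith
  obtain ⟨n, hn, h⟩ := intermediate_value_Icc hab
    ((hf.coupling.contDiffOn_right 0).continuousOn.mono fun k hk => lt_of_lt_of_le ha hk.1)
    (show K ∈ Icc (re f 0 a) (re f 0 b) from ⟨haK2.le, hbK.le⟩)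
  exact ⟨n, lt_of_lt_of_le ha hn.1, h⟩

end Separation

end MFG

namespace MFG

variable {d : ℕ}

/-! ### Reduction to a separated potential -/

lemma gradient_eq_spaceGrad (φ : E d → ℝ) (x : E d) :
    gradient φ x = spaceGrad d ((fderiv ℝ φ x).comp (ContinuousLinearMap.fst ℝ (E d) ℝ)) := by
  refine ext_inner_right ℝ fun v => ?_
  rw [inner_gradient, inner_spaceGrad]
  rfl

lemma inner_fderiv_gradient {φ : E d → ℝ} (hφ : ContDiff ℝ 2 φ) (x v w : E d) :
    inner ℝ (fderiv ℝ (gradient φ) x v) w = fderiv ℝ (fderiv ℝ φ) x v w := by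
  have h2 : HasFDerivAt (fderiv ℝ φ) (fderiv ℝ (fderiv ℝ φ) x) x :=
    ((hφ.fderiv_right (m := 1) (by norm_num)).differentiable (by norm_num) x).hasFDerivAt
  have hd : DifferentiableAt ℝ (gradient φ) x := by
    rw [funext (gradient_eq_spaceGrad φ)]
    exact (spaceGrad d).differentiableAt.comp x (h2.differentiableAt.clm_comp
      (differentiableAt_const _))
  have e1 := hd.hasFDerivAt.inner ℝ (hasFDerivAt_const w x)
  have e2 := h2.clm_apply (hasFDerivAt_const w x)
  have e3 : (fun q => inner ℝ (gradient φ q) w) = fun q => fderiv ℝ φ q w :=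
    funext fun q => inner_gradient w
  rw [e3] at e1
  have := congrArg (fun L => L v) (e1.unique e2)
  simpa [fderivInnerCLM_apply] using this

section Reduction

variable {C₀ τ T : ℝ} {H : E d → E d → ℝ} {f g : E d → ℝ → EReal} {m₀ : E d → ℝ}
  {u m : E d → ℝ → ℝ}

/-- Both sides are continuous in `t` with values in the extended reals, so equality passes to the
closed interval before positivity of `m` is known. -/
lemma IsSolution.hamiltonJacobi_closed (hT : 0 < T) (hH : AssumptionH C₀ τ H) (hf : IsCoupling f)
    (hs : IsSolution T H f g m₀ u m) (x : E d) {t : ℝ} (ht : t ∈ Icc 0 T) :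
    ((-derT T u x t + H x (gradX u x t) : ℝ) : EReal) = f x (m x t) := by
  have hsec : ContinuousOn (fun t : ℝ => (x, t)) (Icc 0 T) := by fun_prop
  have hmaps : MapsTo (fun t : ℝ => (x, t)) (Icc 0 T) (slab d T) := fun t ht => mem_slab.2 ht
  have hjet : ContinuousOn (fun t => jet T u (x, t)) (Icc 0 T) :=
    (contDiffOn_jet (k := 2) hT hs.smooth_u (by norm_num)).continuousOn.comp hsec hmaps
  have hgrad : ContinuousOn (fun t => gradX u x t) (Icc 0 T) :=
    ((spaceGrad d).continuous.comp_continuousOn hjet).congr fun t ht =>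
      gradX_eq_spaceGrad (by norm_num) hs.smooth_u x ht
  have hder : ContinuousOn (fun t => derT T u x t) (Icc 0 T) :=
    (hjet.clm_apply continuousOn_const).congr fun t ht =>
      derT_eq_jet (by norm_num) hs.smooth_u hT x ht
  have hHc : Continuous (H x) := hH.smooth.continuous.comp (Continuous.prodMk_right x)
  have hl : ContinuousOn (fun t => ((-derT T u x t + H x (gradX u x t) : ℝ) : EReal)) (Icc 0 T) :=
    continuous_coe_real_ereal.comp_continuousOn (hder.neg.add (hHc.comp_continuousOn hgrad))
  have hmc : ContinuousOn (fun t => (x, m x t)) (Icc 0 T) :=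
    continuousOn_const.prodMk (hs.smooth_m.continuousOn.comp hsec hmaps)
  have hr : ContinuousOn (fun t => f x (m x t)) (Icc 0 T) :=
    hf.continuous.comp hmc fun t ht => ⟨mem_univ _, hs.nonneg x t ht⟩
  have heq : EqOn (fun t => ((-derT T u x t + H x (gradX u x t) : ℝ) : EReal))
      (fun t => f x (m x t)) (Ioo 0 T) := fun t ht => hs.hamiltonJacobi x t ht
  exact heq.of_subset_closure hl hr Ioo_subset_Icc_self (by rw [closure_Ioo hT.ne]) ht

/-- At a zero of `m` the right side of the equation would be `-∞`, while the left side is a real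
number. -/
lemma IsSolution.pos (hT : 0 < T) (hH : AssumptionH C₀ τ H) (hf : IsCoupling f)
    (hse : StrictlyElliptic f) (hs : IsSolution T H f g m₀ u m) (x : E d) {t : ℝ}
    (ht : t ∈ Icc 0 T) : 0 < m x t := by
  refine lt_of_le_of_ne (hs.nonneg x t ht) fun h => ?_
  have := hs.hamiltonJacobi_closed hT hH hf x ht
  rw [← h, hse x] at this
  exact EReal.coe_ne_bot _ this

/-- The potential of the reduced system. -/
def potential (H : E d → E d → ℝ) (f : E d → ℝ → EReal) (n : ℝ) (x : E d) : ℝ :=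
  (re f x n - re f 0 n) - (H x 0 - H 0 0)

lemma contDiff_left (hf : IsCoupling f) {n : ℝ} (hn : 0 < n) : ContDiff ℝ 4 fun x => re f x n :=
  contDiffOn_univ.1 (hf.smooth.comp (contDiff_prodMk_left n).contDiffOn fun _ _ => ⟨mem_univ _, hn⟩)

lemma AssumptionH.contDiff_left (hH : AssumptionH C₀ τ H) (p : E d) :
    ContDiff ℝ 4 fun x => H x p := hH.smooth.comp (contDiff_prodMk_left p)

lemma AssumptionH.contDiff_right (hH : AssumptionH C₀ τ H) (x : E d) : ContDiff ℝ 4 (H x) :=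
  hH.smooth.comp (contDiff_prodMk_right x)

lemma AssumptionH.inner_hessP_symm (hH : AssumptionH C₀ τ H) (x p v w : E d) :
    inner ℝ (hessP H x p v) w = inner ℝ v (hessP H x p w) := by
  have hc := (hH.contDiff_right x).of_le (m := 2) (by norm_num)
  have key : ∀ v w, inner ℝ (hessP H x p v) w = fderiv ℝ (fderiv ℝ (H x)) p v w :=
    inner_fderiv_gradient hc p
  rw [key, real_inner_comm, key]
  exact hc.contDiffAt.isSymmSndFDerivAt (by simp) v w

/-- Separation moves the whole dependence on `x` into the potential. Every reference density `n`
gives the same potential; the choice matters only for estimating it. -/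
lemma IsSolution.reducedSystem (hT : 0 < T) (hC : 0 < C₀) (hH : AssumptionH C₀ τ H)
    (hf : AssumptionF C₀ τ f) (hse : StrictlyElliptic f) (hsep : SeparatedPotential H f)
    (hs : IsSolution T H f g m₀ u m) {n : ℝ} (hn : 0 < n) :
    ReducedSystem T (H 0) (potential H f n) (re f 0) u m where
  T_pos := hT
  smooth_h := (hH.contDiff_right 0).differentiable (by norm_num)
  smooth_grad := (hH.smooth_gradP.comp (contDiff_prodMk_right 0)).of_le (by norm_num)
  hess_symm := hH.inner_hessP_symm 0
  hess_nonneg := fun p v => le_trans (by positivity) (hH.convex 0 p v).1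
  smooth_P := (((contDiff_left hf.coupling hn).sub contDiff_const).sub
    ((hH.contDiff_left 0).sub contDiff_const)).of_le (by norm_num)
  periodic_P := fun x i => by
    have h1 := hf.coupling.periodic_re n x i
    have h2 := hH.periodic x i
    simp only at h1
    rw [potential, potential, h1, h2]
  smooth_F := (hf.coupling.contDiffOn_right 0).of_le (by norm_num)
  deriv_F_pos := hf.coupling.derM_pos 0
  smooth_u := hs.smooth_u
  smooth_m := hs.smooth_m
  periodic_u := hs.periodic_u
  pos := fun x t ht => hs.pos hT hH hf.coupling hse x ht
  hamiltonJacobi := fun x t ht => by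
    have hpos := hs.pos hT hH hf.coupling hse x ht
    have h1 := hs.hamiltonJacobi_closed hT hH hf.coupling x ht
    rw [← hf.coupling.coe_re hpos, EReal.coe_eq_coe_iff, hamiltonian_eq_add hH hsep.derXP_eq,
      re_eq_add hf.coupling hsep.derXM_eq x hpos n hn] at h1
    rw [potential]
    linarith
  transport := fun x t ht => by
    have h1 := hs.transport x t ht
    have h2 : ∀ y p, gradP H y p = gradient (H 0) p := by
      intro y p
      refine is_const_of_fderiv_eq_zero (𝕜 := ℝ) (f := fun y => gradP H y p) ?_
        (fun y => hsep.derXP_eq y p) y 0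
      exact (hH.smooth_gradP.comp (contDiff_prodMk_left p)).differentiable (by norm_num)
    simpa only [h2] using h1

end Reduction

end MFG

namespace MFG

variable {d : ℕ}

/-! ### Bounds on the data -/

lemma norm_le_of_supNorm_le {X V : Type*} [NormedAddCommGroup V] {F : X → V} {S : Set X} {C : ℝ}
    (hC : 0 ≤ C) (h : supNorm F S ≤ ENNReal.ofReal C) {z : X} (hz : z ∈ S) : ‖F z‖ ≤ C := by
  have h1 : ‖F z‖ₑ ≤ ENNReal.ofReal C := (le_iSup₂ (f := fun z _ => ‖F z‖ₑ) z hz).trans h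
  rwa [← ofReal_norm, ENNReal.ofReal_le_ofReal_iff hC] at h1

lemma supNorm_le_ofReal {X V : Type*} [NormedAddCommGroup V] {F : X → V} {S : Set X} {C : ℝ}
    (h : ∀ z ∈ S, ‖F z‖ ≤ C) : supNorm F S ≤ ENNReal.ofReal C :=
  iSup₂_le fun z hz => by
    rw [← ofReal_norm]
    exact ENNReal.ofReal_le_ofReal (h z hz)

lemma supNorm_iteratedFDeriv_le {X V : Type*} [NormedAddCommGroup X] [NormedSpace ℝ X]
    [NormedAddCommGroup V] [NormedSpace ℝ V] {F : X → V} {S : Set X} {j k : ℕ} (hj : j ≤ k) :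
    supNorm (iteratedFDeriv ℝ j F) S ≤ ckNorm k F S :=
  Finset.single_le_sum (f := fun j => supNorm (iteratedFDeriv ℝ j F) S) (fun _ _ => zero_le)
    (Finset.mem_range.2 (Nat.lt_succ_of_le hj))

lemma norm_le_of_ckNorm_le {X V : Type*} [NormedAddCommGroup X] [NormedSpace ℝ X]
    [NormedAddCommGroup V] [NormedSpace ℝ V] {F : X → V} {S : Set X} {k : ℕ} {C : ℝ} (hC : 0 ≤ C)
    (h : ckNorm k F S ≤ ENNReal.ofReal C) {z : X} (hz : z ∈ S) : ‖F z‖ ≤ C := by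
  rw [← norm_iteratedFDeriv_zero (𝕜 := ℝ) (f := F)]
  exact norm_le_of_supNorm_le hC ((supNorm_iteratedFDeriv_le k.zero_le).trans h) hz

lemma norm_fderiv_le_of_ckNorm_le {X V : Type*} [NormedAddCommGroup X] [NormedSpace ℝ X]
    [NormedAddCommGroup V] [NormedSpace ℝ V] {F : X → V} {S : Set X} {k : ℕ} {C : ℝ} (hC : 0 ≤ C)
    (hk : 1 ≤ k) (h : ckNorm k F S ≤ ENNReal.ofReal C) {z : X} (hz : z ∈ S) :
    ‖fderiv ℝ F z‖ ≤ C := by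
  rw [← norm_iteratedFDeriv_one]
  exact norm_le_of_supNorm_le hC ((supNorm_iteratedFDeriv_le hk).trans h) hz

lemma abs_fderiv_fderiv_le_of_ckNorm_le {X : Type*} [NormedAddCommGroup X] [NormedSpace ℝ X]
    {F : X → ℝ} {S : Set X} {k : ℕ} {C : ℝ} (hC : 0 ≤ C)
    (hk : 2 ≤ k) (h : ckNorm k F S ≤ ENNReal.ofReal C) {z : X} (hz : z ∈ S) (v : X) :
    |fderiv ℝ (fderiv ℝ F) z v v| ≤ C * ‖v‖ ^ 2 := by
  have h1 := norm_le_of_supNorm_le hC ((supNorm_iteratedFDeriv_le hk).trans h) hz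
  have h2 := (iteratedFDeriv ℝ 2 F z).le_opNorm fun _ => v
  rw [iteratedFDeriv_two_apply, Real.norm_eq_abs] at h2
  refine h2.trans ?_
  simp only [Finset.prod_const, Finset.card_univ, Fintype.card_fin]
  gcongr

lemma norm_fst_zero_le (v : E d) : ‖((v, 0) : E d × ℝ)‖ ≤ ‖v‖ := by simp

section Data

variable {C₀ τ T : ℝ} {H : E d → E d → ℝ} {f g : E d → ℝ → EReal} {m₀ : E d → ℝ}
  {u m : E d → ℝ → ℝ}

lemma AssumptionM.mem_range (hm : AssumptionM m₀) (x : E d) :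
    m₀ x ∈ Icc (⨅ x, m₀ x) (⨆ x, m₀ x) := by
  obtain ⟨a, -, ha⟩ := hm.periodic.exists_forall_le hm.smooth.continuous
  obtain ⟨b, -, hb⟩ := hm.periodic.exists_forall_ge hm.smooth.continuous
  exact ⟨ciInf_le ⟨m₀ b, by rintro _ ⟨y, rfl⟩; exact hb y⟩ x,
    le_ciSup (f := m₀) ⟨m₀ a, by rintro _ ⟨y, rfl⟩; exact ha y⟩ x⟩

namespace Normalised

lemma ckNorm_density (hN : Normalised C₀ τ H f m₀) : ckNorm 1 m₀ univ ≤ ENNReal.ofReal C₀ :=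
  (le_add_self.trans le_self_add).trans hN.bound_data

lemma ckNorm_coupling (hN : Normalised C₀ τ H f m₀) :
    ckNorm 2 (fun z : E d × ℝ => re f z.1 z.2) (univ ×ˢ Icc (⨅ x, m₀ x) (⨆ x, m₀ x))
      ≤ ENNReal.ofReal C₀ := le_add_self.trans hN.bound_data

lemma abs_re_le (hN : Normalised C₀ τ H f m₀) (hC : 0 < C₀) (hm : AssumptionM m₀) (x y : E d) :
    |re f x (m₀ y)| ≤ C₀ :=
  norm_le_of_ckNorm_le hC.le hN.ckNorm_coupling (z := (x, m₀ y)) ⟨mem_univ _, hm.mem_range y⟩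

lemma norm_fderiv_re_le (hN : Normalised C₀ τ H f m₀) (hC : 0 < C₀) (hm : AssumptionM m₀)
    (x y : E d) : ‖fderiv ℝ (fun z : E d × ℝ => re f z.1 z.2) (x, m₀ y)‖ ≤ C₀ :=
  norm_fderiv_le_of_ckNorm_le hC.le one_le_two hN.ckNorm_coupling ⟨mem_univ _, hm.mem_range y⟩

lemma abs_hamiltonian_zero_le (hN : Normalised C₀ τ H f m₀) (x : E d) : |H x 0| ≤ C₀ := by
  have h1 := hN.lower x 0
  have h2 := hN.upper x 0
  simp at h1 h2
  exact abs_le.2 ⟨h1, h2⟩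

lemma zero_rpow (hτ : 0 ≤ τ) : ‖(0 : E d)‖ ^ (1 + τ) = 0 := by
  rw [norm_zero, Real.zero_rpow (by linarith)]

lemma abs_potential_le (hN : Normalised C₀ τ H f m₀) (hC : 0 < C₀) (hm : AssumptionM m₀)
    (x y : E d) : |potential H f (m₀ y) x| ≤ 4 * C₀ := by
  have h1 := abs_le.1 (hN.abs_re_le hC hm x y)
  have h2 := abs_le.1 (hN.abs_re_le hC hm 0 y)
  have h3 := abs_le.1 (hN.abs_hamiltonian_zero_le x)
  have h4 := abs_le.1 (hN.abs_hamiltonian_zero_le 0)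
  rw [potential, abs_le]
  constructor <;> linarith [h1.1, h1.2, h2.1, h2.2, h3.1, h3.2, h4.1, h4.2]

lemma fderiv_potential (hH : AssumptionH C₀ τ H) (hf : IsCoupling f) {n : ℝ} (hn : 0 < n)
    (x : E d) : fderiv ℝ (potential H f n) x = (fderiv ℝ (fun z : E d × ℝ => re f z.1 z.2)
      (x, n)).comp (ContinuousLinearMap.inl ℝ (E d) ℝ) - fderiv ℝ (fun y => H y 0) x :=
  (((hf.hasFDerivAt_left hn).sub_const _).sub (((hH.contDiff_left 0).differentiable
    (by norm_num) x).hasFDerivAt.sub_const _)).fderiv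

lemma norm_fderiv_potential_le (hN : Normalised C₀ τ H f m₀) (hC : 0 < C₀) (hτ : 0 ≤ τ)
    (hm : AssumptionM m₀) (hH : AssumptionH C₀ τ H) (hf : IsCoupling f) (x y : E d) :
    ‖fderiv ℝ (potential H f (m₀ y)) x‖ ≤ 2 * C₀ := by
  rw [fderiv_potential hH hf (hm.pos y)]
  refine ContinuousLinearMap.opNorm_le_bound _ (by positivity) fun v => ?_
  have h1 : ‖fderiv ℝ (fun z : E d × ℝ => re f z.1 z.2) (x, m₀ y) (v, 0)‖ ≤ C₀ * ‖v‖ :=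
    (ContinuousLinearMap.le_of_opNorm_le _ (hN.norm_fderiv_re_le hC hm x y) _).trans
      (by gcongr; exact norm_fst_zero_le v)
  have h2 : ‖fderiv ℝ (fun y => H y 0) x v‖ ≤ C₀ * ‖v‖ := by
    rw [← inner_gradient]
    refine (norm_inner_le_norm _ _).trans ?_
    have := hN.boundX x 0
    rw [zero_rpow hτ, add_zero, mul_one] at this
    exact mul_le_mul_of_nonneg_right this (norm_nonneg v)
  calc _ ≤ _ := norm_sub_le _ _
    _ ≤ C₀ * ‖v‖ + C₀ * ‖v‖ := add_le_add h1 h2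
    _ = _ := by ring

lemma abs_fderiv_fderiv_potential_le (hN : Normalised C₀ τ H f m₀) (hC : 0 < C₀) (hτ : 0 ≤ τ)
    (hm : AssumptionM m₀) (hH : AssumptionH C₀ τ H) (hf : IsCoupling f) (x y v : E d) :
    |fderiv ℝ (fderiv ℝ (potential H f (m₀ y))) x v v| ≤ 2 * C₀ * ‖v‖ ^ 2 := by
  set G : E d × ℝ → ℝ := fun z => re f z.1 z.2 with hG
  have hGd : HasFDerivAt (fderiv ℝ G) (fderiv ℝ (fderiv ℝ G) (x, m₀ y)) (x, m₀ y) :=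
    (((hf.smooth.fderiv_of_isOpen (m := 3) IsCoupling.isOpen_pos (by norm_num)).differentiableOn
      (by norm_num)).differentiableAt
      (IsCoupling.isOpen_pos.mem_nhds (show (x, m₀ y) ∈ univ ×ˢ Ioi 0 from ⟨mem_univ _, hm.pos y⟩))).hasFDerivAt
  have hHd : HasFDerivAt (fderiv ℝ fun y => H y 0) (fderiv ℝ (fderiv ℝ fun y => H y 0) x) x :=
    (((hH.contDiff_left 0).fderiv_right (m := 3) (by norm_num)).differentiable
      (by norm_num) x).hasFDerivAt
  have h1 : HasFDerivAt (fun x => fderiv ℝ G (x, m₀ y))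
      ((fderiv ℝ (fderiv ℝ G) (x, m₀ y)).comp (ContinuousLinearMap.inl ℝ (E d) ℝ)) x :=
    hGd.comp x (hasFDerivAt_prodMk_left (𝕜 := ℝ) x (m₀ y))
  have h2 := (h1.clm_comp (hasFDerivAt_const (ContinuousLinearMap.inl ℝ (E d) ℝ) x)).fun_sub hHd
  rw [funext (fderiv_potential hH hf (hm.pos y)), h2.fderiv]
  have h3 : |fderiv ℝ (fderiv ℝ G) (x, m₀ y) (v, 0) (v, 0)| ≤ C₀ * ‖v‖ ^ 2 :=
    (abs_fderiv_fderiv_le_of_ckNorm_le hC.le le_rfl hN.ckNorm_coupling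
      ⟨mem_univ _, hm.mem_range y⟩ _).trans (by gcongr; exact norm_fst_zero_le v)
  have h4 : |fderiv ℝ (fderiv ℝ fun y => H y 0) x v v| ≤ C₀ * ‖v‖ ^ 2 := by
    rw [← inner_fderiv_gradient ((hH.contDiff_left 0).of_le (by norm_num))]
    refine (norm_inner_le_norm (𝕜 := ℝ) (hessX H x 0 v) v).trans ?_
    have := hN.boundXX x 0
    rw [zero_rpow hτ, add_zero, mul_one] at this
    have := (hessX H x 0).le_of_opNorm_le this v
    calc _ ≤ C₀ * ‖v‖ * ‖v‖ := mul_le_mul_of_nonneg_right this (norm_nonneg v)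
      _ = _ := by ring
  have h5 : ∀ a b : ℝ, |a| ≤ C₀ * ‖v‖ ^ 2 → |b| ≤ C₀ * ‖v‖ ^ 2 →
      |a - b| ≤ 2 * C₀ * ‖v‖ ^ 2 := fun a b ha hb => (abs_sub _ _).trans (by linarith)
  simpa using h5 _ _ h3 h4

end Normalised

end Data

end MFG

namespace MFG

variable {d : ℕ}

/-! ### Bounds for the value function and the terminal density -/

section Terminal

variable {C₀ τ T : ℝ} {H : E d → E d → ℝ} {f g : E d → ℝ → EReal} {m₀ : E d → ℝ}
  {u m : E d → ℝ → ℝ}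

namespace IsCoupling

lemma minX_le (hf : IsCoupling f) {n : ℝ} (hn : 0 < n) (x : E d) : minX f n ≤ re f x n := by
  obtain ⟨y, hy, h⟩ := hf.exists_minX hn
  exact h x

lemma le_maxX (hf : IsCoupling f) {n : ℝ} (hn : 0 < n) (x : E d) : re f x n ≤ maxX f n := by
  obtain ⟨y, hy, h⟩ := hf.exists_maxX hn
  exact hy ▸ h x

end IsCoupling

/-- By separation a minimiser of `f(·,1)` minimises every slice, so `f₀` is a translate of `f(0,·)`,
which takes all real values. -/
lemma AssumptionF.exists_minX_eq (hf : AssumptionF C₀ τ f) (hse : StrictlyElliptic f)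
    (hsep : SeparatedPotential H f) (K : ℝ) : ∃ n, 0 < n ∧ minX f n = K := by
  obtain ⟨x, hx₁, hx⟩ := hf.coupling.exists_minX one_pos
  obtain ⟨n, hn, h⟩ := hf.exists_re_eq hse (K - (re f x 1 - re f 0 1))
  obtain ⟨y, hy, hyn⟩ := hf.coupling.exists_minX hn
  refine ⟨n, hn, ?_⟩
  have e1 := re_eq_add hf.coupling hsep.derXM_eq x hn 1 one_pos
  have e2 := re_eq_add hf.coupling hsep.derXM_eq y hn 1 one_pos
  have := hyn x
  have := hx y
  linarith

lemma AssumptionF.exists_maxX_eq (hf : AssumptionF C₀ τ f) (hse : StrictlyElliptic f)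
    (hsep : SeparatedPotential H f) (K : ℝ) : ∃ n, 0 < n ∧ maxX f n = K := by
  obtain ⟨x, hx₁, hx⟩ := hf.coupling.exists_maxX one_pos
  obtain ⟨n, hn, h⟩ := hf.exists_re_eq hse (K - (re f x 1 - re f 0 1))
  obtain ⟨y, hy, hyn⟩ := hf.coupling.exists_maxX hn
  refine ⟨n, hn, ?_⟩
  have e1 := re_eq_add hf.coupling hsep.derXM_eq x hn 1 one_pos
  have e2 := re_eq_add hf.coupling hsep.derXM_eq y hn 1 one_pos
  have := hyn x
  have := hx y
  linarith

/-- The data of the problem, together with a solution. -/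
structure Setting (C₀ τ T : ℝ) (H : E d → E d → ℝ) (f g : E d → ℝ → EReal) (m₀ : E d → ℝ)
    (u m : E d → ℝ → ℝ) : Prop where
  const_pos : 0 < C₀
  exponent_nonneg : 0 ≤ τ
  time_pos : 0 < T
  density : AssumptionM m₀
  hamiltonian : AssumptionH C₀ τ H
  cost : AssumptionF C₀ τ f
  terminalCost : AssumptionG g
  elliptic : StrictlyElliptic f
  separated : SeparatedPotential H f
  normalised : Normalised C₀ τ H f m₀
  solution : IsSolution T H f g m₀ u m

namespace Setting

/-- The reference density `m₀(0)` lies in the range of `m₀`, where the normalisation bounds `f` in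
`C²` by `C₀`. -/
lemma reducedSystem (hS : Setting C₀ τ T H f g m₀ u m) :
    ReducedSystem T (H 0) (potential H f (m₀ 0)) (re f 0) u m :=
  hS.solution.reducedSystem hS.time_pos hS.const_pos hS.hamiltonian hS.cost hS.elliptic
    hS.separated (hS.density.pos 0)

lemma hamiltonJacobi (hS : Setting C₀ τ T H f g m₀ u m) (x : E d) {t : ℝ} (ht : t ∈ Icc 0 T) :
    -jet T u (x, t) (0, 1) + H x (mom T u (x, t)) = re f x (m x t) := by
  have h := hS.solution.hamiltonJacobi_closed hS.time_pos hS.hamiltonian hS.cost.coupling x ht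
  rw [← hS.cost.coupling.coe_re (hS.reducedSystem.pos x t ht), EReal.coe_eq_coe_iff,
    ← hS.reducedSystem.mom_eq ht, derT_eq_jet (by norm_num) hS.solution.smooth_u hS.time_pos x ht]
    at h
  exact h

lemma terminal (hS : Setting C₀ τ T H f g m₀ u m) (x : E d) : u x T = re g x (m x T) := by
  have h := hS.solution.terminal x
  rw [← hS.terminalCost.coupling.coe_re
    (hS.reducedSystem.pos x T (right_mem_Icc.2 hS.time_pos.le)), EReal.coe_eq_coe_iff] at h
  exact h

/-- At the terminal maximum `D_x u = 0`, so the equation trades `u_t` for `f(x, m(x,T))`. The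
constant `2C₀²` is `|DP| ≤ 2C₀` times `|Dh(0)| ≤ C₀`; `2C₀` bounds `u_t` at critical points at time
`0`. -/
lemma exists_terminal_max (hS : Setting C₀ τ T H f g m₀ u m) {ς : ℝ} (hς : ς = 1 ∨ ς = -1) :
    ∃ x, -((2 * C₀ ^ 2 + 1) * T + 3 * C₀ + 1) ≤ -ς * re f x (m x T) ∧
      (∀ y, ς * u y T ≤ ς * u x T) ∧
      ∀ y, ∀ s ∈ Icc 0 T, ς * u y s ≤
        ς * u x T + ((2 * C₀ ^ 2 + 1) * T ^ 2 / 2 + (2 * C₀ + 1) * T) := by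
  have hC := hS.const_pos
  have hD : ∀ x, |fderiv ℝ (potential H f (m₀ 0)) x (gradient (H 0) 0)| ≤ 2 * C₀ ^ 2 := by
    intro x
    have h1 := hS.normalised.norm_fderiv_potential_le hC hS.exponent_nonneg hS.density
      hS.hamiltonian hS.cost.coupling x 0
    have h2 := hS.normalised.boundP 0 0
    rw [norm_zero, add_zero, mul_one] at h2
    refine (ContinuousLinearMap.le_of_opNorm_le _ h1 _).trans ?_
    calc 2 * C₀ * ‖gradient (H 0) 0‖ ≤ 2 * C₀ * C₀ := by gcongr; exact h2
      _ = _ := by ring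
  have hB : ∀ x, mom T u (x, 0) = 0 → |jet T u (x, 0) (0, 1)| ≤ 2 * C₀ := by
    intro x hx
    have h1 := hS.hamiltonJacobi x (left_mem_Icc.2 hS.time_pos.le)
    have h2 := abs_le.1 (hS.normalised.abs_re_le hC hS.density x x)
    have h3 := abs_le.1 (hS.normalised.abs_hamiltonian_zero_le x)
    rw [hx, hS.solution.initial] at h1
    rw [abs_le]
    constructor <;> linarith [h2.1, h2.2, h3.1, h3.2]
  obtain ⟨x, hx, h1, h2, h3⟩ := hS.reducedSystem.exists_terminal_max hς (by positivity) hD hB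
  refine ⟨x, ?_, h2, h3⟩
  have h4 := hS.hamiltonJacobi x (right_mem_Icc.2 hS.time_pos.le)
  have h5 := abs_le.1 (hS.normalised.abs_hamiltonian_zero_le x)
  rw [hx] at h4
  rw [← h4]
  rcases hς with rfl | rfl <;> linarith [h5.1, h5.2]

variable {l₁ a b : ℝ}

/-- At the maximum point of `u(·,T)` the bound on `f` gives `m ≤ a`, hence `u(·,T) ≤ g₁(a)`
everywhere, and `g₀(m(y,T)) ≤ u(y,T)` returns to the density at any `y`. -/
lemma upper_bounds (hS : Setting C₀ τ T H f g m₀ u m)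
    (hl : (2 * C₀ ^ 2 + 1) * T + 3 * C₀ + 1 ≤ l₁) (ha : 0 < a) (hal : minX f a = l₁) :
    (∀ y, ∀ s ∈ Icc 0 T, u y s ≤
      maxX g a + ((2 * C₀ ^ 2 + 1) * T ^ 2 / 2 + (2 * C₀ + 1) * T)) ∧
      ∀ y, m y T ≤ inv (minX g) (maxX g a) := by
  have hpos := fun x => hS.reducedSystem.pos x T (right_mem_Icc.2 hS.time_pos.le)
  have hf := hS.cost.coupling
  have hg := hS.terminalCost.coupling
  obtain ⟨x, h1, h2, h3⟩ := hS.exists_terminal_max (Or.inl rfl)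
  have hx : m x T ≤ a := by
    refine (hf.strictMonoOn_minX.le_iff_le (hpos x) ha).1 ?_
    linarith [hf.minX_le (hpos x) x]
  have hu : u x T ≤ maxX g a := by
    rw [hS.terminal]
    exact ((hg.strictMonoOn_re x).monotoneOn (hpos x) ha hx).trans (hg.le_maxX ha x)
  refine ⟨fun y s hs => by linarith [h3 y s hs], fun y => ?_⟩
  obtain ⟨n, hn, hna⟩ := hS.terminalCost.exists_minX_eq ha
  rw [inv_eq_of_strictMonoOn hg.strictMonoOn_minX hn hna]
  refine (hg.strictMonoOn_minX.le_iff_le (hpos y) hn).1 ?_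
  have := hg.minX_le (hpos y) y
  rw [← hS.terminal] at this
  linarith [h2 y]

lemma lower_bounds (hS : Setting C₀ τ T H f g m₀ u m)
    (hl : (2 * C₀ ^ 2 + 1) * T + 3 * C₀ + 1 ≤ l₁) (hb : 0 < b) (hbl : maxX f b = -l₁) :
    (∀ y, ∀ s ∈ Icc 0 T,
      minX g b - ((2 * C₀ ^ 2 + 1) * T ^ 2 / 2 + (2 * C₀ + 1) * T) ≤ u y s) ∧
      0 < inv (maxX g) (minX g b) ∧ ∀ y, inv (maxX g) (minX g b) ≤ m y T := by
  have hpos := fun x => hS.reducedSystem.pos x T (right_mem_Icc.2 hS.time_pos.le)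
  have hf := hS.cost.coupling
  have hg := hS.terminalCost.coupling
  obtain ⟨x, h1, h2, h3⟩ := hS.exists_terminal_max (Or.inr rfl)
  have hx : b ≤ m x T := by
    refine (hf.strictMonoOn_maxX.le_iff_le hb (hpos x)).1 ?_
    linarith [hf.le_maxX (hpos x) x]
  have hu : minX g b ≤ u x T := by
    rw [hS.terminal]
    exact (hg.minX_le hb x).trans ((hg.strictMonoOn_re x).monotoneOn hb (hpos x) hx)
  obtain ⟨n, hn, hna⟩ := hS.terminalCost.exists_maxX_eq hb
  rw [inv_eq_of_strictMonoOn hg.strictMonoOn_maxX hn hna]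
  refine ⟨fun y s hs => by linarith [h3 y s hs], hn, fun y => ?_⟩
  refine (hg.strictMonoOn_maxX.le_iff_le hn (hpos y)).1 ?_
  have := hg.le_maxX (hpos y) y
  rw [← hS.terminal] at this
  linarith [h2 y]

end Setting

end Terminal

end MFG

namespace MFG

variable {d : ℕ}

/-! ### Finiteness of the norms of the couplings -/

lemma supNorm_lt_top_of_periodic {V : Type*} [NormedAddCommGroup V] {G : E d × ℝ → V} {S : Set ℝ}
    (hper : ∀ n, IsPeriodic fun x => G (x, n)) (hc : ContinuousOn G (univ ×ˢ S))
    (hS : IsCompact S) : supNorm G (univ ×ˢ S) < ⊤ := by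
  obtain ⟨C, hC⟩ := (isCompact_unitCube.prod hS).exists_bound_of_continuousOn
    (hc.mono (prod_mono (subset_univ (unitCube d)) le_rfl))
  refine (supNorm_le_ofReal (C := C) fun z hz => ?_).trans_lt ENNReal.ofReal_lt_top
  have h : G (toCube z.1, z.2) = G z := (hper z.2).apply_toCube z.1
  rw [← h]
  exact hC (toCube z.1, z.2) ⟨toCube_mem _, hz.2⟩

lemma ckNorm_one_lt_top {V : Type*} [NormedAddCommGroup V] [NormedSpace ℝ V] {G : E d × ℝ → V}
    (hper : ∀ n, IsPeriodic fun x => G (x, n)) (hG : ContDiffOn ℝ 1 G (univ ×ˢ Ioi 0)) {K : ℝ}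
    (hK : 0 < K) : ckNorm 1 G (univ ×ˢ Icc (1 / K) K) < ⊤ := by
  have hsub : (univ : Set (E d)) ×ˢ Icc (1 / K) K ⊆ univ ×ˢ Ioi 0 :=
    prod_mono le_rfl fun n hn => lt_of_lt_of_le (by positivity) hn.1
  have h0 : supNorm (iteratedFDeriv ℝ 0 G) (univ ×ˢ Icc (1 / K) K) < ⊤ := by
    have := supNorm_lt_top_of_periodic hper (hG.continuousOn.mono hsub) isCompact_Icc
    simpa only [supNorm, ← ofReal_norm, norm_iteratedFDeriv_zero] using this
  have h1 : supNorm (iteratedFDeriv ℝ 1 G) (univ ×ˢ Icc (1 / K) K) < ⊤ := by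
    have hper' : ∀ n, IsPeriodic fun x => fderiv ℝ G (x, n) := by
      intro n x i
      have h := fderiv_comp_add_right (𝕜 := ℝ) (f := G) (x := (x, n))
        (EuclideanSpace.single i (1 : ℝ), (0 : ℝ))
      have hG' : (fun z => G (z + (EuclideanSpace.single i (1 : ℝ), (0 : ℝ)))) = G := by
        funext z
        have hz : z + (EuclideanSpace.single i (1 : ℝ), (0 : ℝ)) =
            (z.1 + EuclideanSpace.single i 1, z.2) := Prod.ext rfl (add_zero _)
        rw [hz]
        exact hper z.2 z.1 i
      rw [hG'] at h
      simpa using h.symm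
    have := supNorm_lt_top_of_periodic hper'
      ((hG.continuousOn_fderiv_of_isOpen IsCoupling.isOpen_pos le_rfl).mono hsub) isCompact_Icc
    simpa only [supNorm, ← ofReal_norm, norm_iteratedFDeriv_one] using this
  rw [ckNorm, Finset.sum_range_succ, Finset.sum_range_one]
  exact ENNReal.add_lt_top.2 ⟨h0, h1⟩

namespace IsCoupling

variable {f : E d → ℝ → EReal}

lemma inv_re (hf : IsCoupling f) {x : E d} {n : ℝ} (hn : 0 < n) : inv (re f x) (re f x n) = n :=
  inv_eq_of_strictMonoOn (hf.strictMonoOn_re x) hn rfl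

lemma chi_re (hf : IsCoupling f) {x : E d} {n : ℝ} (hn : 0 < n) :
    chi f x (re f x n) = n * derM f x n := by
  rw [chi, hf.inv_re hn]

lemma contDiffOn_derM (hf : IsCoupling f) (x : E d) : ContDiffOn ℝ 3 (derM f x) (Ioi 0) :=
  (hf.contDiffOn_right x).deriv_of_isOpen isOpen_Ioi (by norm_num)

lemma contDiffOn_mul_derM (hf : IsCoupling f) (x : E d) :
    ContDiffOn ℝ 3 (fun n => n * derM f x n) (Ioi 0) := contDiffOn_id.mul (hf.contDiffOn_derM x)

lemma mul_derM_pos (hf : IsCoupling f) {x : E d} {n : ℝ} (hn : 0 < n) : 0 < n * derM f x n :=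
  mul_pos hn (hf.derM_pos x n hn)

/-- In the variable `n` one has `χ(x, f(x,n)) = n f_m(x,n)`; the chain rule uses the derivative of
the inverse of `f(x,·)`. -/
lemma hfunW_re (hf : IsCoupling f) {x : E d} {n : ℝ} (hn : 0 < n) :
    hfunW f x (re f x n) =
      deriv (fun n => n * derM f x n) n * (derM f x n)⁻¹ / (2 * √(n * derM f x n)) := by
  have h1 : HasStrictDerivAt (re f x) (derM f x n) n :=
    ((hf.contDiffOn_right x).contDiffAt (Ioi_mem_nhds hn)).hasStrictDerivAt (by norm_num)
  have h2 : HasDerivAt (inv (re f x)) (derM f x n)⁻¹ (re f x n) :=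
    (h1.to_local_left_inverse (hf.derM_pos x n hn).ne'
      ((eventually_gt_nhds hn).mono fun k hk => hf.inv_re hk)).hasDerivAt
  have h3 : HasDerivAt (fun n => n * derM f x n) (deriv (fun n => n * derM f x n) n)
      (inv (re f x) (re f x n)) := by
    rw [hf.inv_re hn]
    exact (((hf.contDiffOn_mul_derM x).differentiableOn (by norm_num)).differentiableAt
      (Ioi_mem_nhds hn)).hasDerivAt
  have h4 : HasDerivAt (chi f x) _ (re f x n) := h3.comp (re f x n) h2
  have h5 := h4.sqrt (by rw [hf.chi_re hn]; exact (hf.mul_derM_pos hn).ne')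
  rw [hf.chi_re hn] at h5
  exact h5.deriv

lemma continuousOn_hfunW_re (hf : IsCoupling f) (x : E d) :
    ContinuousOn (fun n => hfunW f x (re f x n)) (Ioi 0) := by
  have h1 : ContinuousOn (deriv fun n => n * derM f x n) (Ioi 0) :=
    (hf.contDiffOn_mul_derM x).continuousOn_deriv_of_isOpen isOpen_Ioi (by norm_num)
  refine ((h1.mul ((hf.contDiffOn_derM x).continuousOn.inv₀
    fun n hn => (hf.derM_pos x n hn).ne')).div
    (continuousOn_const.mul (hf.contDiffOn_mul_derM x).continuousOn.sqrt) fun n hn => ?_).congr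
    fun n hn => hf.hfunW_re hn
  exact (mul_pos two_pos (Real.sqrt_pos.2 (hf.mul_derM_pos hn))).ne'

/-- The logarithmic drift of `m f_m` is controlled by `h_w`. -/
lemma abs_deriv_mul_derM_le (hf : IsCoupling f) {x : E d} {n B : ℝ} (hn : 0 < n)
    (hB : |hfunW f x (re f x n)| ≤ B) :
    |deriv (fun n => n * derM f x n) n| ≤ 2 * B * derM f x n * √(n * derM f x n) := by
  have h1 := hf.derM_pos x n hn
  have h2 := Real.sqrt_pos.2 (hf.mul_derM_pos (x := x) hn)
  rw [hf.hfunW_re hn, abs_div, abs_mul, abs_inv, abs_of_pos h1, abs_of_pos (by positivity :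
    0 < 2 * √(n * derM f x n)), div_le_iff₀ (by positivity), ← div_eq_mul_inv,
    div_le_iff₀ h1] at hB
  linarith

end IsCoupling

namespace AssumptionF

variable {C₀ τ : ℝ} {H : E d → E d → ℝ} {f : E d → ℝ → EReal}

/-- Adding a constant to the coupling translates `χ` in `w`, so bounds on `χ` and on `h_w` need only
be proved at the origin. -/
lemma chi_eq (hf : AssumptionF C₀ τ f) (hse : StrictlyElliptic f) (hsep : SeparatedPotential H f)
    (x : E d) (w : ℝ) : chi f x w = chi f 0 (w - (re f x 1 - re f 0 1)) := by
  obtain ⟨n, hn, h⟩ := hf.exists_re_eq hse (w - (re f x 1 - re f 0 1))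
  have e1 : ∀ k, 0 < k → re f x k = re f 0 k + (re f x 1 - re f 0 1) := fun k hk =>
    re_eq_add hf.coupling hsep.derXM_eq x hk 1 one_pos
  have e2 : derM f x n = derM f 0 n := by
    have : re f x =ᶠ[𝓝 n] fun k => re f 0 k + (re f x 1 - re f 0 1) :=
      (eventually_gt_nhds hn).mono e1
    rw [derM, this.deriv_eq, deriv_add_const, derM]
  have e3 : w = re f x n := by rw [e1 n hn]; linarith
  rw [← h, hf.coupling.chi_re hn, e3, hf.coupling.chi_re hn, e2]

lemma hfunW_eq (hf : AssumptionF C₀ τ f) (hse : StrictlyElliptic f)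
    (hsep : SeparatedPotential H f) (x : E d) (w : ℝ) :
    hfunW f x w = hfunW f 0 (w - (re f x 1 - re f 0 1)) := by
  have : hfun f x = fun w => hfun f 0 (w - (re f x 1 - re f 0 1)) :=
    funext fun w => by rw [hfun, hf.chi_eq hse hsep]; rfl
  rw [hfunW, this, deriv_comp_sub_const]
  rfl

/-- Compactness covers densities between the one corresponding to `w₀` and the threshold of the
growth condition; beyond it `m f_m` is bounded below. -/
lemma exists_chi_bound (hf : AssumptionF C₀ τ f) (hse : StrictlyElliptic f) (w₀ : ℝ) :
    ∃ C, ∀ w, w₀ ≤ w → |1 / chi f 0 w| ≤ C := by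
  obtain ⟨n₀, hn₀, h₀⟩ := hf.exists_re_eq hse w₀
  obtain ⟨c, hc, hev⟩ := hf.growth
  obtain ⟨M, hM⟩ := eventually_atTop.1 hev
  have hcont : ContinuousOn (fun n => 1 / (n * derM f 0 n)) (Ioi 0) :=
    continuousOn_const.div (hf.coupling.contDiffOn_mul_derM 0).continuousOn
      fun n hn => (hf.coupling.mul_derM_pos hn).ne'
  obtain ⟨C, hC⟩ := (isCompact_Icc (a := n₀) (b := M)).exists_bound_of_continuousOn
    (hcont.mono fun n hn => hn₀.trans_le hn.1)
  refine ⟨max C (1 / c), fun w hw => ?_⟩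
  obtain ⟨n, hn, h⟩ := hf.exists_re_eq hse w
  have hn0 : n₀ ≤ n := ((hf.coupling.strictMonoOn_re 0).le_iff_le hn₀ hn).1 (by rwa [h₀, h])
  rw [← h, hf.coupling.chi_re hn]
  rcases le_total n M with hnM | hnM
  · exact (hC n ⟨hn0, hnM⟩).trans (le_max_left _ _)
  · rw [abs_of_pos (one_div_pos.2 (hf.coupling.mul_derM_pos hn))]
    exact (one_div_le_one_div_of_le hc (hM n hnM 0)).trans (le_max_right _ _)

lemma exists_hfunW_bound (hf : AssumptionF C₀ τ f) (hse : StrictlyElliptic f)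
    (hsep : SeparatedPotential H f) (w₀ : ℝ) : ∃ C, ∀ w, w₀ ≤ w → |hfunW f 0 w| ≤ C := by
  obtain ⟨C₁, hev⟩ := hsep.limsup_hW
  obtain ⟨w₁, hw₁⟩ := eventually_atTop.1 hev
  obtain ⟨n₀, hn₀, h₀⟩ := hf.exists_re_eq hse w₀
  obtain ⟨n₁, hn₁, h₁⟩ := hf.exists_re_eq hse w₁
  obtain ⟨C, hC⟩ := (isCompact_Icc (a := n₀) (b := n₁)).exists_bound_of_continuousOn
    ((hf.coupling.continuousOn_hfunW_re 0).mono fun n hn => hn₀.trans_le hn.1)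
  have hmono := hf.coupling.strictMonoOn_re 0
  refine ⟨max C C₁, fun w hw => ?_⟩
  obtain ⟨n, hn, h⟩ := hf.exists_re_eq hse w
  rcases le_total w w₁ with hww | hww
  · rw [← h]
    exact (hC n ⟨(hmono.le_iff_le hn₀ hn).1 (by rwa [h₀, h]),
      (hmono.le_iff_le hn hn₁).1 (by rwa [h₁, h])⟩).trans (le_max_left _ _)
  · exact (hw₁ w hww 0).trans (le_max_right _ _)

/-- The translation is at most `f₁(1) - f(0,1)`, so all shifted half-lines lie in a single one. -/
lemma supNorm_lt_top_of_shift (hf : AssumptionF C₀ τ f) {φ : E d → ℝ → ℝ}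
    (hφ : ∀ x w, φ x w = φ 0 (w - (re f x 1 - re f 0 1)))
    (hbd : ∀ w₀, ∃ C, ∀ w, w₀ ≤ w → |φ 0 w| ≤ C) (K : ℝ) :
    supNorm (fun z : E d × ℝ => φ z.1 z.2) (univ ×ˢ Ici (-K)) < ⊤ := by
  obtain ⟨C, hC⟩ := hbd (-K - (maxX f 1 - re f 0 1))
  refine (supNorm_le_ofReal (C := C) fun z hz => ?_).trans_lt ENNReal.ofReal_lt_top
  rw [hφ]
  refine hC _ ?_
  have h1 := hf.coupling.le_maxX one_pos z.1
  have h2 : -K ≤ z.2 := hz.2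
  linarith

lemma beta_lt_top (hf : AssumptionF C₀ τ f) (hse : StrictlyElliptic f)
    (hsep : SeparatedPotential H f) {g : E d → ℝ → EReal} (hg : IsCoupling g) {K : ℝ}
    (hK : 0 < K) : beta f g K < ⊤ := by
  refine ENNReal.add_lt_top.2 ⟨ENNReal.add_lt_top.2 ⟨ENNReal.add_lt_top.2 ⟨?_, ?_⟩, ?_⟩, ?_⟩
  · exact ckNorm_one_lt_top (fun n => hf.coupling.periodic_re n)
      (hf.coupling.smooth.of_le (by norm_num)) hK
  · exact ckNorm_one_lt_top (fun n => hg.periodic_gradX n)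
      (hg.contDiffOn_gradX.of_le (by norm_num)) hK
  · exact hf.supNorm_lt_top_of_shift (φ := fun x w => 1 / chi f x w)
      (fun x w => by rw [hf.chi_eq hse hsep]) (hf.exists_chi_bound hse) K
  · exact hf.supNorm_lt_top_of_shift (hf.hfunW_eq hse hsep)
      (hf.exists_hfunW_bound hse hsep) K

end AssumptionF

end MFG

namespace MFG

variable {d : ℕ}

/-! ### The gradient bound -/

namespace Setting

variable {C₀ τ T : ℝ} {H : E d → E d → ℝ} {f g : E d → ℝ → EReal} {m₀ : E d → ℝ}
  {u m : E d → ℝ → ℝ}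

lemma jet_initial (hS : Setting C₀ τ T H f g m₀ u m) (x v : E d) :
    jet T m (x, 0) (v, 0) = fderiv ℝ m₀ x v := by
  have h := hasFDerivAt_space (by norm_num) hS.solution.smooth_m x (left_mem_Icc.2 hS.time_pos.le)
  rw [funext hS.solution.initial] at h
  rw [h.fderiv]
  rfl

lemma inner_mom_terminal (hS : Setting C₀ τ T H f g m₀ u m) (x v : E d) :
    inner ℝ (mom T u (x, T)) v = inner ℝ (gradX (re g) x (m x T)) v
      + derM g x (m x T) * jet T m (x, T) (v, 0) := by
  have hT := right_mem_Icc.2 hS.time_pos.le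
  have hpos := hS.reducedSystem.pos x T hT
  have hg := hS.terminalCost.coupling
  have h1 := hasFDerivAt_space (by norm_num) hS.solution.smooth_u x hT
  have h2 := hasFDerivAt_space (by norm_num) hS.solution.smooth_m x hT
  have h3 := (hg.hasFDerivAt_re hpos).comp x ((hasFDerivAt_id x).prodMk h2)
  have h4 : (fun y => u y T) = (fun z : E d × ℝ => re g z.1 z.2) ∘ fun y => (id y, m y T) :=
    funext fun y => hS.terminal y
  rw [h4] at h1
  have h5 := congrArg (fun L => L v) (h1.unique h3)
  rw [mom, inner_spaceGrad, hg.gradX_eq hpos, inner_spaceGrad, hg.derM_eq hpos]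
  have h6 : (v, jet T m (x, T) (v, 0)) = (v, (0 : ℝ)) + jet T m (x, T) (v, 0) • ((0 : E d), (1 : ℝ)) := by
    simp
  refine h5.trans ?_
  change fderiv ℝ (fun z : E d × ℝ => re g z.1 z.2) (x, m x T) (v, jet T m (x, T) (v, 0)) = _
  rw [h6, map_add, map_smul, smul_eq_mul, mul_comm]

/-- In the constant, `4k` covers the potential, `k²` the product of the `C₀` bounds on `f_m` and
`Dm₀`, and `2B` the drift, whose factor two comes from differentiating a square root. The condition
`ω + 1 ≤ k` keeps the drift estimate inside the range `w ≥ -k` measured by `β`. -/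
lemma reducedBounds (hS : Setting C₀ τ T H f g m₀ u m) {l ω k B : ℝ} (hCl : C₀ ≤ l)
    (hu : ∀ x, ∀ t ∈ Icc 0 T, |u x t| ≤ l) (hm : ∀ x, m x T ≤ l) (hm' : ∀ x, 1 / l ≤ m x T)
    (hω : ω = (minX f (1 / l))⁻ + l) (hk : ω + 1 ≤ k) (hTk : 1 / T ≤ k) (hB : 0 ≤ B)
    (hβ : beta f g k ≤ ENNReal.ofReal B) :
    ReducedBounds (1 + 4 * k + k ^ 2 + 2 * B) ω T (H 0) (potential H f (m₀ 0)) (re f 0) u m := by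
  have hC := hS.const_pos
  have hl : 0 < l := hC.trans_le hCl
  have hneg : 0 ≤ (minX f (1 / l))⁻ := negPart_nonneg _
  have hlω : l ≤ ω := by linarith
  have hlk : l ≤ k := by linarith
  have hk0 : 0 < k := by linarith
  have hf := hS.cost.coupling
  have hg := hS.terminalCost.coupling
  have hH := hS.hamiltonian
  have hN := hS.normalised
  have hT := right_mem_Icc.2 hS.time_pos.le
  have hk2 : 0 ≤ k ^ 2 := sq_nonneg k
  set N := 1 + 4 * k + k ^ 2 + 2 * B with hNdef
  have hN0 : 0 < N := by linarith
  have hCN : C₀ ≤ N := by linarith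
  have hmk : ∀ x, m x T ∈ Icc (1 / k) k := fun x =>
    ⟨(one_div_le_one_div_of_le hl hlk).trans (hm' x), (hm x).trans hlk⟩
  have hβf : ckNorm 1 (fun z : E d × ℝ => re f z.1 z.2) (univ ×ˢ Icc (1 / k) k)
      ≤ ENNReal.ofReal B := ((le_self_add.trans le_self_add).trans le_self_add).trans hβ
  have hβg : ckNorm 1 (fun z : E d × ℝ => gradX (re g) z.1 z.2) (univ ×ˢ Icc (1 / k) k)
      ≤ ENNReal.ofReal B := ((le_add_self.trans le_self_add).trans le_self_add).trans hβ
  have hβh : supNorm (fun z : E d × ℝ => hfunW f z.1 z.2) (univ ×ˢ Ici (-k))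
      ≤ ENNReal.ofReal B := le_add_self.trans hβ
  exact
  { one_le := by linarith
    omega_le := by linarith
    hess_ge := fun p v => le_trans (by gcongr) (hH.convex 0 p v).1
    hess_le := fun p v => (hH.convex 0 p v).2.trans (by gcongr)
    quadratic := fun p => (sub_le_sub_left hCN _).trans (hH.quadratic 0 p)
    lower := fun p => le_trans (sub_le_sub (by gcongr) hCN) (hN.lower 0 p)
    upper := fun p => (hN.upper 0 p).trans (by gcongr)
    grad_le := fun p => (hN.boundP 0 p).trans (by gcongr)
    third := fun p => by
      have h := hH.third 0 p
      have hp : 0 < 1 + ‖p‖ := by positivity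
      rw [← div_eq_mul_inv, le_div_iff₀ hp] at h
      exact h.trans hCN
    P_le := fun x => (hN.abs_potential_le hC hS.density x 0).trans (by linarith)
    dP_le := fun x => (hN.norm_fderiv_potential_le hC hS.exponent_nonneg hS.density hH hf x
      0).trans (by linarith)
    ddP_le := fun x v => (hN.abs_fderiv_fderiv_potential_le hC hS.exponent_nonneg hS.density hH
      hf x 0 v).trans (mul_le_mul_of_nonneg_right (by linarith) (sq_nonneg _))
    u_le := fun x t ht => (hu x t ht).trans (by linarith)
    inv_T := by linarith
    initial_ge := fun x => by
      rw [hS.solution.initial]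
      linarith [(abs_le.1 (hN.abs_re_le hC hS.density 0 x)).1]
    terminal_ge := fun x => by
      have h1 := (hf.strictMonoOn_re 0).monotoneOn (one_div_pos.2 hl)
        ((one_div_pos.2 hl).trans_le (hm' x)) (hm' x)
      have h2 := hf.minX_le (one_div_pos.2 hl) 0
      have h3 := neg_le_negPart (minX f (1 / l))
      linarith
    initial_le := fun x => by
      rw [hS.solution.initial]
      linarith [(abs_le.1 (hN.abs_re_le hC hS.density 0 x)).2]
    terminal_le := fun x => by
      have := norm_le_of_ckNorm_le hB hβf (z := (0, m x T)) ⟨mem_univ _, hmk x⟩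
      linarith [(abs_le.1 this).2]
    initial_deriv := fun x v => by
      rw [hS.solution.initial, hS.jet_initial, ← derM, hf.derM_eq (hS.density.pos x), abs_mul]
      have h1 := (fderiv ℝ (fun z : E d × ℝ => re f z.1 z.2) (0, m₀ x)).le_of_opNorm_le
        (hN.norm_fderiv_re_le hC hS.density 0 x) (0, 1)
      have h2 := (fderiv ℝ m₀ x).le_of_opNorm_le (norm_fderiv_le_of_ckNorm_le hC.le le_rfl
        hN.ckNorm_density (mem_univ x)) v
      have h3 : ‖((0 : E d), (1 : ℝ))‖ = 1 := by simp [Prod.norm_def]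
      rw [h3, mul_one] at h1
      calc _ ≤ C₀ * (C₀ * ‖v‖) := mul_le_mul h1 h2 (abs_nonneg _) hC.le
        _ = C₀ ^ 2 * ‖v‖ := by ring
        _ ≤ N * ‖v‖ := mul_le_mul_of_nonneg_right
          ((pow_le_pow_left₀ hC.le (hCl.trans hlk) 2).trans (by linarith)) (norm_nonneg v)
    terminal_deriv := fun x => ⟨gradX (re g) x (m x T), derM g x (m x T),
      hg.derM_pos x _ (hS.reducedSystem.pos x T hT),
      (norm_le_of_ckNorm_le hB hβg (z := (x, m x T)) ⟨mem_univ _, hmk x⟩).trans (by linarith),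
      hS.inner_mom_terminal x⟩
    drift := fun n hn hFn => by
      have h1 : |hfunW f 0 (re f 0 n)| ≤ B := norm_le_of_supNorm_le hB hβh (z := (0, re f 0 n))
        ⟨mem_univ _, show -k ≤ re f 0 n by linarith⟩
      have h2 := hf.derM_pos 0 n hn
      exact (hf.abs_deriv_mul_derM_le hn h1).trans (mul_le_mul_of_nonneg_right
        (mul_le_mul_of_nonneg_right (by linarith) h2.le) (Real.sqrt_nonneg _)) }

end Setting

/-- The bound for the space-time gradient in terms of the constant of `ReducedBounds`. -/
def gradientConstant (d : ℕ) (N : ℝ) : ℝ :=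
  1 + N * (N * (100 * ((d : ℝ) + 1) * N ^ 11) ^ 2 + 4 * N + 1)
    + (N * (100 * ((d : ℝ) + 1) * N ^ 11) ^ 2 + 3 * N + 1) ^ 2

lemma monotoneOn_gradientConstant : MonotoneOn (gradientConstant d) (Ici 0) := by
  intro N hN N' hN' h
  have h0 : 0 ≤ N := hN
  have h0' : 0 ≤ N' := hN'
  unfold gradientConstant
  gcongr

lemma normDu_le {T N ω : ℝ} {h P : E d → ℝ} {F : ℝ → ℝ} {u m : E d → ℝ → ℝ}
    (hS : ReducedSystem T h P F u m) (hB : ReducedBounds N ω T h P F u m) (x : E d) {t : ℝ}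
    (ht : t ∈ Icc 0 T) : normDu T u x t ≤ gradientConstant d N := by
  obtain ⟨h1, h2⟩ := hS.gradient_bound hB rfl (mem_slab.2 ht : (x, t) ∈ slab d T)
  rw [hS.mom_eq ht] at h1
  rw [← derT_eq_jet (by norm_num) hS.smooth_u hS.T_pos x ht] at h2
  have h3 := sq_le_sq' (abs_le.1 h2).1 (abs_le.1 h2).2
  have h4 : ‖gradX u x t‖ ^ 2 + derT T u x t ^ 2 ≤ gradientConstant d N - 1 := by
    unfold gradientConstant
    linarith
  have h5 : 0 ≤ ‖gradX u x t‖ ^ 2 + derT T u x t ^ 2 := by positivity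
  -- The summand `1` in the constant lets it bound the square root without taking a root itself.
  refine Real.sqrt_le_iff.2 ⟨by linarith, ?_⟩
  nlinarith

/-! ### The constants -/

/-- The constant `L₁`. -/
def constL₁ (v : Fin 3 → ℝ) : ℝ :=
  (2 * v 0 ^ 2 + 1) * v 2 + 3 * v 0 + 1 + ((2 * v 0 ^ 2 + 1) * v 2 ^ 2 / 2 + (2 * v 0 + 1) * v 2)

/-- The constant `L`. -/
def constL (v : Fin 5 → ℝ) : ℝ := 1 + v 0 + v 1 + v 2 + v 3 + v 4

/-- The constant `K₁`. -/
def constK₁ (v : Fin 3 → ℝ) : ℝ := 1 + v 0 + v 1 + v 2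

/-- The constant `K`. -/
def constK (d : ℕ) (v : Fin 2 → ℝ) : ℝ := gradientConstant d (1 + 4 * v 0 + v 0 ^ 2 + 2 * v 1)

lemma isMonotoneConstant_L₁ : IsMonotoneConstant constL₁ {v | 0 ≤ v ∧ v 1 < 1} := by
  refine ⟨fun v hv w hw h => ?_, fun v hv => ?_⟩
  · have h0 := h 0
    have h2 := h 2
    have hv0 : 0 ≤ v 0 := hv.1 0
    have hv2 : 0 ≤ v 2 := hv.1 2
    have hw0 : 0 ≤ w 0 := hw.1 0
    unfold constL₁
    gcongr
  · have hv0 : 0 ≤ v 0 := hv.1 0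
    have hv2 : 0 ≤ v 2 := hv.1 2
    unfold constL₁
    positivity

lemma isMonotoneConstant_L : IsMonotoneConstant constL {v | 0 ≤ v} := by
  refine ⟨fun v hv w hw h => ?_, fun v hv => ?_⟩
  · have h0 := h 0
    have h1 := h 1
    have h2 := h 2
    have h3 := h 3
    have h4 := h 4
    unfold constL
    gcongr
  · have h0 : 0 ≤ v 0 := hv 0
    have h1 : 0 ≤ v 1 := hv 1
    have h2 : 0 ≤ v 2 := hv 2
    have h3 : 0 ≤ v 3 := hv 3
    have h4 : 0 ≤ v 4 := hv 4
    unfold constL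
    positivity

lemma isMonotoneConstant_K₁ : IsMonotoneConstant constK₁ {v | 0 ≤ v} := by
  refine ⟨fun v hv w hw h => ?_, fun v hv => ?_⟩
  · have h0 := h 0
    have h1 := h 1
    have h2 := h 2
    unfold constK₁
    gcongr
  · have h0 : 0 ≤ v 0 := hv 0
    have h1 : 0 ≤ v 1 := hv 1
    have h2 : 0 ≤ v 2 := hv 2
    unfold constK₁
    positivity

lemma isMonotoneConstant_K : IsMonotoneConstant (constK d) {v | 0 ≤ v} := by
  refine ⟨fun v hv w hw h => ?_, fun v hv => ?_⟩
  · have h0 := h 0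
    have h1 := h 1
    have hv0 : 0 ≤ v 0 := hv 0
    have hv1 : 0 ≤ v 1 := hv 1
    have hw0 : 0 ≤ w 0 := hw 0
    have hw1 : 0 ≤ w 1 := hw 1
    unfold constK
    refine monotoneOn_gradientConstant (show (0 : ℝ) ≤ _ by positivity)
      (show (0 : ℝ) ≤ _ by positivity) ?_
    gcongr
  · have hv0 : 0 ≤ v 0 := hv 0
    have hv1 : 0 ≤ v 1 := hv 1
    unfold constK gradientConstant
    positivity

end MFG

end

/-! ### The main theorem. -/

theorem mainTheorem6 (d : ℕ) :
    ∃ (L₁ : (Fin 3 → ℝ) → ℝ) (L : (Fin 5 → ℝ) → ℝ) (K₁ : (Fin 3 → ℝ) → ℝ)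
      (K : (Fin 2 → ℝ) → ℝ),
      MFG.IsMonotoneConstant L₁ {v | 0 ≤ v ∧ v 1 < 1} ∧
      MFG.IsMonotoneConstant L {v | 0 ≤ v} ∧
      MFG.IsMonotoneConstant K₁ {v | 0 ≤ v} ∧
      MFG.IsMonotoneConstant K {v | 0 ≤ v} ∧
      ∀ (C₀ τ T : ℝ) (H : MFG.E d → MFG.E d → ℝ) (f g : MFG.E d → ℝ → EReal)
        (m₀ : MFG.E d → ℝ) (u m : MFG.E d → ℝ → ℝ),
        0 < C₀ → 0 ≤ τ → τ < 1 → 0 < T →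
        MFG.AssumptionM m₀ →
        MFG.AssumptionH C₀ τ H →
        MFG.AssumptionF C₀ τ f →
        MFG.AssumptionG g →
        MFG.StrictlyElliptic f →
        MFG.SeparatedPotential H f →
        MFG.Normalised C₀ τ H f m₀ →
        MFG.IsSolution T H f g m₀ u m →
        ∀ l₁ a b l k₁ k : ℝ,
        l₁ = L₁ ![C₀, τ, T] →
        -- `a = f₀⁻¹(L₁)` and `b = f₁⁻¹(-L₁)`
        a = MFG.inv (MFG.minX f) l₁ →
        b = MFG.inv (MFG.maxX f) (-l₁) →
        l = L ![l₁, |MFG.maxX g a|, |MFG.minX g b|,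
          MFG.inv (MFG.minX g) (MFG.maxX g a), 1 / MFG.inv (MFG.maxX g) (MFG.minX g b)] →
        k₁ = K₁ ![l, (MFG.minX f (1 / l))⁻, 1 / T] →
        k = K ![k₁, (MFG.beta f g k₁).toReal] →
        (∀ x, 0 < m x T) ∧
        MFG.supNorm (fun z : MFG.E d × ℝ => u z.1 z.2) (Set.univ ×ˢ Set.Icc 0 T)
            + MFG.supNorm (fun x => m x T) Set.univ
            + MFG.supNorm (fun x => 1 / m x T) Set.univ ≤ ENNReal.ofReal l ∧
        MFG.beta f g k₁ < ⊤ ∧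
        MFG.supNorm (fun z : MFG.E d × ℝ => MFG.normDu T u z.1 z.2)
            (Set.univ ×ˢ Set.Icc 0 T) ≤ ENNReal.ofReal k := by
  refine ⟨MFG.constL₁, MFG.constL, MFG.constK₁, MFG.constK d, MFG.isMonotoneConstant_L₁,
    MFG.isMonotoneConstant_L, MFG.isMonotoneConstant_K₁, MFG.isMonotoneConstant_K, ?_⟩
  intro C₀ τ T H f g m₀ u m hC hτ _ hT hm hH hf hg hse hsep hN hs l₁ a b l k₁ k hl₁ ha hb hl hk₁ hk
  have hS : MFG.Setting C₀ τ T H f g m₀ u m := ⟨hC, hτ, hT, hm, hH, hf, hg, hse, hsep, hN, hs⟩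
  -- The inverses in the statement are choices of preimages; genuine preimages exist, and strict
  -- monotonicity identifies the two.
  obtain ⟨a', ha0, hal⟩ := hf.exists_minX_eq hse hsep l₁
  obtain ⟨b', hb0, hbl⟩ := hf.exists_maxX_eq hse hsep (-l₁)
  obtain rfl : a = a' := ha.trans
    (MFG.inv_eq_of_strictMonoOn hf.coupling.strictMonoOn_minX ha0 hal)
  obtain rfl : b = b' := hb.trans
    (MFG.inv_eq_of_strictMonoOn hf.coupling.strictMonoOn_maxX hb0 hbl)
  -- The first part of `l₁` bounds the coupling at the terminal extrema; the second is the height of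
  -- the comparison quadratic, which enters the bound on `u`.
  have hl₁' : l₁ = (2 * C₀ ^ 2 + 1) * T + 3 * C₀ + 1
      + ((2 * C₀ ^ 2 + 1) * T ^ 2 / 2 + (2 * C₀ + 1) * T) := hl₁
  have hpos₁ : 0 < (2 * C₀ ^ 2 + 1) * T := by positivity
  have hpos₂ : 0 < (2 * C₀ ^ 2 + 1) * T ^ 2 / 2 + (2 * C₀ + 1) * T := by positivity
  obtain ⟨hu₁, hm₁⟩ := hS.upper_bounds (by linarith) ha0 hal
  obtain ⟨hu₂, hc, hm₂⟩ := hS.lower_bounds (by linarith) hb0 hbl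
  set A := MFG.inv (MFG.minX g) (MFG.maxX g a)
  set B := MFG.inv (MFG.maxX g) (MFG.minX g b)
  have hmpos : ∀ x, 0 < m x T := fun x => hc.trans_le (hm₂ x)
  have hA : 0 < A := (hmpos 0).trans_le (hm₁ 0)
  have hB : 0 < 1 / B := one_div_pos.2 hc
  have hl' : l = 1 + l₁ + |MFG.maxX g a| + |MFG.minX g b| + A + 1 / B := hl
  have hga := abs_nonneg (MFG.maxX g a)
  have hgb := abs_nonneg (MFG.minX g b)
  have hlpos : 0 < l := by linarith
  have hu : ∀ x, ∀ t ∈ Set.Icc 0 T, |u x t| ≤ l₁ + |MFG.maxX g a| + |MFG.minX g b| := by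
    intro x t ht
    have h1 := hu₁ x t ht
    have h2 := hu₂ x t ht
    have h3 := le_abs_self (MFG.maxX g a)
    have h4 := neg_abs_le (MFG.minX g b)
    rw [abs_le]
    constructor <;> linarith
  have hminv : ∀ x, 1 / m x T ≤ 1 / B := fun x => one_div_le_one_div_of_le hc (hm₂ x)
  have hk₁' : k₁ = 1 + l + (MFG.minX f (1 / l))⁻ + 1 / T := hk₁
  have hneg : 0 ≤ (MFG.minX f (1 / l))⁻ := negPart_nonneg _
  have hTinv : 0 < 1 / T := one_div_pos.2 hT
  have hβ : MFG.beta f g k₁ < ⊤ := hf.beta_lt_top hse hsep hg.coupling (by linarith)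
  refine ⟨hmpos, ?_, hβ, ?_⟩
  · calc _ ≤ ENNReal.ofReal (l₁ + |MFG.maxX g a| + |MFG.minX g b|) + ENNReal.ofReal A
          + ENNReal.ofReal (1 / B) := by
          gcongr
          · exact MFG.supNorm_le_ofReal fun z hz => hu z.1 z.2 hz.2
          · exact MFG.supNorm_le_ofReal fun x _ => by
              rw [Real.norm_of_nonneg (hmpos x).le]
              exact hm₁ x
          · exact MFG.supNorm_le_ofReal fun x _ => by
              rw [Real.norm_of_nonneg (one_div_pos.2 (hmpos x)).le]
              exact hminv x
      _ = ENNReal.ofReal (l₁ + |MFG.maxX g a| + |MFG.minX g b| + A + 1 / B) := by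
          rw [ENNReal.ofReal_add (by linarith) hB.le, ENNReal.ofReal_add (by linarith) hA.le]
      _ ≤ ENNReal.ofReal l := ENNReal.ofReal_le_ofReal (by linarith)
  -- Here `ω = f₀(1/l)⁻ + l`, so `k₁ = ω + 1 + 1/T` meets both requirements on `k`, and `B` is the
  -- finite value of `β`.
  · have hbounds := hS.reducedBounds (l := l) (k := k₁) (by linarith)
      (fun x t ht => (hu x t ht).trans (by linarith)) (fun x => (hm₁ x).trans (by linarith))
      (fun x => by
        rw [one_div_le hlpos (hmpos x)]
        exact (hminv x).trans (by linarith))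
      rfl (by linarith) (by linarith) ENNReal.toReal_nonneg (ENNReal.ofReal_toReal hβ.ne).ge
    refine MFG.supNorm_le_ofReal fun z hz => ?_
    have hnorm : ‖MFG.normDu T u z.1 z.2‖ = MFG.normDu T u z.1 z.2 :=
      Real.norm_of_nonneg (Real.sqrt_nonneg _)
    rw [hnorm, hk]
    exact MFG.normDu_le hS.reducedSystem hbounds z.1 hz.2
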